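/- Conventions. An index is a finite (possibly empty) sequence $(n_1,\dots,n_r)$ of positive integers, regarded as a word $\mathbf n_1\cdots\mathbf n_r$ in the letters $\mathbf 1,\mathbf 2,\mathbf 3,\dots$. The algebra. Let $\mathcal I$ be the commutative $\mathbb Q$-algebra generated by symbols $\mathbb I(a_0;a_1,\dots,a_N;a_{N+1})$ ($N\ge 0$, $a_i\in\{0,1\}$) subject to: (I1) $\mathbb I(a;\emptyset;b)=1$; (I2) $\mathbb I(a;u;b)\,\mathbb I(a;v;b)=\mathbb I(a;u\mathbin{\mathrm{sh}}v;b)$, where $\mathrm{sh}$ is the shuffle product of words in $\{0,1\}$, extended linearly; (I3) $\mathbb I(a;a_1,\dots,a_N;b)=\sum_{k=0}^N\mathbb I(a;a_1,\dots,a_k;x)\,\mathbb I(x;a_{k+1},\dots,a_N;b)$ for $x\in\{0,1\}$; (I4) $\mathbb I(a;a_1,\dots,a_N;a)=0$ for $N\ge1$. Let $\mathcal I^1=\mathcal I/\mathbb I(0;0;1)\mathcal I$, let $I(\cdots)$ be the image of $\mathbb I(\cdots)$, and put $I(n_1,\dots,n_r)=I(0;1,0^{n_1-1},\dots,1,0^{n_r-1};1)$.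 These elements, over all indices, form a $\mathbb Q$-basis of $\mathcal I^1$. The coproduct is the $\mathbb Q$-linear map $\Delta:\mathcal I^1\to\mathcal I^1\otimes\mathcal I^1$ determined by $$\Delta I(a_0;a_1,\dots,a_N;a_{N+1})=\sum_{0=i_0<i_1<\dots<i_k<i_{k+1}=N+1}\ \prod_{p=0}^k I(a_{i_p};a_{i_p+1},\dots,a_{i_{p+1}-1};a_{i_{p+1}})\otimes I(a_0;a_{i_1},\dots,a_{i_k};a_{N+1}),$$ applied to the basis elements. The two maps. (a) $\mathfrak z^{\mathrm{sh}}:\mathcal I^1\to\mathbb R$ is the $\mathbb Q$-linear map $I(n_1,\dots,n_r)\mapsto\zeta^{\mathrm{sh}}(n_1,\dots,n_r)$, where $\zeta^{\mathrm{sh}}(n_1,\dots,n_r)$ is the shuffle-regularised multiple zeta value: the constant term in $T$ of $Z(1\,0^{n_1-1}\cdots1\,0^{n_r-1})$, for the unique $Z:\mathbb Q+1\,\mathbb Q\langle0,1\rangle\to\mathbb R[T]$ that is an algebra homomorphism for $\mathrm{sh}$ with $Z(1)=T$ for the one-letter word $1$ and $Z(1\,0^{n_1-1}\cdots1\,0^{n_r-1})=\zeta(n_1,\dots,n_r)=\sum_{0<m_1<\dots<m_r}m_1^{-n_1}\cdots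 m_r^{-n_r}$ whenever $n_r\ge2$. (b) For positive integers $k_1,\dots,k_m$ and commuting variables put $$H\tbinom{k_1,\dots,k_m}{y_1,\dots,y_m}=\sum_{0<u_1<\dots<u_m}\ \prod_{j=1}^m e^{u_jy_j}\Big(\frac{q^{u_j}}{1-q^{u_j}}\Big)^{k_j},\qquad h(z_1,\dots,z_r)=\sum_{i_1+\dots+i_m=r,\ i_j\ge 1}\frac1{i_1!\cdots i_m!}\,H\tbinom{i_1,\dots,i_m}{y_1,\dots,y_m},$$ with $y_1=z_1+\dots+z_{i_1}$, $y_2=z_{i_1+1}+\dots+z_{i_1+i_2}$, and so on, and $g_{\mathrm{sh}}(x_1,\dots,x_r)=h(x_r-x_{r-1},\dots,x_2-x_1,x_1)$. Let $g^{\mathrm{sh}}_{n_1,\dots,n_r}(q)\in\mathbb C[[q]]$ be $(-2\pi\sqrt{-1})^{n_1+\dots+n_r}$ times the coefficient of $x_1^{n_1-1}\cdots x_r^{n_r-1}$ in $g_{\mathrm{sh}}(x_1,\dots,x_r)$ (equal to $1$ for $r=0$), and let $\mathfrak g^{\mathrm{sh}}:\mathcal I^1\to\mathbb C[[q]]$ be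 the $\mathbb Q$-linear map $I(n_1,\dots,n_r)\mapsto g^{\mathrm{sh}}_{n_1,\dots,n_r}(q)$. Let $\mathfrak z^{\mathrm{sh}}\otimes\mathfrak g^{\mathrm{sh}}:\mathcal I^1\otimes\mathcal I^1\to\mathbb C[[q]]$ be the map $x\otimes y\mapsto\mathfrak z^{\mathrm{sh}}(x)\,\mathfrak g^{\mathrm{sh}}(y)$. The regularised multiple Eisenstein series is $G^{\mathrm{sh}}_w(q)=(\mathfrak z^{\mathrm{sh}}\otimes\mathfrak g^{\mathrm{sh}})\circ\Delta(I(w))\in\mathbb C[[q]]$. The harmonic product. Let $*$ be the $\mathbb Q$-bilinear product on the space with basis all indices given by $w*\emptyset=\emptyset*w=w$ and $\mathbf m u*\mathbf n v=\mathbf m(u*\mathbf n v)+\mathbf n(\mathbf m u*v)+(\mathbf{m+n})(u*v)$. Let $c_w(x)$ be the coefficient of $w$ in $x$, and let $har:\mathcal I^1\times\mathcal I^1\to\mathcal I^1$ be the $\mathbb Q$-bilinear map with $har(I(w_1),I(w_2))=\sum_w c_w(w_1*w_2)\,I(w)$. Theorem 4.4. For any words $w_1,w_2$ in the letters $\mathbf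 2,\mathbf 3,\mathbf 4,\dots$ one has $$(\mathfrak z^{\mathrm{sh}}\otimes\mathfrak g^{\mathrm{sh}})\circ\Delta\big(har(I(w_1),I(w_2))-I(w_1)I(w_2)\big)=0.$$ Moreover, for such words $G^{\mathrm{sh}}_{w_1}(q)\,G^{\mathrm{sh}}_{w_2}(q)$ equals both $\sum_w c_w(w_1*w_2)\,G^{\mathrm{sh}}_w(q)$ (harmonic product) and $\sum_w s_w\,G^{\mathrm{sh}}_w(q)$ (shuffle product), where both sums run over all indices $w$ and $s_w$ is the coefficient of the $\{0,1\}$-word of $w$ (obtained by replacing each letter $\mathbf n$ by $1\,0^{n-1}$) in the shuffle product of the $\{0,1\}$-words of $w_1$ and $w_2$. -/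

import Mathlib

open scoped TensorProduct

namespace MES

/-- Words in the letters `0, 1`. -/
abbrev Word : Type := List (Fin 2)

/-- Indices `(n₁, …, n_r)` of positive integers, of arbitrary length `r ≥ 0`. -/
abbrev Index : Type := List ℕ+

/-! ### The shuffle product of words -/

/-- The linear map `w ↦ a w` (prepending a letter) on a space with basis all words. -/
noncomputable def prepend {α : Type} (a : α) : (List α →₀ ℚ) →ₗ[ℚ] (List α →₀ ℚ) :=
  Finsupp.lmapDomain ℚ ℚ (List.cons a)

/-- The shuffle product of two words, an element of the space with basis all words:
`a u ⧢ b v = a (u ⧢ b v) + b (a u ⧢ v)`. -/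
noncomputable def shuffle : Word → Word → (Word →₀ ℚ)
  | [], v => Finsupp.single v 1
  | a :: u, [] => Finsupp.single (a :: u) 1
  | a :: u, b :: v => prepend a (shuffle u (b :: v)) + prepend b (shuffle (a :: u) v)
termination_by u v => u.length + v.length

/-! ### The algebra of formal iterated integrals -/

/-- The symbols `𝕀(a₀; a₁, …, a_N; a_{N+1})`, as triples `(a₀, [a₁, …, a_N], a_{N+1})`. -/
abbrev Gen : Type := Fin 2 × Word × Fin 2

open MvPolynomial in
/-- The defining relations (unit, shuffle product, path composition, trivial path). -/
def relations : Set (MvPolynomial Gen ℚ) :=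
  {p | ∃ a b : Fin 2, p = X (a, [], b) - 1} ∪
  {p | ∃ (a b : Fin 2) (u v : Word),
    p = X (a, u, b) * X (a, v, b)
      - Finsupp.linearCombination ℚ (fun w : Word => X (a, w, b)) (shuffle u v)} ∪
  {p | ∃ (a x b : Fin 2) (w : Word),
    p = X (a, w, b)
      - ∑ k ∈ Finset.range (w.length + 1), X (a, w.take k, x) * X (x, w.drop k, b)} ∪
  {p | ∃ (a : Fin 2) (w : Word), w ≠ [] ∧ p = X (a, w, a)}

/-- The commutative `ℚ`-algebra generated by the symbols `𝕀(a₀; a₁, …, a_N; a_{N+1})` subject to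
the above relations. -/
def FormalInt : Type := MvPolynomial Gen ℚ ⧸ Ideal.span relations

noncomputable instance : CommRing FormalInt :=
  inferInstanceAs (CommRing (MvPolynomial Gen ℚ ⧸ Ideal.span relations))

noncomputable instance : Algebra ℚ FormalInt :=
  inferInstanceAs (Algebra ℚ (MvPolynomial Gen ℚ ⧸ Ideal.span relations))

/-- The element `𝕀(a; w; b)`. -/
noncomputable def formalInt (a : Fin 2) (w : Word) (b : Fin 2) : FormalInt :=
  Ideal.Quotient.mk (Ideal.span relations) (MvPolynomial.X (a, w, b))

/-- The quotient algebra by the ideal generated by `𝕀(0; 0; 1)`. -/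
def RegInt : Type := FormalInt ⧸ Ideal.span {formalInt 0 [0] 1}

noncomputable instance : CommRing RegInt :=
  inferInstanceAs (CommRing (FormalInt ⧸ Ideal.span {formalInt 0 [0] 1}))

noncomputable instance : Algebra ℚ RegInt :=
  inferInstanceAs (Algebra ℚ (FormalInt ⧸ Ideal.span {formalInt 0 [0] 1}))

/-- The image `I(a; w; b)` of `𝕀(a; w; b)` in the quotient. -/
noncomputable def regInt (a : Fin 2) (w : Word) (b : Fin 2) : RegInt :=
  Ideal.Quotient.mk (Ideal.span {formalInt 0 [0] 1}) (formalInt a w b)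

/-- The word `1 0^{n₁-1} ⋯ 1 0^{n_r-1}`. -/
def indexWord : Index → Word
  | [] => []
  | n :: l => 1 :: (List.replicate (n.natPred) 0 ++ indexWord l)

/-- `I(n₁, …, n_r) = I(0; 1, 0^{n₁-1}, …, 1, 0^{n_r-1}; 1)`. -/
noncomputable def regIdx (n : Index) : RegInt := regInt 0 (indexWord n) 1

/-! ### Auxiliary facts: the elements `I(n₁, …, n_r)` form a basis -/

section Basis

lemma shuffle_nil_left (v : Word) : shuffle [] v = Finsupp.single v 1 := by
  simp [shuffle]

lemma shuffle_nil_right (u : Word) : shuffle u [] = Finsupp.single u 1 := by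
  cases u <;> simp [shuffle]

lemma shuffle_cons (a b : Fin 2) (u v : Word) : shuffle (a :: u) (b :: v) =
    prepend a (shuffle u (b :: v)) + prepend b (shuffle (a :: u) v) := by
  rw [shuffle]

/-- The bilinear extension of the shuffle product. -/
noncomputable def shMul : (Word →₀ ℚ) →ₗ[ℚ] (Word →₀ ℚ) →ₗ[ℚ] (Word →₀ ℚ) :=
  Finsupp.linearCombination ℚ fun u => Finsupp.linearCombination ℚ (shuffle u)

lemma shMul_single (u v : Word) :
    shMul (Finsupp.single u 1) (Finsupp.single v 1) = shuffle u v := by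
  simp [shMul]

lemma prepend_single {α : Type} (a : α) (u : List α) (c : ℚ) :
    prepend a (Finsupp.single u c) = Finsupp.single (a :: u) c := by
  simp [prepend]

lemma word_induction {p : (Word →₀ ℚ) → Prop} (h0 : p 0) (hs : ∀ w, p (Finsupp.single w 1))
    (ha : ∀ x y, p x → p y → p (x + y)) (hc : ∀ (c : ℚ) x, p x → p (c • x)) (x : Word →₀ ℚ) :
    p x := by
  induction x using Finsupp.induction_linear with
  | zero => exact h0
  | add f g hf hg => exact ha _ _ hf hg
  | single a b =>
    have := hc b _ (hs a)
    simpa using this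

/-- Linear maps on the word space agree when they agree on words. -/
lemma word_ext {M : Type} [AddCommGroup M] [Module ℚ M] {f g : (Word →₀ ℚ) →ₗ[ℚ] M}
    (h : ∀ w, f (Finsupp.single w 1) = g (Finsupp.single w 1)) : f = g := by
  ext w; simpa using h w

lemma shMul_one_left (x : Word →₀ ℚ) : shMul (Finsupp.single [] 1) x = x := by
  have : shMul (Finsupp.single [] 1) = LinearMap.id := word_ext fun w => by
    rw [shMul_single, shuffle_nil_left]; rfl
  rw [this]; rfl

lemma shMul_prepend (a b : Fin 2) (x y : Word →₀ ℚ) : shMul (prepend a x) (prepend b y) =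
    prepend a (shMul x (prepend b y)) + prepend b (shMul (prepend a x) y) := by
  induction x using word_induction with
  | h0 => simp
  | ha x x' h h' => simp only [map_add, LinearMap.add_apply, h, h']; abel
  | hc c x h => simp only [map_smul, LinearMap.smul_apply, h, smul_add]
  | hs u =>
    induction y using word_induction with
    | h0 => simp
    | ha x x' h h' => simp only [map_add, h, h']; abel
    | hc c x h => simp only [map_smul, h, smul_add]
    | hs v => simp only [prepend_single, shMul_single, shuffle_cons]

lemma shuffle_comm (u v : Word) : shuffle u v = shuffle v u := by
  match u, v with
  | [], v => rw [shuffle_nil_left, shuffle_nil_right]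
  | a :: u, [] => rw [shuffle_nil_left, shuffle_nil_right]
  | a :: u, b :: v =>
    rw [shuffle_cons, shuffle_cons, shuffle_comm u (b :: v), shuffle_comm (a :: u) v, add_comm]
termination_by u.length + v.length

lemma shMul_comm (x y : Word →₀ ℚ) : shMul x y = shMul y x := by
  have : shMul = shMul.flip := word_ext fun u => word_ext fun v => by
    rw [LinearMap.flip_apply, shMul_single, shMul_single, shuffle_comm]
  conv_lhs => rw [this]
  rfl

lemma shMul_one_right (x : Word →₀ ℚ) : shMul x (Finsupp.single [] 1) = x := by
  rw [shMul_comm, shMul_one_left]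

lemma shMul_assoc_word (u v w : Word) :
    shMul (shMul (Finsupp.single u 1) (Finsupp.single v 1)) (Finsupp.single w 1) =
    shMul (Finsupp.single u 1) (shMul (Finsupp.single v 1) (Finsupp.single w 1)) := by
  match u, v, w with
  | [], v, w => simp only [shMul_one_left]
  | a :: u, [], w => simp only [shMul_one_left, shMul_one_right]
  | a :: u, b :: v, [] => simp only [shMul_one_right]
  | a :: u, b :: v, c :: w =>
    have h1 := shMul_assoc_word u (b :: v) (c :: w)
    have h2 := shMul_assoc_word (a :: u) v (c :: w)
    have h3 := shMul_assoc_word (a :: u) (b :: v) w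
    simp only [← prepend_single] at h1 h2 h3 ⊢
    simp only [shMul_prepend, map_add, LinearMap.add_apply] at h1 h2 h3 ⊢
    rw [h1, h2, ← h3]
    simp only [map_add]
    abel
termination_by u.length + v.length + w.length


lemma shMul_assoc (x y z : Word →₀ ℚ) : shMul (shMul x y) z = shMul x (shMul y z) := by
  induction x using word_induction with
  | h0 => simp
  | ha x x' h h' => simp only [map_add, LinearMap.add_apply, h, h']
  | hc c x h => simp only [map_smul, LinearMap.smul_apply, h]
  | hs u =>
    induction y using word_induction with
    | h0 => simp
    | ha x x' h h' => simp only [map_add, LinearMap.add_apply, h, h']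
    | hc c x h => simp only [map_smul, LinearMap.smul_apply, h]
    | hs v =>
      induction z using word_induction with
      | h0 => simp
      | ha x x' h h' => simp only [map_add, h, h']
      | hc c x h => simp only [map_smul, h]
      | hs w => exact shMul_assoc_word u v w

/-- The shuffle algebra on words in `0, 1`. -/
def Sh : Type := Word →₀ ℚ

noncomputable instance : AddCommGroup Sh := inferInstanceAs (AddCommGroup (Word →₀ ℚ))
noncomputable instance : Module ℚ Sh := inferInstanceAs (Module ℚ (Word →₀ ℚ))

noncomputable instance : CommRing Sh :=
  { (inferInstance : AddCommGroup Sh) with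
    mul := fun x y => shMul x y
    one := Finsupp.single [] 1
    mul_assoc := shMul_assoc
    one_mul := shMul_one_left
    mul_one := shMul_one_right
    left_distrib := fun x y z => map_add (shMul x) y z
    right_distrib := fun x y z => LinearMap.map_add₂ shMul x y z
    zero_mul := fun x => LinearMap.map_zero₂ shMul x
    mul_zero := fun x => map_zero (shMul x)
    mul_comm := shMul_comm }

noncomputable instance : Algebra ℚ Sh :=
  Algebra.ofModule (fun c x y => LinearMap.map_smul₂ shMul c x y) (fun c x y => map_smul (shMul x) c y)

/-- A word as an element of the shuffle algebra. -/
noncomputable def wd (w : Word) : Sh := Finsupp.single w (1 : ℚ)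

lemma wd_nil : wd [] = 1 := rfl

lemma wd_mul (u v : Word) : wd u * wd v = shuffle u v := shMul_single u v

lemma sh_induction {p : Sh → Prop} (h0 : p 0) (hs : ∀ w, p (wd w))
    (ha : ∀ x y, p x → p y → p (x + y)) (hc : ∀ (c : ℚ) x, p x → p (c • x)) (x : Sh) : p x :=
  word_induction h0 hs ha hc x

lemma sh_ext {M : Type} [AddCommGroup M] [Module ℚ M] {f g : Sh →ₗ[ℚ] M}
    (h : ∀ w, f (wd w) = g (wd w)) : f = g := word_ext (f := f) (g := g) h

/-- The linear map with prescribed values on words. -/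
noncomputable def onWords {M : Type} [AddCommGroup M] [Module ℚ M] (f : Word → M) : Sh →ₗ[ℚ] M :=
  Finsupp.linearCombination (α := Word) ℚ f

lemma onWords_wd {M : Type} [AddCommGroup M] [Module ℚ M] (f : Word → M) (w : Word) :
    onWords f (wd w) = f w :=
  (Finsupp.linearCombination_single ℚ (1 : ℚ) w).trans (one_smul ℚ (f w))

lemma onWords_shuffle {M : Type} [AddCommGroup M] [Module ℚ M] (f : Word → M) (u v : Word) :
    Finsupp.linearCombination ℚ f (shuffle u v) = onWords f (wd u * wd v) := by
  rw [wd_mul]; rfl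

/-- Prepending a letter, on the shuffle algebra. -/
noncomputable def pre (a : Fin 2) : Sh →ₗ[ℚ] Sh := onWords fun w => wd (a :: w)

lemma pre_eq (a : Fin 2) : pre a = prepend a := by
  refine sh_ext fun w => ?_
  rw [pre, onWords_wd]
  exact (prepend_single a w 1).symm

lemma wd_cons (a : Fin 2) (w : Word) : wd (a :: w) = pre a (wd w) := by
  rw [pre, onWords_wd]

lemma pre_mul (a b : Fin 2) (x y : Sh) :
    pre a x * pre b y = pre a (x * pre b y) + pre b (pre a x * y) := by
  rw [pre_eq, pre_eq]; exact shMul_prepend a b x y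

/-- Bilinear induction principle for identities in the shuffle algebra. -/
lemma sh_ext₂ {M : Type} [AddCommGroup M] [Module ℚ M] {f g : Sh →ₗ[ℚ] Sh →ₗ[ℚ] M}
    (h : ∀ u v, f (wd u) (wd v) = g (wd u) (wd v)) : f = g :=
  sh_ext fun u => sh_ext fun v => h u v

/-- Removing a given first letter. -/
noncomputable def der (c : Fin 2) : Sh →ₗ[ℚ] Sh := onWords fun w =>
  match w with
  | [] => 0
  | a :: w => if a = c then wd w else 0

lemma der_one (c : Fin 2) : der c 1 = 0 := by rw [← wd_nil, der, onWords_wd]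

lemma der_cons (c a : Fin 2) (w : Word) : der c (wd (a :: w)) = if a = c then wd w else 0 := by
  rw [der, onWords_wd]

lemma der_pre (c a : Fin 2) (x : Sh) : der c (pre a x) = if a = c then x else 0 := by
  induction x using sh_induction with
  | h0 => simp
  | hs w => rw [← wd_cons, der_cons]
  | ha x y hx hy => simp only [map_add, hx, hy]; split_ifs <;> simp
  | hc c x hx => simp only [map_smul, hx]; split_ifs <;> simp

lemma der_mul (c : Fin 2) (x y : Sh) : der c (x * y) = der c x * y + x * der c y := by
  induction x using sh_induction with
  | h0 => simp
  | ha x x' h h' => simp only [map_add, add_mul, h, h']; abel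
  | hc c x h => simp only [map_smul, smul_mul_assoc, h, smul_add]
  | hs u =>
    induction y using sh_induction with
    | h0 => simp
    | ha x x' h h' => simp only [map_add, mul_add, h, h']; abel
    | hc c x h => simp only [map_smul, mul_smul_comm, h, smul_add]
    | hs v =>
      match u, v with
      | [], v => rw [wd_nil, one_mul, der_one, zero_mul, one_mul, zero_add]
      | a :: u, [] => rw [wd_nil, mul_one, der_one, mul_zero, mul_one, add_zero]
      | a :: u, b :: v =>
        simp only [wd_cons, pre_mul, map_add, der_pre]
        split_ifs <;> simp

/-- The coefficient of the empty word. -/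
noncomputable def eps : Sh →ₗ[ℚ] ℚ := onWords fun w => if w = [] then 1 else 0

lemma eps_one : eps 1 = 1 := by rw [← wd_nil, eps, onWords_wd]; simp

lemma eps_cons (a : Fin 2) (w : Word) : eps (wd (a :: w)) = 0 := by rw [eps, onWords_wd]; simp

lemma eps_pre (a : Fin 2) (x : Sh) : eps (pre a x) = 0 := by
  induction x using sh_induction with
  | h0 => simp
  | hs w => rw [← wd_cons, eps_cons]
  | ha x y hx hy => simp [hx, hy]
  | hc c x hx => simp [hx]

lemma eps_mul (x y : Sh) : eps (x * y) = eps x * eps y := by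
  induction x using sh_induction with
  | h0 => simp
  | ha x x' h h' => simp only [map_add, add_mul, h, h']
  | hc c x h => simp only [map_smul, smul_mul_assoc, h]
  | hs u =>
    induction y using sh_induction with
    | h0 => simp
    | ha x x' h h' => simp only [map_add, mul_add, h, h']
    | hc c x h => simp only [map_smul, mul_smul_comm, h]
    | hs v =>
      match u, v with
      | [], v => rw [wd_nil, one_mul, eps_one, one_mul]
      | a :: u, [] => rw [wd_nil, mul_one, eps_one, mul_one]
      | a :: u, b :: v =>
        simp only [wd_cons, pre_mul, map_add, eps_pre]
        simp

/-- The coefficient of a word. -/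
noncomputable def coef (w : Word) : Sh →ₗ[ℚ] ℚ := Finsupp.lapply (α := Word) w

lemma coef_wd (w v : Word) : coef w (wd v) = if v = w then 1 else 0 :=
  Finsupp.single_apply (α := Word) (a := v) (a' := w) (b := (1 : ℚ))

lemma coef_nil (x : Sh) : coef [] x = eps x := by
  have : coef [] = eps := sh_ext fun w => by
    rw [eps, onWords_wd, coef_wd]
  rw [this]

lemma coef_cons (a : Fin 2) (w : Word) (x : Sh) : coef (a :: w) x = coef w (der a x) := by
  have : coef (a :: w) = coef w ∘ₗ der a := sh_ext fun v => by
    rw [LinearMap.comp_apply]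
    cases v with
    | nil => rw [wd_nil, der_one, map_zero, ← wd_nil, coef_wd]; simp
    | cons b v =>
      rw [der_cons, coef_wd]
      split_ifs with h h' h'
      · rw [coef_wd, if_pos (List.cons.inj h).2]
      · exact absurd (List.cons.inj h).1 h'
      · rw [coef_wd, if_neg]; rintro rfl; exact h (by rw [h'])
      · rw [map_zero]
  rw [this]; rfl

lemma sh_eq_zero {x : Sh} (h0 : eps x = 0) (h : ∀ c, der c x = 0) : x = 0 := by
  refine Finsupp.ext (α := Word) (M := ℚ) fun w => ?_
  change coef w x = 0
  cases w with
  | nil => rw [coef_nil, h0]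
  | cons a w => rw [coef_cons, h, map_zero]

/-- Appending a letter. -/
noncomputable def app (a : Fin 2) : Sh →ₗ[ℚ] Sh := onWords fun w => wd (w ++ [a])

lemma app_wd (a : Fin 2) (w : Word) : app a (wd w) = wd (w ++ [a]) := by rw [app, onWords_wd]

lemma app_pre (a b : Fin 2) (x : Sh) : app a (pre b x) = pre b (app a x) := by
  have : app a ∘ₗ pre b = pre b ∘ₗ app a := sh_ext fun w => by
    simp only [LinearMap.comp_apply, ← wd_cons, app_wd, List.cons_append]
  exact LinearMap.congr_fun this x

lemma wd_snoc_mul (a b : Fin 2) (u v : Word) : wd (u ++ [a]) * wd (v ++ [b]) =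
    app a (wd u * wd (v ++ [b])) + app b (wd (u ++ [a]) * wd v) := by
  match u, v with
  | [], [] =>
    simp only [List.nil_append, wd_cons, wd_nil, pre_mul, one_mul, mul_one, app_pre]
    rw [← wd_nil]; simp only [app_wd, List.nil_append, wd_cons]; abel
  | [], c :: v =>
    have h := wd_snoc_mul a b [] v
    simp only [List.nil_append, List.cons_append, wd_cons, wd_nil, pre_mul, one_mul,
      map_add, app_pre] at h ⊢
    rw [h]
    simp only [← app_wd, ← wd_nil, map_add]
    rw [← wd_cons]
    simp only [wd_cons]
    abel
  | c :: u, [] =>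
    have h := wd_snoc_mul a b u []
    simp only [List.nil_append, List.cons_append, wd_cons, wd_nil, pre_mul, mul_one,
      map_add, app_pre] at h ⊢
    rw [h]
    simp only [← app_wd, ← wd_nil, map_add]
    abel
  | c :: u, d :: v =>
    have h1 := wd_snoc_mul a b u (d :: v)
    have h2 := wd_snoc_mul a b (c :: u) v
    simp only [List.cons_append, wd_cons, pre_mul, map_add, app_pre] at h1 h2 ⊢
    rw [h1, h2]
    simp only [map_add]
    abel
termination_by u.length + v.length

/-- Reversal of words. -/
noncomputable def rev : Sh →ₗ[ℚ] Sh := onWords fun w => wd w.reverse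

lemma rev_wd (w : Word) : rev (wd w) = wd w.reverse := by rw [rev, onWords_wd]

lemma rev_pre (a : Fin 2) (x : Sh) : rev (pre a x) = app a (rev x) := by
  have : rev ∘ₗ pre a = app a ∘ₗ rev := sh_ext fun w => by
    simp only [LinearMap.comp_apply, ← wd_cons, app_wd, rev_wd, List.reverse_cons]
  exact LinearMap.congr_fun this x

lemma rev_mul_wd (u v : Word) : rev (wd u * wd v) = wd u.reverse * wd v.reverse := by
  match u, v with
  | [], v => rw [wd_nil, one_mul, rev_wd]; simp [wd_nil]
  | a :: u, [] => rw [wd_nil, mul_one, rev_wd]; simp [wd_nil]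
  | a :: u, b :: v =>
    have h1 := rev_mul_wd u (b :: v)
    have h2 := rev_mul_wd (a :: u) v
    rw [List.reverse_cons, List.reverse_cons, wd_snoc_mul, ← List.reverse_cons,
      ← List.reverse_cons, ← h1, ← h2, wd_cons, wd_cons, pre_mul, map_add, rev_pre, rev_pre]
termination_by u.length + v.length

lemma rev_mul (x y : Sh) : rev (x * y) = rev x * rev y := by
  induction x using sh_induction with
  | h0 => simp
  | ha x x' h h' => simp only [map_add, add_mul, h, h']
  | hc c x h => simp only [map_smul, smul_mul_assoc, h]
  | hs u =>
    induction y using sh_induction with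
    | h0 => simp
    | ha x x' h h' => simp only [map_add, mul_add, h, h']
    | hc c x h => simp only [map_smul, mul_smul_comm, h]
    | hs v => rw [rev_mul_wd, rev_wd, rev_wd]

/-- The sign map `w ↦ (-1)^{|w|} w`. -/
noncomputable def sgn : Sh →ₗ[ℚ] Sh := onWords fun w => (-1 : ℚ) ^ w.length • wd w

lemma sgn_wd (w : Word) : sgn (wd w) = (-1 : ℚ) ^ w.length • wd w := by rw [sgn, onWords_wd]

lemma sgn_one : sgn 1 = 1 := by rw [← wd_nil, sgn_wd]; simp

lemma sgn_pre (a : Fin 2) (x : Sh) : sgn (pre a x) = - pre a (sgn x) := by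
  have : sgn ∘ₗ pre a = - (pre a ∘ₗ sgn) := sh_ext fun w => by
    simp only [LinearMap.comp_apply, LinearMap.neg_apply, ← wd_cons, sgn_wd, map_smul,
      List.length_cons, pow_succ]
    simp
  exact LinearMap.congr_fun this x

lemma sgn_mul_wd (u v : Word) : sgn (wd u * wd v) = sgn (wd u) * sgn (wd v) := by
  match u, v with
  | [], v => rw [wd_nil, one_mul, sgn_one, one_mul]
  | a :: u, [] => rw [wd_nil, mul_one, sgn_one, mul_one]
  | a :: u, b :: v =>
    have h1 := sgn_mul_wd u (b :: v)
    have h2 := sgn_mul_wd (a :: u) v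
    simp only [wd_cons, pre_mul, map_add, sgn_pre, neg_mul, mul_neg, neg_neg] at h1 h2 ⊢
    simp only [h1, h2, map_neg, neg_neg]
termination_by u.length + v.length

lemma sgn_mul (x y : Sh) : sgn (x * y) = sgn x * sgn y := by
  induction x using sh_induction with
  | h0 => simp
  | ha x x' h h' => simp only [map_add, add_mul, h, h']
  | hc c x h => simp only [map_smul, smul_mul_assoc, h]
  | hs u =>
    induction y using sh_induction with
    | h0 => simp
    | ha x x' h h' => simp only [map_add, mul_add, h, h']
    | hc c x h => simp only [map_smul, mul_smul_comm, h]
    | hs v => exact sgn_mul_wd u v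

/-- The antipode `w ↦ (-1)^{|w|} (reversed w)`. -/
noncomputable def anti : Sh →ₗ[ℚ] Sh := rev ∘ₗ sgn

lemma anti_wd (w : Word) : anti (wd w) = (-1 : ℚ) ^ w.length • wd w.reverse := by
  rw [anti, LinearMap.comp_apply, sgn_wd, map_smul, rev_wd]

lemma anti_mul (x y : Sh) : anti (x * y) = anti x * anti y := by
  simp only [anti, LinearMap.comp_apply, sgn_mul, rev_mul]

lemma anti_one : anti 1 = 1 := by rw [← wd_nil, anti_wd]; simp

lemma anti_snoc (w : Word) (b : Fin 2) : anti (wd (w ++ [b])) = - pre b (anti (wd w)) := by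
  rw [anti_wd, anti_wd, map_smul, ← wd_cons]
  simp [pow_succ]

lemma eps_anti_cons (a : Fin 2) (w : Word) : eps (anti (wd (a :: w))) = 0 := by
  have : ∀ v : Word, v ≠ [] → eps (wd v) = 0 := fun v hv => by
    rw [eps, onWords_wd, if_neg hv]
  rw [anti_wd, map_smul, this _ (by simp), smul_zero]

/-- Sums over all ways to cut a word into two. -/
noncomputable def cut {M : Type} [AddCommGroup M] (f : Word → Word → M) (w : Word) : M :=
  ∑ k ∈ Finset.range (w.length + 1), f (w.take k) (w.drop k)

lemma cut_nil {M : Type} [AddCommGroup M] (f : Word → Word → M) : cut f [] = f [] [] := by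
  simp [cut]

lemma cut_cons {M : Type} [AddCommGroup M] (f : Word → Word → M) (a : Fin 2) (w : Word) :
    cut f (a :: w) = cut (fun u v => f (a :: u) v) w + f [] (a :: w) := by
  simp [cut, Finset.sum_range_succ' _ (w.length + 1)]

lemma cut_snoc {M : Type} [AddCommGroup M] (f : Word → Word → M) (b : Fin 2) (w : Word) :
    cut f (w ++ [b]) = cut (fun u v => f u (v ++ [b])) w + f (w ++ [b]) [] := by
  rw [cut, List.length_append, List.length_singleton, Finset.sum_range_succ]
  congr 1
  · refine Finset.sum_congr rfl fun k hk => ?_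
    have : k ≤ w.length := by simpa [Nat.lt_succ_iff] using hk
    rw [List.take_append_of_le_length this, List.drop_append_of_le_length this]
  · rw [List.take_of_length_le (by simp), List.drop_eq_nil_of_le (by simp)]

lemma cut_zero {M : Type} [AddCommGroup M] (w : Word) : cut (fun _ _ => (0 : M)) w = 0 := by
  simp [cut]

lemma cut_add {M : Type} [AddCommGroup M] (f g : Word → Word → M) (w : Word) :
    cut (fun u v => f u v + g u v) w = cut f w + cut g w := by
  simp [cut, Finset.sum_add_distrib]

lemma map_cut {M N : Type} [AddCommGroup M] [AddCommGroup N] [Module ℚ M] [Module ℚ N]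
    (l : M →ₗ[ℚ] N) (f : Word → Word → M) (w : Word) :
    l (cut f w) = cut (fun u v => l (f u v)) w := by
  simp [cut]

lemma cut_anti (w : Word) : cut (fun u v => wd u * anti (wd v)) w = if w = [] then 1 else 0 := by
  match h : w with
  | [] => rw [cut_nil, wd_nil, anti_one]; simp
  | a :: w' =>
    rw [if_neg (by simp)]
    have hder : ∀ c, cut (fun u v => der c (wd u) * anti (wd v)) (a :: w') =
        if a = c then (if w' = [] then 1 else 0) else 0 := fun c => by
      rw [cut_cons]
      simp only [der_cons, wd_nil, der_one, zero_mul, add_zero]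
      split_ifs with h1 h2
      · rw [cut_anti w', if_pos h2]
      · rw [cut_anti w', if_neg h2]
      · simp [cut_zero]
    obtain ⟨v', b, hb⟩ : ∃ v' b, a :: w' = v' ++ [b] :=
      ⟨_, _, (List.dropLast_append_getLast (List.cons_ne_nil a w')).symm⟩
    have hlen : v'.length = w'.length := by simpa using (congrArg List.length hb).symm
    have hder' : ∀ c, cut (fun u v => wd u * der c (anti (wd v))) (a :: w') =
        if b = c then (if v' = [] then -1 else 0) else 0 := fun c => by
      rw [hb, cut_snoc]
      simp only [anti_snoc, map_neg, der_pre, wd_nil, anti_one, der_one, mul_zero, add_zero]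
      split_ifs with h1 h2
      · simp only [mul_neg]
        have := cut_anti v'
        rw [if_pos h2] at this
        rw [← this]; simp [cut]
      · simp only [mul_neg]
        have := cut_anti v'
        rw [if_neg h2] at this
        rw [← neg_eq_zero, ← this]; simp [cut]
      · simp [cut_zero]
    refine sh_eq_zero ?_ fun c => ?_
    · rw [map_cut, cut_cons]
      simp only [eps_mul, eps_cons, eps_anti_cons, zero_mul, mul_zero, cut_zero, add_zero]
    · rw [map_cut]
      simp only [der_mul]
      rw [cut_add, hder, hder']
      by_cases hw : w' = []
      · subst hw
        have hv : v' = [] := List.length_eq_zero_iff.mp (by simpa using hlen)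
        subst hv
        have hab : a = b := by simpa using hb
        subst hab
        split_ifs <;> simp
      · have hv : v' ≠ [] := fun hv => hw (List.length_eq_zero_iff.mp (by rw [← hlen, hv]; rfl))
        simp [hw, hv]
termination_by w.length
decreasing_by all_goals simp_all

lemma cut_reverse {M : Type} [AddCommGroup M] (f : Word → Word → M) (w : Word) :
    cut f w.reverse = cut (fun u v => f v.reverse u.reverse) w := by
  rw [cut, cut, ← Finset.sum_range_reflect]
  refine Finset.sum_congr (by simp) fun k hk => ?_
  have hk : k ≤ w.length := by simpa [Nat.lt_succ_iff] using hk
  rw [List.take_reverse, List.drop_reverse, List.length_reverse]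
  congr 3 <;> omega

lemma cut_anti' (w : Word) : cut (fun u v => anti (wd u) * wd v) w = if w = [] then 1 else 0 := by
  have h := cut_anti w.reverse
  rw [cut_reverse] at h
  have h2 := congrArg rev h
  rw [map_cut] at h2
  simp only [rev_mul, anti_wd, rev_wd, map_smul, List.reverse_reverse, List.length_reverse] at h2
  simp only [anti_wd]
  have h3 : rev (1 : Sh) = 1 := by rw [← wd_nil, rev_wd]; rfl
  simp only [List.reverse_eq_nil_iff] at h2
  rw [show (if w = [] then (1 : Sh) else 0) = rev (if w = [] then 1 else 0) by
    split_ifs <;> simp [h3], ← h2]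
  congr 1
  funext u v
  rw [mul_comm]

/-- The value of `𝕀(a; w; b)` in the shuffle algebra. -/
noncomputable def toShGen (g : Gen) : Sh :=
  if g.1 = g.2.2 then eps (wd g.2.1) • 1
  else if g.1 = 0 then wd g.2.1 else anti (wd g.2.1)

lemma toShGen_same (a : Fin 2) (w : Word) :
    toShGen (a, w, a) = if w = [] then 1 else 0 := by
  rw [toShGen, if_pos rfl, eps, onWords_wd]
  split_ifs <;> simp

lemma toShGen_zero_one (w : Word) : toShGen (0, w, 1) = wd w := by simp [toShGen]

lemma toShGen_one_zero (w : Word) : toShGen (1, w, 0) = anti (wd w) := by simp [toShGen]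

lemma onWords_toShGen (a b : Fin 2) (x y : Sh) :
    onWords (fun w => toShGen (a, w, b)) (x * y) =
      onWords (fun w => toShGen (a, w, b)) x * onWords (fun w => toShGen (a, w, b)) y := by
  by_cases hab : a = b
  · subst hab
    have : onWords (fun w => toShGen (a, w, a)) = eps.smulRight (1 : Sh) := sh_ext fun w => by
      rw [onWords_wd]; simp [toShGen]
    rw [this]
    simp [eps_mul, smul_smul, mul_comm]
  · by_cases ha : a = 0
    · have hb : b = 1 := by omega
      subst ha; subst hb
      have : onWords (fun w => toShGen (0, w, 1)) = LinearMap.id := sh_ext fun w => by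
        rw [onWords_wd, toShGen_zero_one]; rfl
      rw [this]; rfl
    · have ha : a = 1 := by omega
      have hb : b = 0 := by omega
      subst ha; subst hb
      have : onWords (fun w => toShGen (1, w, 0)) = anti := sh_ext fun w => by
        rw [onWords_wd, toShGen_one_zero]
      rw [this, anti_mul]

lemma toShGen_path (a x b : Fin 2) (w : Word) :
    cut (fun u v => toShGen (a, u, x) * toShGen (x, v, b)) w = toShGen (a, w, b) := by
  by_cases hax : a = x
  · subst hax
    simp only [toShGen_same]
    cases w with
    | nil => rw [cut_nil]; simp
    | cons c w => rw [cut_cons]; simp [cut_zero]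
  · by_cases hxb : x = b
    · subst hxb
      simp only [toShGen_same]
      induction w using List.reverseRecOn with
      | nil => rw [cut_nil]; simp
      | append_singleton w c _ => rw [cut_snoc]; simp [cut_zero]
    · have hab : a = b := by omega
      subst hab
      rw [toShGen_same]
      by_cases ha : a = 0
      · have hx : x = 1 := by omega
        subst ha; subst hx
        simp only [toShGen_zero_one, toShGen_one_zero]
        exact cut_anti w
      · have ha : a = 1 := by omega
        have hx : x = 0 := by omega
        subst ha; subst hx
        simp only [toShGen_zero_one, toShGen_one_zero]
        exact cut_anti' w

/-- The algebra map from formal iterated integrals to the shuffle algebra. -/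
noncomputable def toSh : FormalInt →ₐ[ℚ] Sh :=
  Ideal.Quotient.liftₐ (Ideal.span relations) (MvPolynomial.aeval toShGen) <| by
    intro p hp
    have : Ideal.span relations ≤ RingHom.ker (MvPolynomial.aeval (R := ℚ) toShGen) := by
      rw [Ideal.span_le]
      rintro p (((⟨a, b, rfl⟩ | ⟨a, b, u, v, rfl⟩) | ⟨a, x, b, w, rfl⟩) | ⟨a, w, hw, rfl⟩)
      · simp only [SetLike.mem_coe, RingHom.mem_ker, map_sub, MvPolynomial.aeval_X, map_one]
        rw [toShGen]
        split_ifs <;> simp [wd_nil, eps_one, anti_one]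
      · simp only [SetLike.mem_coe, RingHom.mem_ker, map_sub, map_mul, MvPolynomial.aeval_X]
        have h : MvPolynomial.aeval toShGen (Finsupp.linearCombination ℚ
            (fun w : Word => (MvPolynomial.X (a, w, b) : MvPolynomial Gen ℚ)) (shuffle u v)) =
            onWords (fun w => toShGen (a, w, b)) (wd u * wd v) := by
          rw [← onWords_shuffle]
          simp [Finsupp.linearCombination_apply, Finsupp.sum, map_sum]
        rw [h, onWords_toShGen, onWords_wd, onWords_wd, sub_self]
      · simp only [SetLike.mem_coe, RingHom.mem_ker, map_sub, map_sum, map_mul,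
          MvPolynomial.aeval_X]
        exact sub_eq_zero.mpr (toShGen_path a x b w).symm
      · simp only [SetLike.mem_coe, RingHom.mem_ker, MvPolynomial.aeval_X]
        rw [toShGen_same, if_neg hw]
    exact this hp

lemma toSh_formalInt (a : Fin 2) (w : Word) (b : Fin 2) :
    toSh (formalInt a w b) = toShGen (a, w, b) := by
  change MvPolynomial.aeval toShGen (MvPolynomial.X (a, w, b)) = _
  rw [MvPolynomial.aeval_X]

/-- The induced map on the quotient. -/
noncomputable def toShQuot : RegInt →ₐ[ℚ] Sh ⧸ Ideal.span {wd [0]} :=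
  Ideal.Quotient.liftₐ (Ideal.span {formalInt 0 [0] 1})
    ((Ideal.Quotient.mkₐ ℚ (Ideal.span {wd [0]})).comp toSh) <| by
    intro p hp
    obtain ⟨q, rfl⟩ := Ideal.mem_span_singleton'.mp hp
    rw [map_mul, AlgHom.comp_apply, AlgHom.comp_apply, toSh_formalInt, toShGen_zero_one]
    rw [Ideal.Quotient.mkₐ_eq_mk]
    rw [Ideal.Quotient.eq_zero_iff_mem.mpr (Ideal.mem_span_singleton_self (wd [0])), mul_zero]

lemma toShQuot_regInt (w : Word) :
    toShQuot (regInt 0 w 1) = Ideal.Quotient.mk (Ideal.span {wd [0]}) (wd w) := by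
  change Ideal.Quotient.mk _ (toSh (formalInt 0 w 1)) = _
  rw [toSh_formalInt, toShGen_zero_one]

/-- Iterated removal of a leading `0` is nilpotent. -/
lemma der_nilpotent (x : Sh) : ∃ K, ∀ k, K ≤ k → ((der 0) ^ k) x = 0 := by
  induction x using sh_induction with
  | h0 => exact ⟨0, by simp⟩
  | ha x y hx hy =>
    obtain ⟨K, hK⟩ := hx
    obtain ⟨L, hL⟩ := hy
    exact ⟨max K L, fun k hk => by
      rw [map_add, hK k (le_trans (le_max_left _ _) hk), hL k (le_trans (le_max_right _ _) hk),
        add_zero]⟩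
  | hc c x hx =>
    obtain ⟨K, hK⟩ := hx
    exact ⟨K, fun k hk => by rw [map_smul, hK k hk, smul_zero]⟩
  | hs w =>
    induction w with
    | nil => exact ⟨1, fun k hk => by
        obtain ⟨j, rfl⟩ := Nat.exists_eq_add_of_le' hk
        rw [pow_succ, Module.End.mul_apply, wd_nil, der_one, map_zero]⟩
    | cons a w ih =>
      obtain ⟨K, hK⟩ := ih
      refine ⟨K + 1, fun k hk => ?_⟩
      obtain ⟨j, rfl⟩ := Nat.exists_eq_add_of_le' hk
      rw [← add_assoc, pow_succ, Module.End.mul_apply, der_cons]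
      split_ifs
      · exact hK _ (by omega)
      · exact map_zero _

lemma der_zero_mul (x : Sh) : der 0 (wd [0] * x) = x + wd [0] * der 0 x := by
  rw [der_mul, der_cons, if_pos rfl, wd_nil, one_mul]

lemma der_pow_zero_mul (k : ℕ) (x : Sh) : ((der 0) ^ (k + 1)) (wd [0] * x) =
    ((k : ℚ) + 1) • ((der 0) ^ k) x + wd [0] * ((der 0) ^ (k + 1)) x := by
  induction k with
  | zero => simp [der_zero_mul]
  | succ k ih =>
    rw [pow_succ' _ (k + 1), Module.End.mul_apply, ih, map_add, map_smul, der_zero_mul,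
      ← Module.End.mul_apply, ← pow_succ', ← Module.End.mul_apply, ← pow_succ', ← add_assoc]
    congr 1
    push_cast
    module

lemma eq_zero_of_der_zero_mul {x : Sh} (h : der 0 (wd [0] * x) = 0) : x = 0 := by
  obtain ⟨K, hK⟩ := der_nilpotent x
  have key : ∀ j k, K ≤ k + j → ((der 0) ^ k) x = 0 := by
    intro j
    induction j with
    | zero => exact fun k hk => hK k hk
    | succ j ih =>
      intro k hk
      have h1 := der_pow_zero_mul k x
      rw [pow_succ, Module.End.mul_apply, h, map_zero, ← pow_succ, ih (k + 1) (by omega), mul_zero,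
        add_zero] at h1
      exact (smul_eq_zero.mp h1.symm).resolve_left (by positivity)
  exact key K 0 (by omega)

lemma exists_der_eq_zero (x : Sh) : ∃ y z, der 0 y = 0 ∧ x = y + wd [0] * z := by
  obtain ⟨K, hK⟩ := der_nilpotent x
  have key : ∀ K (x : Sh), ((der 0) ^ (K + 1)) x = 0 →
      ∃ y z, der 0 y = 0 ∧ x = y + wd [0] * z := by
    intro K
    induction K with
    | zero => exact fun x hx => ⟨x, 0, by simpa using hx, by simp⟩
    | succ K ih =>
      intro x hx
      obtain ⟨y, z, hy, hyz⟩ := ih (x - wd [0] * (((K : ℚ) + 1)⁻¹ • der 0 x)) <| by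
        have hne : ((K : ℚ) + 1) ≠ 0 := by positivity
        have e : ∀ k, ((der 0) ^ k) (der 0 x) = ((der 0) ^ (k + 1)) x := fun k => by
          rw [pow_succ, Module.End.mul_apply]
        rw [map_sub, der_pow_zero_mul, map_smul, map_smul, e, e, hx, smul_smul,
          mul_inv_cancel₀ hne, one_smul, smul_zero, mul_zero, add_zero, sub_self]
      exact ⟨y, z + ((K : ℚ) + 1)⁻¹ • der 0 x, hy, by rw [mul_add, ← add_assoc, ← hyz]; abel⟩
  exact key K x (hK _ (by omega))

/-- The index read off a word: the lengths of the blocks `1 0 ⋯ 0`. -/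
def wordIndex (w : Word) : Index :=
  (w.foldr (fun a (s : ℕ × Index) =>
    if a = 1 then (0, s.1.succPNat :: s.2) else (s.1 + 1, s.2)) (0, [])).2

lemma wordIndex_indexWord (n : Index) : wordIndex (indexWord n) = n := by
  have h : ∀ n : Index, (indexWord n).foldr (fun a (s : ℕ × Index) =>
      if a = 1 then (0, s.1.succPNat :: s.2) else (s.1 + 1, s.2)) (0, []) = (0, n) := by
    intro n
    induction n with
    | nil => rfl
    | cons m n ih =>
      have hr : ∀ k, (List.replicate k (0 : Fin 2)).foldr (fun a (s : ℕ × Index) =>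
          if a = 1 then (0, s.1.succPNat :: s.2) else (s.1 + 1, s.2)) (0, n) = (k, n) := by
        intro k
        induction k with
        | zero => rfl
        | succ k ihk => rw [List.replicate_succ, List.foldr_cons, ihk]; simp
      rw [indexWord, List.foldr_cons, List.foldr_append, ih, hr]
      simp
  rw [wordIndex, h]

lemma indexWord_injective : Function.Injective indexWord :=
  Function.LeftInverse.injective wordIndex_indexWord

lemma exists_replicate_indexWord (w : Word) :
    ∃ k n, w = List.replicate k 0 ++ indexWord n := by
  induction w with
  | nil => exact ⟨0, [], rfl⟩
  | cons a w ih =>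
    obtain ⟨k, n, rfl⟩ := ih
    by_cases ha : a = 0
    · subst ha
      exact ⟨k + 1, n, by rw [List.replicate_succ]; rfl⟩
    · have ha : a = 1 := by omega
      subst ha
      exact ⟨0, k.succPNat :: n, by simp [indexWord]⟩

lemma exists_indexWord (w : Word) (hw : ∀ v, w ≠ 0 :: v) : ∃ n, indexWord n = w := by
  obtain ⟨k, n, rfl⟩ := exists_replicate_indexWord w
  cases k with
  | zero => exact ⟨n, rfl⟩
  | succ k => exact absurd (by rw [List.replicate_succ]; rfl) (hw _)

lemma der_indexWord (n : Index) : der 0 (wd (indexWord n)) = 0 := by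
  cases n with
  | nil => rw [indexWord, wd_nil, der_one]
  | cons m n => rw [indexWord, der_cons, if_neg (by decide)]

/-- The quotient map from polynomials in the symbols. -/
noncomputable def toRegInt : MvPolynomial Gen ℚ →ₐ[ℚ] RegInt :=
  (Ideal.Quotient.mkₐ ℚ (Ideal.span {formalInt 0 [0] 1})).comp
    (Ideal.Quotient.mkₐ ℚ (Ideal.span relations))

lemma toRegInt_X (a : Fin 2) (w : Word) (b : Fin 2) :
    toRegInt (MvPolynomial.X (a, w, b)) = regInt a w b := rfl

lemma toRegInt_surjective : Function.Surjective toRegInt := by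
  intro y
  obtain ⟨x, rfl⟩ := Ideal.Quotient.mk_surjective (I := Ideal.span {formalInt 0 [0] 1}) y
  obtain ⟨p, rfl⟩ := Ideal.Quotient.mk_surjective (I := Ideal.span relations) x
  exact ⟨p, rfl⟩

lemma toRegInt_rel {p : MvPolynomial Gen ℚ} (hp : p ∈ relations) : toRegInt p = 0 := by
  have : Ideal.Quotient.mk (Ideal.span relations) p = 0 :=
    Ideal.Quotient.eq_zero_iff_mem.mpr (Ideal.subset_span hp)
  change Ideal.Quotient.mk (Ideal.span {formalInt 0 [0] 1})
    (Ideal.Quotient.mk (Ideal.span relations) p) = 0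
  rw [this]
  exact map_zero (Ideal.Quotient.mk (Ideal.span {formalInt 0 [0] 1}))

lemma regInt_nil (a b : Fin 2) : regInt a [] b = 1 := by
  have h := toRegInt_rel (p := MvPolynomial.X (a, [], b) - 1)
    (Or.inl (Or.inl (Or.inl ⟨a, b, rfl⟩)))
  rwa [map_sub, map_one, toRegInt_X, sub_eq_zero] at h

lemma regInt_mul (a b : Fin 2) (u v : Word) :
    regInt a u b * regInt a v b = onWords (fun w => regInt a w b) (wd u * wd v) := by
  have h := toRegInt_rel (Or.inl (Or.inl (Or.inr ⟨a, b, u, v, rfl⟩)))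
  rw [map_sub, map_mul, toRegInt_X, toRegInt_X, sub_eq_zero] at h
  rw [h, ← onWords_shuffle]
  simp [Finsupp.linearCombination_apply, Finsupp.sum, map_sum, toRegInt_X]

lemma regInt_path (a x b : Fin 2) (w : Word) :
    regInt a w b = cut (fun u v => regInt a u x * regInt x v b) w := by
  have h := toRegInt_rel (Or.inl (Or.inr ⟨a, x, b, w, rfl⟩))
  rw [map_sub, toRegInt_X, sub_eq_zero, map_sum] at h
  rw [h, cut]
  simp only [map_mul, toRegInt_X]

lemma regInt_same (a : Fin 2) (w : Word) (hw : w ≠ []) : regInt a w a = 0 :=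
  toRegInt_rel (Or.inr ⟨a, w, hw, rfl⟩)

lemma regInt_zero : regInt 0 [0] 1 = 0 :=
  Ideal.Quotient.eq_zero_iff_mem.mpr (Ideal.mem_span_singleton_self (formalInt 0 [0] 1))

/-- The map `w ↦ I(0; w; 1)`. -/
noncomputable def ofSh : Sh →ₗ[ℚ] RegInt := onWords fun w => regInt 0 w 1

lemma ofSh_wd (w : Word) : ofSh (wd w) = regInt 0 w 1 := by rw [ofSh, onWords_wd]

lemma ofSh_mul (x y : Sh) : ofSh (x * y) = ofSh x * ofSh y := by
  induction x using sh_induction with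
  | h0 => simp
  | ha x x' h h' => simp only [map_add, add_mul, h, h']
  | hc c x h => simp only [map_smul, smul_mul_assoc, h]
  | hs u =>
    induction y using sh_induction with
    | h0 => simp
    | ha x x' h h' => simp only [map_add, mul_add, h, h']
    | hc c x h => simp only [map_smul, mul_smul_comm, h]
    | hs v => rw [ofSh_wd, ofSh_wd, regInt_mul, ofSh]

lemma regInt_mem_range (a : Fin 2) (w : Word) (b : Fin 2) :
    regInt a w b ∈ LinearMap.range ofSh := by
  have hone : (1 : RegInt) ∈ LinearMap.range ofSh := ⟨wd [], by rw [ofSh_wd, regInt_nil]⟩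
  by_cases hab : a = b
  · subst hab
    by_cases hw : w = []
    · subst hw; rw [regInt_nil]; exact hone
    · rw [regInt_same a w hw]; exact zero_mem _
  by_cases ha : a = 0
  · have hb : b = 1 := by omega
    subst ha; subst hb
    exact ⟨wd w, ofSh_wd w⟩
  have ha : a = 1 := by omega
  have hb : b = 0 := by omega
  subst ha; subst hb
  induction hn : w.length using Nat.strong_induction_on generalizing w with
  | _ n ih =>
    cases w with
    | nil => rw [regInt_nil]; exact hone
    | cons c w =>
      have h := regInt_path 0 1 0 (c :: w)
      rw [regInt_same 0 _ (by simp), cut_cons, regInt_nil, one_mul] at h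
      rw [eq_neg_of_add_eq_zero_right h.symm]
      refine neg_mem (Submodule.sum_mem _ fun k hk => ?_)
      obtain ⟨y, hy⟩ := ih _ (by rw [← hn, List.length_cons, List.length_drop]; omega)
        (w.drop k) rfl
      exact ⟨wd (c :: w.take k) * y, by rw [ofSh_mul, ofSh_wd, hy]⟩

lemma ofSh_surjective : Function.Surjective ofSh := by
  intro y
  obtain ⟨p, rfl⟩ := toRegInt_surjective y
  induction p using MvPolynomial.induction_on with
  | C c =>
    refine ⟨c • 1, ?_⟩
    rw [map_smul, ← wd_nil, ofSh_wd, regInt_nil, MvPolynomial.C_eq_smul_one, map_smul, map_one]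
  | add p q hp hq =>
    obtain ⟨x, hx⟩ := hp
    obtain ⟨y, hy⟩ := hq
    exact ⟨x + y, by rw [map_add, map_add, hx, hy]⟩
  | mul_X p g hp =>
    obtain ⟨x, hx⟩ := hp
    obtain ⟨y, hy⟩ := regInt_mem_range g.1 g.2.1 g.2.2
    exact ⟨x * y, by rw [ofSh_mul, hx, hy, map_mul]; rfl⟩

lemma regIdx_span : ⊤ ≤ Submodule.span ℚ (Set.range regIdx) := by
  intro y _
  obtain ⟨x, rfl⟩ := ofSh_surjective y
  obtain ⟨y, z, hy, rfl⟩ := exists_der_eq_zero x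
  rw [map_add, ofSh_mul, ofSh_wd, regInt_zero, zero_mul, add_zero]
  have key : ∀ l : Word →₀ ℚ, (∀ w ∈ l.support, regInt 0 w 1 ∈ Submodule.span ℚ
      (Set.range regIdx)) → Finsupp.linearCombination ℚ (fun w => regInt 0 w 1) l ∈
      Submodule.span ℚ (Set.range regIdx) := fun l hl => by
    rw [Finsupp.linearCombination_apply]
    exact Submodule.sum_mem _ fun w hw => Submodule.smul_mem _ _ (hl w hw)
  refine key y fun w hw => ?_
  obtain ⟨n, rfl⟩ := exists_indexWord w <| by
    rintro v rfl
    have h : coef (0 :: v) y = 0 := by rw [coef_cons, hy, map_zero]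
    exact (Finsupp.mem_support_iff (α := Word).mp hw) h
  exact Submodule.subset_span ⟨n, rfl⟩

lemma regIdx_linearIndependent : LinearIndependent ℚ regIdx := by
  rw [linearIndependent_iff]
  intro l hl
  set x : Sh := Finsupp.linearCombination ℚ (fun n => wd (indexWord n)) l with hx
  have h1 : Ideal.Quotient.mk (Ideal.span {wd [0]}) x = 0 := by
    rw [← map_zero toShQuot, ← hl, hx, ← Ideal.Quotient.mkₐ_eq_mk ℚ]
    rw [← AlgHom.toLinearMap_apply, ← AlgHom.toLinearMap_apply, Finsupp.apply_linearCombination,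
      Finsupp.apply_linearCombination]
    congr 2
    funext n
    simp only [Function.comp_apply, AlgHom.toLinearMap_apply, Ideal.Quotient.mkₐ_eq_mk]
    exact (toShQuot_regInt _).symm
  obtain ⟨z, hz⟩ := Ideal.mem_span_singleton'.mp (Ideal.Quotient.eq_zero_iff_mem.mp h1)
  have hd : der 0 x = 0 := by
    rw [hx, Finsupp.apply_linearCombination]
    have : (der 0 ∘ fun n => wd (indexWord n)) = fun _ => 0 := funext der_indexWord
    rw [this]; simp [Finsupp.linearCombination_apply]
  rw [mul_comm] at hz
  have hz0 : z = 0 := eq_zero_of_der_zero_mul (by rw [hz, hd])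
  rw [hz0, mul_zero] at hz
  ext n
  have hc : coef (indexWord n) x = 0 := by rw [← hz, map_zero]
  rw [hx, Finsupp.apply_linearCombination] at hc
  have : (coef (indexWord n) ∘ fun m => wd (indexWord m)) = fun m => if m = n then 1 else 0 := by
    funext m
    rw [Function.comp_apply, coef_wd]
    simp [indexWord_injective.eq_iff]
  rw [this] at hc
  simpa [Finsupp.linearCombination_apply, Finsupp.sum_ite_eq'] using hc

end Basis

/-- The basis of the quotient algebra formed by the elements `I(n₁, …, n_r)`. -/
noncomputable def regBasis : Module.Basis Index ℚ RegInt :=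
  Module.Basis.mk regIdx_linearIndependent regIdx_span

lemma regBasis_apply (n : Index) : regBasis n = regIdx n := by
  rw [regBasis, Module.Basis.mk_apply]


/-! ### The coproduct -/

/-- The letter `a_j` of the sequence `a₀, a₁, …, a_N, a_{N+1}`, for `w = [a₁, …, a_N]`. -/
def letter (a : Fin 2) (w : Word) (b : Fin 2) (j : ℕ) : Fin 2 := (a :: (w ++ [b])).getD j 0

/-- The right-hand side of the coproduct formula for `I(a; w; b)`:
the sum over all `0 = i₀ < i₁ < ⋯ < i_k < i_{k+1} = N + 1` of
`∏ₚ I(a_{iₚ}; a_{iₚ+1}, …, a_{i_{p+1}-1}; a_{i_{p+1}}) ⊗ I(a₀; a_{i₁}, …, a_{i_k}; a_{N+1})`.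
The sequences `i₁ < ⋯ < i_k` are the sublists of `[1, …, N]`. -/
noncomputable def coproductFormula (a : Fin 2) (w : Word) (b : Fin 2) : RegInt ⊗[ℚ] RegInt :=
  ((List.range' 1 w.length).sublists'.map fun i : List ℕ =>
    ((List.zip (0 :: i) (i ++ [w.length + 1])).map fun pq : ℕ × ℕ =>
      regInt (letter a w b pq.1)
        ((List.range' (pq.1 + 1) (pq.2 - pq.1 - 1)).map (letter a w b))
        (letter a w b pq.2)).prod
      ⊗ₜ[ℚ] regInt a (i.map (letter a w b)) b).sum

/-- The coproduct `Δ`, the `ℚ`-linear map given by the coproduct formula on the basis elements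
`I(n₁, …, n_r)`. -/
noncomputable def coproduct : RegInt →ₗ[ℚ] RegInt ⊗[ℚ] RegInt :=
  regBasis.constr ℚ fun n => coproductFormula 0 (indexWord n) 1

/-! ### Regularised multiple zeta values -/

/-- `ζ(n₁, …, n_r) = ∑_{0 < m₁ < ⋯ < m_r} m₁^{-n₁} ⋯ m_r^{-n_r}`, used only for convergent sums
(`r = 0` or `n_r ≥ 2`). -/
noncomputable def mzv (n : Index) : ℝ :=
  ∑' m : {m : Fin n.length → ℕ // StrictMono m ∧ ∀ i, 0 < m i},
    ∏ i, ((m.1 i : ℝ) ^ (n.get i : ℕ))⁻¹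

open Polynomial in
/-- For a word `u` starting with `1`, the value `Z(u 0 1^k)` of the shuffle regularisation map
`Z : ℚ + 1⟨0,1⟩ → ℝ[T]`. It is determined by `Z(u 0) = ζ(u 0)`, `Z(1) = T` and multiplicativity:
`1 ⧢ (u 0 1^k) = (1 ⧢ u) 0 1^k + (k + 1) u 0 1^{k+1}`. -/
noncomputable def zetaRegAux (u : Word) : ℕ → ℝ[X]
  | 0 => C (mzv (wordIndex (u ++ [0])))
  | k + 1 => C ((k : ℝ) + 1)⁻¹ *
      (X * zetaRegAux u k
        - (shuffle [1] u).sum fun v (c : ℚ) => C (c : ℝ) * zetaRegAux v k)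

open Polynomial in
/-- The shuffle regularisation map `Z` on words starting with `1` (or empty): such a word is
either `1^k`, with `Z(1^k) = T^k / k!` since `1 ⧢ ⋯ ⧢ 1 = k! 1^k`, or of the form `u 0 1^k`. -/
noncomputable def zetaReg (w : Word) : ℝ[X] :=
  let k := (w.reverse.takeWhile (· = 1)).length
  match w.reverse.dropWhile (· = 1) with
  | [] => C ((k.factorial : ℝ)⁻¹) * X ^ k
  | _ :: u => zetaRegAux u.reverse k

/-- The regularised multiple zeta value: the constant term in `T` of `Z(1 0^{n₁-1} ⋯ 1 0^{n_r-1})`.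
-/
noncomputable def zetaSh (n : Index) : ℝ := (zetaReg (indexWord n)).coeff 0

/-- The `ℚ`-linear map `I(n₁, …, n_r) ↦ ζ^sh(n₁, …, n_r)`. -/
noncomputable def zMap : RegInt →ₗ[ℚ] ℝ := regBasis.constr ℚ zetaSh

/-! ### The `q`-series -/

/-- The coefficient ring `ℚ[[q]]`. -/
abbrev QSeries : Type := PowerSeries ℚ

/-- Power series over `ℚ[[q]]` in the variables `x₁, x₂, …` (`x_{i+1}` is `X i`). -/
abbrev XSeries : Type := MvPowerSeries ℕ QSeries

/-- `q^u / (1 - q^u)`. -/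
noncomputable def qFrac (u : ℕ) : QSeries := PowerSeries.X ^ u * (1 - PowerSeries.X ^ u)⁻¹

/-- `exp(y)` for a power series `y` without constant term. -/
noncomputable def xExp (y : XSeries) : XSeries := (PowerSeries.exp ℚ).subst y

open scoped Classical in
/-- The part `0 < u₁ < ⋯ < u_m ≤ N` of the sum defining `H`. -/
noncomputable def hTrunc (l : List (ℕ × XSeries)) (N : ℕ) : XSeries :=
  ∑ u ∈ (Fintype.piFinset fun _ : Fin l.length => Finset.Icc 1 N).filter StrictMono,
    ∏ j, xExp (u j • (l.get j).2) * MvPowerSeries.C (qFrac (u j) ^ (l.get j).1)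

/-- The power series
`H(n₁,…,n_m; y₁,…,y_m) = ∑_{0<u₁<⋯<u_m} ∏ⱼ exp(uⱼ yⱼ) (q^{uⱼ} / (1 - q^{uⱼ}))^{nⱼ}`
with all `nⱼ ≥ 1`, for `l = [(n₁, y₁), …, (n_m, y_m)]`. A term with `u_m > N` is divisible
by `q^{N+1}`, so the coefficients of `q^N` are those of the truncated sum. -/
noncomputable def hSeries (l : List (ℕ × XSeries)) : XSeries :=
  fun d => PowerSeries.mk fun N => PowerSeries.coeff N (MvPowerSeries.coeff d (hTrunc l N))

/-- `h(z₁, …, z_r) = ∑ 1 / (i₁! ⋯ i_m!) H(i₁,…,i_m; y₁,…,y_m)`, the sum over all compositions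
`r = i₁ + ⋯ + i_m`, with `y₁ = z₁ + ⋯ + z_{i₁}`, `y₂ = z_{i₁+1} + ⋯ + z_{i₁+i₂}`, and so on. -/
noncomputable def hExp (z : List XSeries) : XSeries :=
  ∑ c : Composition z.length,
    ((c.blocks.map fun i => ((i.factorial : ℚ)⁻¹)).prod) •
      hSeries ((z.splitWrtComposition c).map fun s => (s.length, s.sum))

/-- `x_{i+1} - x_i`, with `x₀ = 0`. -/
noncomputable def xDiff : ℕ → XSeries
  | 0 => MvPowerSeries.X 0
  | i + 1 => MvPowerSeries.X (i + 1) - MvPowerSeries.X i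

/-- `g_sh(x₁, …, x_r) = h(x_r - x_{r-1}, …, x₂ - x₁, x₁)`. -/
noncomputable def gShSeries (r : ℕ) : XSeries := hExp ((List.range r).map xDiff).reverse

/-- The exponent of the monomial `x₁^{n₁-1} ⋯ x_r^{n_r-1}`. -/
noncomputable def exponent (n : Index) : ℕ →₀ ℕ :=
  ∑ i : Fin n.length, Finsupp.single (i : ℕ) ((n.get i : ℕ) - 1)

/-- `g^sh_{n₁,…,n_r}(q)`: the coefficient of `x₁^{n₁-1} ⋯ x_r^{n_r-1}` in `g_sh(x₁, …, x_r)`,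
multiplied by `(-2πi)^{n₁+⋯+n_r}`. -/
noncomputable def gSh (n : Index) : PowerSeries ℂ :=
  (-2 * (Real.pi : ℂ) * Complex.I) ^ (n.map fun k : ℕ+ => (k : ℕ)).sum •
    PowerSeries.map (algebraMap ℚ ℂ) (MvPowerSeries.coeff (exponent n) (gShSeries n.length))

/-- The `ℚ`-linear map `I(n₁, …, n_r) ↦ g^sh_{n₁,…,n_r}(q)`. -/
noncomputable def gMap : RegInt →ₗ[ℚ] PowerSeries ℂ := regBasis.constr ℚ gSh

/-- The map `𝔷^sh ⊗ 𝔤^sh`, `x ⊗ y ↦ 𝔷^sh(x) 𝔤^sh(y)`. -/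
noncomputable def zgMap : RegInt ⊗[ℚ] RegInt →ₗ[ℚ] PowerSeries ℂ :=
  TensorProduct.lift <| LinearMap.mk₂ ℚ (fun x y => ((zMap x : ℝ) : ℂ) • gMap y)
    (fun x x' y => by simp [add_smul])
    (fun c x y => by
      rw [map_smul, Rat.smul_def, Complex.ofReal_mul, Complex.ofReal_ratCast, mul_smul,
        Rat.cast_smul_eq_qsmul])
    (fun x y y' => by simp [smul_add])
    (fun c x y => by rw [map_smul, smul_comm])

/-! ### The harmonic product -/

/-- The harmonic product of two words in the letters `1, 2, 3, …`:
`m u ∗ n v = m (u ∗ n v) + n (m u ∗ v) + (m + n) (u ∗ v)`. -/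
noncomputable def harmonic : Index → Index → (Index →₀ ℚ)
  | [], v => Finsupp.single v 1
  | m :: u, [] => Finsupp.single (m :: u) 1
  | m :: u, n :: v =>
      prepend m (harmonic u (n :: v)) + prepend n (harmonic (m :: u) v)
        + prepend (m + n) (harmonic u v)
termination_by u v => u.length + v.length

/-- The `ℚ`-bilinear map with `har(I(w₁), I(w₂)) = ∑_w c_w(w₁ ∗ w₂) I(w)`, where `c_w` is the
coefficient of `w`. -/
noncomputable def har : RegInt →ₗ[ℚ] RegInt →ₗ[ℚ] RegInt :=
  regBasis.constr ℚ fun w₁ => regBasis.constr ℚ fun w₂ =>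
    (harmonic w₁ w₂).sum fun w c => c • regIdx w

/-- The regularised multiple Eisenstein series `G^sh_{n₁,…,n_r}(q)`. -/
noncomputable def eisensteinSh (n : Index) : PowerSeries ℂ := zgMap (coproduct (regIdx n))

end MES

/-! The argument lives on functions on words, with the convolution (f * g)(w) = ∑ f(u) g(v) over all
w = uv (`conv`). A character is a function that is multiplicative for a product on words.
Deconcatenation is compatible with the shuffle product (`shConv_mul`) and with the harmonic product
(`harmonicSum_conv`), so in both cases characters are closed under convolution.

Shuffle product. Both 𝔷^sh and 𝔤^sh are algebra homomorphisms. For 𝔷^sh, the shuffle algebra is the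
direct sum of the span of the words not ending in 1 and the ideal generated by the word 1.
Projecting along this ideal reduces the claim to convergent words, where it follows by summing the
coefficients of polylogarithm power series (`zMap_mul`). For 𝔤^sh, put f(u) = q^u/(1 - q^u) and read
0 and 1 as noncommuting variables. The values g^sh are the coefficients of the ordered product of
e^{-u·0} e^{f(u)·1} e^{u·0} over u = N, …, 1, in the limit of large N, and each exponential is a
character (`coeff_gShSeries`, `gMap_mul`).

Write z_{ab}(w) for 𝔷^sh(I(a; w; b)) and γ for 𝔤^sh. Applied to the coproduct formula, 𝔷^sh ⊗ 𝔤^sh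
gives the sum over words v of γ(v) times the convolution z_{0v₁} * [v₁] * z_{v₁v₂} * ⋯ * z_{v_k1}.
Path composition through the base point 0 turns the second factor into a product of the conjugates
z_{0c} * [c] * z_{c0}, followed by z_{01}. The conjugates are infinitesimal characters, and
substituting these for the letters of a character gives a character (`shChar_gapSum`). Hence w ↦
G^sh_w is a shuffle character; multiplicativity of Δ itself is not needed.

Harmonic product, for entries at least 2. Expanding f(u) as a geometric series gives g^sh_n =
∑_{0<l₁<⋯<l_r} ∏ φ_{nᵢ}(lᵢ) with φ_k(l) = (-2πi)^k/(k-1)! ∑_d d^{k-1} q^{ld} (`map_gFam`). Grouping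
the selected letters of the coproduct formula into runs 1 0^j writes G^sh as the convolution ζ * B₁
* B₂ * ⋯ on indices. Here B_l is a combination of the φ_{j+1}(l), with coefficients read off z_{10}
* [0]^j * z_{01} (`subwordSum_indexWord`, `blockValue_multiSum`). By the Lipschitz formula φ_k(l) =
∑_m (lτ + m)^{-k}. The coefficients are precisely those that partial fractions produce for the
multitangent function ∑_{m₁<⋯<m_r} ∏ (lτ + mᵢ)^{-nᵢ} (`tendsto_windowSum`). So B_l is a multitangent
function of lτ; as a nested sum it obeys the harmonic product, and by uniqueness of q-expansions so
does the power series B_l (`harmonicChar_blockGen`). The same holds for ζ, hence for the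
convolution. Modulo q^{N+1} only l ≤ N contribute, so all products are finite.

The vanishing statement follows, since both terms in it are sent to the product of the two
Eisenstein series. -/

namespace MES

/-! ### Deconcatenation and convolution -/

section Convolution

variable {α : Type}

/-- The sum of `F u v` over all ways to write a list as `u ++ v`. -/
def lcut {M : Type} [AddCommMonoid M] : (List α → List α → M) → List α → M
  | F, [] => F [] []
  | F, a :: w => F [] (a :: w) + lcut (fun u v => F (a :: u) v) w

section

variable {M : Type} [AddCommMonoid M]

@[simp] lemma lcut_nil (F : List α → List α → M) : lcut F [] = F [] [] := rfl

lemma lcut_cons (F : List α → List α → M) (a : α) (w : List α) :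
    lcut F (a :: w) = F [] (a :: w) + lcut (fun u v => F (a :: u) v) w := rfl

lemma lcut_congr {F G : List α → List α → M} {w : List α}
    (h : ∀ u v, u ++ v = w → F u v = G u v) : lcut F w = lcut G w := by
  induction w generalizing F G with
  | nil => exact h [] [] rfl
  | cons a w ih =>
    rw [lcut_cons, lcut_cons, h [] _ rfl, ih fun u v huv => h (a :: u) v (by simp [huv])]

lemma lcut_add (F G : List α → List α → M) (w : List α) :
    lcut (fun u v => F u v + G u v) w = lcut F w + lcut G w := by
  induction w generalizing F G with
  | nil => rfl
  | cons a w ih => rw [lcut_cons, lcut_cons, lcut_cons, ih]; abel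

lemma lcut_zero (w : List α) : lcut (fun _ _ => (0 : M)) w = 0 := by
  induction w with
  | nil => rfl
  | cons a w ih => rw [lcut_cons, ih, add_zero]

lemma lcut_eq_zero {F : List α → List α → M} {w : List α}
    (h : ∀ u v, u ++ v = w → F u v = 0) : lcut F w = 0 :=
  (lcut_congr h).trans (lcut_zero w)

lemma map_lcut {N L : Type} [AddCommMonoid N] [FunLike L M N] [AddMonoidHomClass L M N] (l : L)
    (F : List α → List α → M) (w : List α) : l (lcut F w) = lcut (fun u v => l (F u v)) w := by
  induction w generalizing F with
  | nil => rfl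
  | cons a w ih => rw [lcut_cons, lcut_cons, map_add, ih]

lemma lcut_sum {ι : Type} (s : Finset ι) (F : ι → List α → List α → M) (w : List α) :
    lcut (fun u v => ∑ i ∈ s, F i u v) w = ∑ i ∈ s, lcut (F i) w := by
  induction s using Finset.cons_induction with
  | empty => simpa using lcut_zero w
  | cons i s hi ih => simp only [Finset.sum_cons, lcut_add, ih]

lemma lcut_comm {β : Type} (F : List α → List α → List β → List β → M) (w : List α)
    (x : List β) : lcut (fun u v => lcut (F u v) x) w = lcut (fun s t => lcut (fun u v => F u v s t) w) x := by
  induction w generalizing F with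
  | nil => rfl
  | cons a w ih => simp only [lcut_cons, lcut_add, ih]

lemma lcut_append (F : List α → List α → M) (w : List α) (a : α) :
    lcut F (w ++ [a]) = lcut (fun u v => F u (v ++ [a])) w + F (w ++ [a]) [] := by
  induction w generalizing F with
  | nil => rfl
  | cons b w ih => rw [List.cons_append, lcut_cons, ih, lcut_cons, add_assoc]; rfl

lemma lcut_reverse (F : List α → List α → M) (w : List α) :
    lcut F w.reverse = lcut (fun u v => F v.reverse u.reverse) w := by
  induction w generalizing F with
  | nil => rfl
  | cons a w ih =>
    rw [List.reverse_cons, lcut_append, ih, lcut_cons, add_comm]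
    simp

/-- Both ways to cut a list into three parts agree. -/
lemma lcut_lcut (F : List α → List α → List α → M) (w : List α) :
    lcut (fun u v => lcut (fun s t => F s t v) u) w =
      lcut (fun s x => lcut (fun t v => F s t v) x) w := by
  induction w generalizing F with
  | nil => rfl
  | cons a w ih =>
    rw [lcut_cons, lcut_cons, lcut_nil]
    simp only [lcut_cons, lcut_add, ih]
    rw [add_assoc]

end

lemma lcut_mul_left {R : Type} [Semiring R] (c : R) (F : List α → List α → R) (w : List α) :
    lcut (fun u v => c * F u v) w = c * lcut F w :=
  (map_lcut (AddMonoidHom.mulLeft c) F w).symm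

lemma lcut_mul_right {R : Type} [Semiring R] (c : R) (F : List α → List α → R) (w : List α) :
    lcut (fun u v => F u v * c) w = lcut F w * c :=
  (map_lcut (AddMonoidHom.mulRight c) F w).symm

lemma lcut_mul_lcut {β R : Type} [Semiring R] (F : List α → List α → R)
    (G : List β → List β → R) (u : List α) (v : List β) :
    lcut F u * lcut G v = lcut (fun u' u'' => lcut (fun v' v'' => F u' u'' * G v' v'') v) u := by
  simp only [lcut_mul_left, lcut_mul_right]

lemma cut_eq_lcut {M : Type} [AddCommGroup M] (F : Word → Word → M) (w : Word) :
    cut F w = lcut F w := by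
  induction w generalizing F with
  | nil => exact cut_nil F
  | cons a w ih => rw [cut_cons, lcut_cons, ih, add_comm]

variable {R : Type} [CommRing R]

/-- The convolution product of functions on lists. -/
def conv (f g : List α → R) : List α → R := lcut fun u v => f u * g v

/-- The unit of the convolution product. -/
def unitFn : List α → R
  | [] => 1
  | _ :: _ => 0

lemma conv_nil (f g : List α → R) : conv f g [] = f [] * g [] := rfl

lemma conv_cons (f g : List α → R) (a : α) (w : List α) :
    conv f g (a :: w) = f [] * g (a :: w) + conv (fun u => f (a :: u)) g w := rfl

lemma conv_congr {f f' g g' : List α → R} {w : List α}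
    (h : ∀ u v, u ++ v = w → f u = f' u ∧ g v = g' v) : conv f g w = conv f' g' w :=
  lcut_congr fun u v huv => by rw [(h u v huv).1, (h u v huv).2]

lemma conv_mul_conv {β : Type} (f g : List α → R) (f' g' : List β → R) (u : List α)
    (v : List β) : conv f g u * conv f' g' v =
      lcut (fun u' u'' => lcut (fun v' v'' => f u' * g u'' * (f' v' * g' v'')) v) u :=
  lcut_mul_lcut _ _ u v

lemma conv_assoc (f g h : List α → R) : conv (conv f g) h = conv f (conv g h) := by
  funext w
  unfold conv
  simp only [← lcut_mul_right, ← lcut_mul_left]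
  rw [lcut_lcut fun s t v => f s * g t * h v]
  simp only [mul_assoc]

lemma conv_add_left (f f' g : List α → R) : conv (f + f') g = conv f g + conv f' g := by
  funext w; simp only [conv, Pi.add_apply, add_mul, lcut_add]

lemma conv_add_right (f g g' : List α → R) : conv f (g + g') = conv f g + conv f g' := by
  funext w; simp only [conv, Pi.add_apply, mul_add, lcut_add]

lemma conv_zero_left (g : List α → R) : conv 0 g = 0 := by
  funext w; simp only [conv, Pi.zero_apply, zero_mul, lcut_zero]

lemma conv_smul_left (c : R) (f g : List α → R) : conv (c • f) g = c • conv f g := by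
  funext w; simp only [conv, Pi.smul_apply, smul_eq_mul, mul_assoc, lcut_mul_left]

lemma conv_smul_right (c : R) (f g : List α → R) : conv f (c • g) = c • conv f g := by
  funext w
  simp only [conv, Pi.smul_apply, smul_eq_mul, mul_left_comm _ c, lcut_mul_left]

lemma conv_sum_left {ι : Type} (s : Finset ι) (f : ι → List α → R) (g : List α → R) :
    conv (∑ i ∈ s, f i) g = ∑ i ∈ s, conv (f i) g := by
  funext w; simp only [conv, Finset.sum_apply, Finset.sum_mul, lcut_sum]

lemma conv_sum_right {ι : Type} (s : Finset ι) (f : List α → R) (g : ι → List α → R) :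
    conv f (∑ i ∈ s, g i) = ∑ i ∈ s, conv f (g i) := by
  funext w; simp only [conv, Finset.sum_apply, Finset.mul_sum, lcut_sum]

lemma unitFn_conv (f : List α → R) : conv unitFn f = f := by
  funext w
  cases w with
  | nil => simp [conv, unitFn]
  | cons a w =>
    rw [conv_cons, show (fun u => unitFn (a :: u)) = (0 : List α → R) from rfl, conv_zero_left]
    simp [unitFn]

lemma conv_unitFn (f : List α → R) : conv f unitFn = f := by
  funext w
  induction w generalizing f with
  | nil => simp [conv, unitFn]
  | cons a w ih => rw [conv_cons, ih]; simp [unitFn]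

end Convolution

/-! ### Characters of the shuffle algebra -/

/-- The shuffle product of two words is homogeneous. -/
lemma wd_mul_wd_mem_span (u v : Word) : wd u * wd v ∈
    Submodule.span ℚ (wd '' {w | w.length = u.length + v.length}) := by
  induction hn : u.length + v.length using Nat.strong_induction_on generalizing u v with
  | _ n ih =>
    have hpre : ∀ m c x, x ∈ Submodule.span ℚ (wd '' {w | w.length = m}) →
        pre c x ∈ Submodule.span ℚ (wd '' {w | w.length = m + 1}) := by
      intro m c x hx
      induction hx using Submodule.span_induction with
      | mem x hx =>
        obtain ⟨w, hw, rfl⟩ := hx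
        rw [← wd_cons]
        exact Submodule.subset_span ⟨_, by simpa using hw, rfl⟩
      | zero => simp
      | add x y _ _ hx hy => rw [map_add]; exact add_mem hx hy
      | smul c x _ hx => rw [map_smul]; exact Submodule.smul_mem _ _ hx
    match u, v with
    | [], v => rw [wd_nil, one_mul]; exact Submodule.subset_span ⟨_, by simp [← hn], rfl⟩
    | a :: u, [] => rw [wd_nil, mul_one]; exact Submodule.subset_span ⟨_, by simp [← hn], rfl⟩
    | a :: u, b :: v =>
      rw [wd_cons, wd_cons, pre_mul, ← wd_cons, ← wd_cons]
      simp only [List.length_cons] at hn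
      obtain ⟨m, rfl⟩ : ∃ m, n = m + 1 := ⟨u.length + v.length + 1, by omega⟩
      exact add_mem (hpre _ _ _ (ih m (by omega) _ _ (by simp; omega)))
        (hpre _ _ _ (ih m (by omega) _ _ (by simp; omega)))

/-- Vanishing of `der 0 x` means that no word in the support starts with 0, and such words are
exactly the words of indices. -/
lemma der_eq_zero_mem_span {x : Sh} (hx : der 0 x = 0) :
    x ∈ Submodule.span ℚ (Set.range fun n => wd (indexWord n)) := by
  have h : x = Finsupp.sum (M := ℚ) (α := Word) x fun w c => c • wd w := by
    have : ∀ w (c : ℚ), c • wd w = Finsupp.single w c := fun w c => by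
      refine (Finsupp.smul_single c w (1 : ℚ)).trans ?_
      rw [smul_eq_mul, mul_one]
    simp only [this]
    exact (Finsupp.sum_single x).symm
  rw [h]
  refine Submodule.sum_mem _ fun w hw => Submodule.smul_mem _ _ ?_
  obtain ⟨n, rfl⟩ := exists_indexWord w <| by
    rintro v rfl
    have h : coef (0 :: v) x = 0 := by rw [coef_cons, hx, map_zero]
    exact (Finsupp.mem_support_iff (α := Word).mp hw) h
  exact Submodule.subset_span ⟨n, rfl⟩

/-- Multiplicativity of linear maps given by their values on the basis. -/
lemma constr_mul {M : Type} [CommRing M] [Algebra ℚ M] (f : Index → M) (φ : Sh →ₗ[ℚ] M)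
    (hφ : ∀ n, φ (wd (indexWord n)) = f n)
    (hmul : ∀ n m, φ (wd (indexWord n) * wd (indexWord m)) = f n * f m) (x y : RegInt) :
    regBasis.constr ℚ f (x * y) = regBasis.constr ℚ f x * regBasis.constr ℚ f y := by
  -- It suffices to compare with `φ` on the kernel of `der 0`. A product of two index words stays in
  -- this kernel because `der 0` is a derivation, so no assumption on `φ` at words starting with 0
  -- is needed.
  have h1 : ∀ x, der 0 x = 0 → regBasis.constr ℚ f (ofSh x) = φ x := fun x hx => by
    refine LinearMap.eqOn_span (f := (regBasis.constr ℚ f) ∘ₗ ofSh) (g := φ) ?_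
      (der_eq_zero_mem_span hx)
    rintro _ ⟨n, rfl⟩
    simp only [LinearMap.comp_apply]
    rw [ofSh_wd, hφ]
    change regBasis.constr ℚ f (regIdx n) = _
    rw [← regBasis_apply, Module.Basis.constr_basis]
  have h2 : (LinearMap.mul ℚ RegInt).compr₂ (regBasis.constr ℚ f) =
      (LinearMap.mul ℚ M).compl₁₂ (regBasis.constr ℚ f) (regBasis.constr ℚ f) := by
    refine regBasis.ext fun n => regBasis.ext fun m => ?_
    simp only [LinearMap.compr₂_apply, LinearMap.compl₁₂_apply, LinearMap.mul_apply',
      Module.Basis.constr_basis]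
    rw [regBasis_apply, regBasis_apply, regIdx, regIdx, ← ofSh_wd, ← ofSh_wd, ← ofSh_mul, h1,
      hmul]
    rw [der_mul, der_indexWord, der_indexWord, zero_mul, mul_zero, add_zero]
  exact LinearMap.congr_fun (LinearMap.congr_fun h2 x) y

section Characters

variable {R : Type} [CommRing R] [Algebra ℚ R]

/-- The convolution product of linear functionals on the shuffle algebra. -/
noncomputable def shConv (f g : Sh →ₗ[ℚ] R) : Sh →ₗ[ℚ] R :=
  onWords (conv (fun w => f (wd w)) (fun w => g (wd w)))

lemma shConv_pre (f g : Sh →ₗ[ℚ] R) (a : Fin 2) (x : Sh) :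
    shConv f g (pre a x) = f 1 * g (pre a x) + shConv (f ∘ₗ pre a) g x := by
  have : shConv f g ∘ₗ pre a = (LinearMap.mulLeft ℚ (f 1)) ∘ₗ g ∘ₗ pre a + shConv (f ∘ₗ pre a) g :=
    sh_ext fun w => by
      simp only [LinearMap.comp_apply, LinearMap.add_apply, LinearMap.mulLeft_apply, ← wd_cons,
        shConv, onWords_wd, conv_cons, wd_nil]
  exact LinearMap.congr_fun this x

/-- Deconcatenation is compatible with the shuffle product. -/
lemma shConv_mul (f g : Sh →ₗ[ℚ] R) (u v : Word) : shConv f g (wd u * wd v) =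
    lcut (fun u' u'' => lcut (fun v' v'' => f (wd u' * wd v') * g (wd u'' * wd v'')) v) u := by
  match u, v with
  | [], v =>
    simp only [wd_nil, one_mul, lcut_nil, shConv, onWords_wd]; rfl
  | a :: u, [] =>
    simp only [wd_nil, mul_one, lcut_nil, shConv, onWords_wd]; rfl
  | a :: u, b :: v =>
    have h1 := shConv_mul (f ∘ₗ pre a) g u (b :: v)
    have h2 := shConv_mul (f ∘ₗ pre b) g (a :: u) v
    have hmul : wd (a :: u) * wd (b :: v) = pre a (wd u * wd (b :: v)) + pre b (wd (a :: u) * wd v) := by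
      simp only [wd_cons, pre_mul]
    rw [hmul, map_add, shConv_pre, shConv_pre, h1, h2, lcut_cons]
    simp only [lcut_cons, lcut_add, LinearMap.comp_apply, wd_nil, one_mul, mul_one,
      ← wd_cons]
    -- The term with both left parts empty carries the whole shuffle on the right; it is split by
    -- its first letter so that each half joins one of the two recursive calls.
    rw [show g (wd (a :: u) * wd (b :: v)) = g (pre a (wd u * wd (b :: v))) +
      g (pre b (wd (a :: u) * wd v)) by rw [hmul, map_add]]
    have h3 : ∀ u' v', f (wd (a :: u') * wd (b :: v')) =
        f (pre a (wd u' * wd (b :: v'))) + f (pre b (wd (a :: u') * wd v')) := fun u' v' => by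
      rw [← map_add, wd_cons, wd_cons, pre_mul]
    simp only [h3, add_mul, lcut_add, mul_add]
    abel
termination_by u.length + v.length

/-- A character of the shuffle algebra, given by its values on words. -/
structure ShChar (f : Word → R) : Prop where
  nil : f [] = 1
  mul : ∀ u v, onWords f (wd u * wd v) = f u * f v

/-- The shuffle product preserves length. This accounts for the normalising power of -2πi, whose
exponent is the weight of the index, that is, the length of its word. -/
lemma ShChar.twist {f : Word → R} (hf : ShChar f) (c : R) : ShChar fun w => c ^ w.length * f w where
  nil := by simp [hf.nil]
  mul u v := by
    have := LinearMap.eqOn_span (f := onWords fun w => c ^ w.length * f w)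
      (g := (LinearMap.mulLeft ℚ (c ^ (u.length + v.length))) ∘ₗ onWords f)
      (s := wd '' {w | w.length = u.length + v.length}) (by
        rintro _ ⟨w, hw, rfl⟩
        simp only [LinearMap.comp_apply, onWords_wd, LinearMap.mulLeft_apply]
        rw [← show w.length = _ from hw]) (wd_mul_wd_mem_span u v)
    rw [this, LinearMap.comp_apply, hf.mul, LinearMap.mulLeft_apply, pow_add]
    ring

lemma ShChar.comp {S : Type} [CommRing S] [Algebra ℚ S] {f : Word → R} (hf : ShChar f)
    (l : R →ₐ[ℚ] S) : ShChar fun w => l (f w) where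
  nil := by rw [hf.nil, map_one]
  mul u v := by
    have : (onWords fun w => l (f w)) = l.toLinearMap ∘ₗ onWords f := sh_ext fun w => by
      rw [onWords_wd, LinearMap.comp_apply, onWords_wd]; rfl
    rw [this, LinearMap.comp_apply, hf.mul, AlgHom.toLinearMap_apply, map_mul]

/-- An infinitesimal character of the shuffle algebra, given by its values on words. -/
def ShInf (f : Word → R) : Prop :=
  ∀ u v, onWords f (wd u * wd v) = f u * unitFn v + unitFn u * f v

lemma onWords_conv (f g : Word → R) : onWords (conv f g) = shConv (onWords f) (onWords g) := by
  simp only [shConv, onWords_wd]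

lemma ShChar.conv {f g : Word → R} (hf : ShChar f) (hg : ShChar g) : ShChar (conv f g) where
  nil := by rw [conv_nil, hf.nil, hg.nil, one_mul]
  mul u v := by
    rw [onWords_conv, shConv_mul]
    simp only [hf.mul, hg.mul]
    rw [conv_mul_conv]
    exact lcut_congr fun _ _ _ => lcut_congr fun _ _ _ => mul_mul_mul_comm _ _ _ _

/-- When a shuffle is cut in two, the left piece is a shuffle of a prefix of `u` and a prefix of
`v`. An infinitesimal character is nonzero there only if one of these prefixes is empty, so it acts
on one word and leaves the other intact. -/
lemma shInf_conv {f g : Word → R} {g' : Word → Word → R} (hf : ShInf f)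
    (hg : ∀ u v, onWords g (wd u * wd v) = g' u v) (u v : Word) :
    onWords (MES.conv f g) (wd u * wd v) =
      MES.conv f (fun u => g' u v) u + MES.conv f (fun v => g' u v) v := by
  rw [onWords_conv, shConv_mul]
  simp only [hf _ _, hg, add_mul, lcut_add]
  congr 1
  · refine lcut_congr fun u' u'' _ => ?_
    simp only [mul_assoc, lcut_mul_left]
    congr 1
    exact congrFun (unitFn_conv fun v => g' u'' v) v
  · rw [lcut_comm]
    refine lcut_congr fun v' v'' _ => ?_
    simp only [mul_comm (unitFn _) (f _), mul_assoc, lcut_mul_left]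
    congr 1
    exact congrFun (unitFn_conv fun u => g' u v'') u

/-- Conjugating a primitive element by a group-like one gives a primitive element: `p * g` satisfies
a Leibniz rule twisted by `g`, and convolving with the inverse `f` on the left turns the spectator
factor `g` into the unit. -/
lemma ShInf.conj {f p g : Word → R} (hp : ShInf p) (hf : ShChar f) (hg : ShChar g)
    (hfg : MES.conv f g = unitFn) : ShInf (MES.conv f (MES.conv p g)) := by
  intro u v
  have h : ∀ u v, onWords (MES.conv p g) (wd u * wd v) =
      MES.conv p g u * g v + g u * MES.conv p g v := fun u v => by
    rw [shInf_conv hp hg.mul]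
    simp only [MES.conv, ← lcut_mul_left, ← lcut_mul_right]
    congr 1
    · exact lcut_congr fun _ _ _ => by ring
    · exact lcut_congr fun _ _ _ => by ring
  rw [onWords_conv, shConv_mul]
  simp only [hf.mul, h, mul_add, lcut_add]
  rw [← hfg, conv_mul_conv, conv_mul_conv]
  congr 1 <;>
    exact lcut_congr fun _ _ _ => lcut_congr fun _ _ _ => mul_mul_mul_comm _ _ _ _

end Characters

end MES

namespace MES

/-! ### Substitution of infinitesimal characters -/

section Substitution

/-- The words of length at most `n`. -/
def wordsLE : ℕ → Finset Word
  | 0 => {[]}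
  | n + 1 => Finset.cons [] ((Finset.univ ×ˢ wordsLE n).map
      ⟨fun p : Fin 2 × Word => p.1 :: p.2, fun p q h => by
        simpa [Prod.ext_iff] using h⟩) (by simp)

lemma sum_wordsLE_zero {M : Type} [AddCommMonoid M] (g : Word → M) :
    ∑ v ∈ wordsLE 0, g v = g [] := by simp [wordsLE]

lemma sum_wordsLE_succ {M : Type} [AddCommMonoid M] (n : ℕ) (g : Word → M) :
    ∑ v ∈ wordsLE (n + 1), g v = g [] + ∑ c, ∑ v ∈ wordsLE n, g (c :: v) := by
  rw [wordsLE, Finset.sum_cons, Finset.sum_map, Finset.sum_product]; rfl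

lemma sum_wordsLE_stable {M : Type} [AddCommMonoid M] {n m : ℕ} (h : n ≤ m) (g : Word → M)
    (hg : ∀ v, n < v.length → g v = 0) : ∑ v ∈ wordsLE m, g v = ∑ v ∈ wordsLE n, g v := by
  induction n generalizing m g with
  | zero =>
    cases m with
    | zero => rfl
    | succ m =>
      rw [sum_wordsLE_succ, sum_wordsLE_zero, Finset.sum_eq_zero fun c _ =>
        Finset.sum_eq_zero fun v _ => hg _ (by simp), add_zero]
  | succ n ih =>
    obtain ⟨m, rfl⟩ := Nat.exists_eq_add_of_le' (show 1 ≤ m by omega)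
    rw [sum_wordsLE_succ, sum_wordsLE_succ]
    congr 1
    exact Finset.sum_congr rfl fun c _ => ih (by omega) _ fun v hv => hg _ (by simpa using hv)

variable {R : Type} [CommRing R]

/-- The indicator function of the one-letter word `c`. -/
def letterFn (c : Fin 2) : Word → R := fun w => if w = [c] then 1 else 0

lemma letterFn_conv_nil (c : Fin 2) (f : Word → R) : conv (letterFn c) f [] = 0 := by
  simp [conv_nil, letterFn]

lemma letterFn_conv_cons (c b : Fin 2) (f : Word → R) (w : Word) :
    conv (letterFn c) f (b :: w) = if b = c then f w else 0 := by
  have h : (fun u : Word => (letterFn c (b :: u) : R)) = (if b = c then 1 else 0 : R) • unitFn := by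
    funext u
    cases u <;> simp [letterFn, unitFn]
  rw [conv_cons, h, conv_smul_left, unitFn_conv]
  simp [letterFn]

/-- The convolution product of the infinitesimal characters `ψ c`, for `c` in a word. -/
def convWord (ψ : Fin 2 → Word → R) : Word → Word → R
  | [] => unitFn
  | c :: v => conv (ψ c) (convWord ψ v)

/-- Each factor vanishes on the empty word and therefore uses up at least one letter. This keeps
every sum over substituted words finite. -/
lemma convWord_eq_zero {ψ : Fin 2 → Word → R} (hψ : ∀ c, ψ c [] = 0) (v w : Word)
    (h : w.length < v.length) : convWord ψ v w = 0 := by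
  induction v generalizing w with
  | nil => simp at h
  | cons c v ih =>
    refine lcut_eq_zero fun u' u'' hu => ?_
    cases u' with
    | nil => rw [hψ, zero_mul]
    | cons b u' =>
      rw [ih _ (by subst hu; simp at h ⊢; omega), mul_zero]

/-- The sum of `B s t` over all ways to split a word into a subword `s` and its complement `t`. -/
def unshuffleSum {M : Type} [AddCommMonoid M] : (Word → Word → M) → Word → M
  | B, [] => B [] []
  | B, c :: v => unshuffleSum (fun s t => B (c :: s) t) v + unshuffleSum (fun s t => B s (c :: t)) v

lemma unshuffleSum_conv_left (f : Word → R) (B : Word → Word → Word → R) (v u : Word) :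
    unshuffleSum (fun s t => conv f (B s t) u) v = conv f (fun u => unshuffleSum (fun s t => B s t u) v) u := by
  induction v generalizing B with
  | nil => rfl
  | cons c v ih =>
    rw [unshuffleSum, ih, ih, ← Pi.add_apply, ← conv_add_right]; rfl

variable [Algebra ℚ R]

/-- A product of primitive elements has the unshuffle coproduct: each factor `ψ c` acts on `u` or on
`v`, which splits `w` into two complementary subwords. -/
lemma convWord_mul {ψ : Fin 2 → Word → R} (hψ : ∀ c, ShInf (ψ c)) (w u v : Word) :
    onWords (convWord ψ w) (wd u * wd v) =
      unshuffleSum (fun s t => convWord ψ s u * convWord ψ t v) w := by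
  induction w generalizing u v with
  | nil =>
    rw [unshuffleSum, convWord]
    have : (onWords unitFn : Sh →ₗ[ℚ] R) = Algebra.linearMap ℚ R ∘ₗ eps := sh_ext fun w => by
      rw [onWords_wd, LinearMap.comp_apply, eps, onWords_wd]
      cases w <;> simp [unitFn]
    have h2 : ∀ w, (unitFn w : R) = algebraMap ℚ R (eps (wd w)) := fun w => by
      rw [← onWords_wd unitFn w, this]; rfl
    rw [this, h2, h2, ← map_mul, ← eps_mul]; rfl
  | cons c w ih =>
    rw [unshuffleSum, convWord, shInf_conv (hψ c) ih]
    congr 1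
    · rw [← unshuffleSum_conv_left]
      simp only [convWord, conv, ← lcut_mul_right, mul_assoc]
    · rw [← unshuffleSum_conv_left]
      simp only [convWord, conv, ← lcut_mul_left, mul_left_comm]

/-- Unshuffling is adjoint to the shuffle product: the coefficient of v in the shuffle of s and t
counts the ways to split v into s and t. The vanishing of `B` allows one length bound for all three
sums, and the induction removes first letters. -/
lemma sum_mul_unshuffleSum (n : ℕ) (g : Sh →ₗ[ℚ] R) (B : Word → Word → R)
    (hB : ∀ s t, n < s.length + t.length → B s t = 0) :
    ∑ v ∈ wordsLE n, g (wd v) * unshuffleSum B v =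
      ∑ s ∈ wordsLE n, ∑ t ∈ wordsLE n, g (wd s * wd t) * B s t := by
  induction n generalizing g B with
  | zero => simp [sum_wordsLE_zero, unshuffleSum, wd_nil]
  | succ n ih =>
    have h1 := fun c => ih (g ∘ₗ pre c) (fun s t => B (c :: s) t) fun s t h =>
      hB _ _ (by simp; omega)
    have h2 := fun c => ih (g ∘ₗ pre c) (fun s t => B s (c :: t)) fun s t h =>
      hB _ _ (by simp; omega)
    -- By `hB` the bound on `t` may be raised by one for free; then the empty `t` is separated from
    -- the `t` with a first letter `d`, to match the recursion of the shuffle product.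
    have e1 : ∀ c, ∑ s ∈ wordsLE n, ∑ t ∈ wordsLE n, g (pre c (wd s * wd t)) * B (c :: s) t =
        ∑ s ∈ wordsLE n, (g (wd (c :: s)) * B (c :: s) [] +
          ∑ d, ∑ t ∈ wordsLE n, g (pre c (wd s * wd (d :: t))) * B (c :: s) (d :: t)) := fun c => by
      refine Finset.sum_congr rfl fun s _ => ?_
      rw [← sum_wordsLE_stable (Nat.le_succ n) _ fun t ht => by
        rw [hB _ _ (by simp; omega), mul_zero], sum_wordsLE_succ, wd_nil, mul_one, ← wd_cons]
    have e2 : ∀ d, ∑ s ∈ wordsLE n, ∑ t ∈ wordsLE n, g (pre d (wd s * wd t)) * B s (d :: t) =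
        ∑ t ∈ wordsLE n, (g (wd (d :: t)) * B [] (d :: t) +
          ∑ c, ∑ s ∈ wordsLE n, g (pre d (wd (c :: s) * wd t)) * B (c :: s) (d :: t)) := fun d => by
      rw [Finset.sum_comm]
      refine Finset.sum_congr rfl fun t _ => ?_
      rw [← sum_wordsLE_stable (Nat.le_succ n) _ fun s hs => by
        rw [hB _ _ (by simp; omega), mul_zero], sum_wordsLE_succ, wd_nil, one_mul, ← wd_cons]
    simp only [LinearMap.comp_apply, ← wd_cons] at h1 h2
    simp only [sum_wordsLE_succ, unshuffleSum, mul_add, Finset.sum_add_distrib, h1, h2, e1, e2]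
    have e3 : ∀ c d s t, g (wd (c :: s) * wd (d :: t)) * B (c :: s) (d :: t) =
        g (pre c (wd s * wd (d :: t))) * B (c :: s) (d :: t) +
        g (pre d (wd (c :: s) * wd t)) * B (c :: s) (d :: t) := fun c d s t => by
      rw [← add_mul, ← map_add, wd_cons, wd_cons, pre_mul]
    simp only [e3, Finset.sum_add_distrib, wd_nil, one_mul, mul_one]
    have e4 : ∑ d, ∑ t ∈ wordsLE n, ∑ c, ∑ s ∈ wordsLE n,
        g (pre d (wd (c :: s) * wd t)) * B (c :: s) (d :: t) = ∑ c, ∑ s ∈ wordsLE n, ∑ d,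
        ∑ t ∈ wordsLE n, g (pre d (wd (c :: s) * wd t)) * B (c :: s) (d :: t) := by
      trans ∑ d, ∑ c, ∑ t ∈ wordsLE n, ∑ s ∈ wordsLE n,
          g (pre d (wd (c :: s) * wd t)) * B (c :: s) (d :: t)
      · exact Finset.sum_congr rfl fun d _ => Finset.sum_comm
      rw [Finset.sum_comm]
      refine Finset.sum_congr rfl fun c _ => ?_
      exact (Finset.sum_congr rfl fun d _ => Finset.sum_comm).trans Finset.sum_comm
    rw [e4]
    abel

/-- Substituting infinitesimal characters for the letters of a character gives a character. -/
lemma shChar_substitute {γ : Word → R} (hγ : ShChar γ) {ψ : Fin 2 → Word → R}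
    (hψ : ∀ c, ShInf (ψ c)) (hψ0 : ∀ c, ψ c [] = 0) :
    ShChar fun w => ∑ v ∈ wordsLE w.length, γ v * convWord ψ v w where
  nil := by simp [sum_wordsLE_zero, hγ.nil, convWord, unitFn]
  mul u v := by
    -- The bound in the substituted sum depends on the word. On the span of words of length at most
    -- `u.length + v.length` one bound serves all, and the linear extension then passes through the
    -- sum.
    have key : ∀ x ∈ Submodule.span ℚ (wd '' {w | w.length ≤ u.length + v.length}),
        onWords (fun w => ∑ v ∈ wordsLE w.length, γ v * convWord ψ v w) x =
        ∑ s ∈ wordsLE (u.length + v.length), γ s * onWords (convWord ψ s) x := by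
      intro x hx
      induction hx using Submodule.span_induction with
      | mem x hx =>
        obtain ⟨w, hw, rfl⟩ := hx
        simp only [onWords_wd]
        exact (sum_wordsLE_stable hw _ fun s hs => by
          rw [convWord_eq_zero hψ0 _ _ hs, mul_zero]).symm
      | zero => simp
      | add x y _ _ hx hy => simp only [map_add, hx, hy, mul_add, Finset.sum_add_distrib]
      | smul c x _ hx => simp only [map_smul, hx, mul_smul_comm, Finset.smul_sum]
    have hsub : {w : Word | w.length = u.length + v.length} ⊆
        {w : Word | w.length ≤ u.length + v.length} := fun w hw => le_of_eq hw
    have hmem := Submodule.span_mono (R := ℚ) (Set.image_mono (f := wd) hsub)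
      (wd_mul_wd_mem_span u v)
    rw [key _ hmem]
    simp only [convWord_mul hψ]
    have := sum_mul_unshuffleSum (u.length + v.length) (onWords γ)
      (fun s t => convWord ψ s u * convWord ψ t v) fun s t h => by
        by_cases hs : u.length < s.length
        · rw [convWord_eq_zero hψ0 _ _ hs, zero_mul]
        · rw [convWord_eq_zero hψ0 t v (by omega), mul_zero]
    simp only [onWords_wd] at this
    rw [this]
    have e : ∀ w : Word, w.length ≤ u.length + v.length →
        ∑ s ∈ wordsLE w.length, γ s * convWord ψ s w =
          ∑ s ∈ wordsLE (u.length + v.length), γ s * convWord ψ s w := fun w hw =>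
      (sum_wordsLE_stable hw _ fun s hs => by rw [convWord_eq_zero hψ0 _ _ hs, mul_zero]).symm
    rw [e u (by omega), e v (by omega), Finset.sum_mul_sum]
    exact Finset.sum_congr rfl fun s _ => Finset.sum_congr rfl fun t _ => by
      rw [hγ.mul]; ring

end Substitution

end MES

namespace MES

/-! ### The coproduct formula as a convolution -/

section Coproduct

variable {R : Type} [CommRing R]

/-- The convolution product `z a v₁ * [v₁] * z v₁ v₂ * ⋯ * z v_k 1`. -/
def chain (z : Fin 2 → Fin 2 → Word → R) : Fin 2 → Word → Word → R
  | a, [] => z a 1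
  | a, c :: v => conv (z a c) (conv (letterFn c) (chain z c v))

/-- The sum over all subwords of a word `w`, where the factors `z a c` are evaluated at the gaps;
`p` is a part of the first gap preceding `w`. -/
def gapSum (z : Fin 2 → Fin 2 → Word → R) : Fin 2 → Word → Word → (Word → R) → R
  | a, p, [], h => z a 1 p * h []
  | a, p, c :: w, h => gapSum z a (p ++ [c]) w h + z a c p * gapSum z c [] w fun v => h (c :: v)

/-- A variant of `chain`, where the argument of the first factor is preceded by `p`. -/
def chainFrom (z : Fin 2 → Fin 2 → Word → R) (a : Fin 2) (p : Word) : Word → Word → R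
  | [] => fun w => z a 1 (p ++ w)
  | c :: v => conv (fun u => z a c (p ++ u)) (conv (letterFn c) (chain z c v))

lemma chainFrom_nil (z : Fin 2 → Fin 2 → Word → R) (a : Fin 2) (v : Word) :
    chainFrom z a [] v = chain z a v := by
  cases v <;> rfl

/-- Both sides expand over the ways to select letters of `w`; the right side sorts them by the
selected word `v`. The prefix `p` records the unselected letters read since the last selection. -/
lemma gapSum_eq (z : Fin 2 → Fin 2 → Word → R) (a : Fin 2) (p w : Word) (h : Word → R) (n : ℕ)
    (hn : w.length ≤ n) :
    gapSum z a p w h = ∑ v ∈ wordsLE n, h v * chainFrom z a p v w := by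
  induction w generalizing a p h n with
  | nil =>
    cases n with
    | zero => simp [gapSum, sum_wordsLE_zero, chainFrom, mul_comm]
    | succ n => simp [gapSum, sum_wordsLE_succ, chainFrom, conv_nil, letterFn, mul_comm]
  | cons b w ih =>
    obtain ⟨n, rfl⟩ := Nat.exists_eq_add_of_le' (show 1 ≤ n from le_trans (by simp) hn)
    rw [gapSum, ih _ _ _ (n + 1) (by simp at hn; omega), ih _ _ _ n (by simpa using hn)]
    -- The next letter `b` is either the first selected letter `c`, which closes the gap `p`, or it
    -- joins the gap.
    have e : ∀ c v, chainFrom z a p (c :: v) (b :: w) = z a c p * (if b = c then chain z c v w else 0)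
        + chainFrom z a (p ++ [b]) (c :: v) w := fun c v => by
      rw [chainFrom, chainFrom, conv_cons, letterFn_conv_cons]
      simp
    have : ∑ c, ∑ v ∈ wordsLE n, h (c :: v) * (z a c p * if b = c then chain z c v w else 0) =
        z a b p * ∑ v ∈ wordsLE n, h (b :: v) * chain z b v w := by
      rw [Finset.sum_eq_single b, Finset.mul_sum]
      · exact Finset.sum_congr rfl fun v _ => by rw [if_pos rfl]; ring
      · intro c _ hc
        exact Finset.sum_eq_zero fun v _ => by rw [if_neg (Ne.symm hc)]; ring
      · simp
    simp only [sum_wordsLE_succ, e, mul_add, Finset.sum_add_distrib, this, chainFrom_nil]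
    simp only [chainFrom, List.append_assoc, List.cons_append, List.nil_append]
    ring

lemma gapSum_eq_sum_chain (z : Fin 2 → Fin 2 → Word → R) (a : Fin 2) (w : Word) (h : Word → R) :
    gapSum z a [] w h = ∑ v ∈ wordsLE w.length, h v * chain z a v w := by
  simp only [gapSum_eq z a [] w h w.length le_rfl, chainFrom_nil]

/-- Functions `z a b` satisfying the path composition formula. -/
structure PathFamily (z : Fin 2 → Fin 2 → Word → R) : Prop where
  same : ∀ a, z a a = unitFn
  path : ∀ a b c, conv (z a b) (z b c) = z a c

/-- Every path from `c` to the next letter is routed through 0, as z c d = z c 0 * z 0 d. Regrouping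
leaves one conjugate z 0 c * [c] * z c 0 per letter, independent of its neighbours. -/
lemma chain_eq {z : Fin 2 → Fin 2 → Word → R} (hz : PathFamily z) (a : Fin 2) (v : Word) :
    chain z a v = conv (z a 0) (conv (convWord (fun c => conv (z 0 c) (conv (letterFn c) (z c 0))) v)
      (z 0 1)) := by
  induction v generalizing a with
  | nil => rw [chain, convWord, unitFn_conv, hz.path]
  | cons c v ih =>
    rw [chain, ih, convWord]
    simp only [← conv_assoc]
    rw [hz.path]

variable [Algebra ℚ R]

/-- This functional is the counit `eps` after the derivation `der c`, which makes it infinitesimal.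
-/
lemma shInf_letterFn (c : Fin 2) : ShInf (letterFn c : Word → R) := by
  have h : (onWords (letterFn c) : Sh →ₗ[ℚ] R) = Algebra.linearMap ℚ R ∘ₗ eps ∘ₗ der c :=
    sh_ext fun w => by
      rw [onWords_wd, LinearMap.comp_apply, LinearMap.comp_apply]
      rcases w with _ | ⟨a, _ | ⟨b, w⟩⟩
      · simp [wd_nil, der_one, letterFn]
      · rw [der_cons, wd_nil, letterFn]
        by_cases hac : a = c <;> simp [hac, eps_one]
      · rw [der_cons, letterFn, if_neg (by simp)]
        split_ifs
        · rw [eps_cons, map_zero]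
        · rw [map_zero, map_zero]
  have h1 : ∀ w, (letterFn c w : R) = algebraMap ℚ R (eps (der c (wd w))) := fun w => by
    rw [← onWords_wd (letterFn c) w, h]; rfl
  have h2 : ∀ w, (unitFn w : R) = algebraMap ℚ R (eps (wd w)) := fun w => by
    cases w with
    | nil => simp [unitFn, wd_nil, eps_one]
    | cons a w => simp [unitFn, eps_cons]
  intro u v
  rw [h, h1, h1, h2, h2, ← map_mul (algebraMap ℚ R),
    ← map_mul (algebraMap ℚ R), ← map_add (algebraMap ℚ R), LinearMap.comp_apply,
    LinearMap.comp_apply, der_mul, map_add eps, eps_mul, eps_mul]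
  rfl

/-- The coproduct formula preserves characters. -/
lemma shChar_gapSum {z : Fin 2 → Fin 2 → Word → R} (hz : PathFamily z) (hc : ∀ a b, ShChar (z a b))
    {γ : Word → R} (hγ : ShChar γ) : ShChar fun w => gapSum z 0 [] w γ := by
  -- The functions `z 0 c` and `z c 0` are convolution inverses, by path composition and triviality
  -- of closed paths, so each conjugate of a letter is infinitesimal.
  have h := (shChar_substitute hγ (ψ := fun c => conv (z 0 c) (conv (letterFn c) (z c 0)))
    (fun c => (shInf_letterFn c).conj (hc 0 c) (hc c 0) (by rw [hz.path, hz.same]))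
    (fun c => by simp [conv_nil, letterFn])).conv (hc 0 1)
  convert h using 1
  funext w
  rw [gapSum_eq_sum_chain]
  have hsum : ∀ n, w.length ≤ n → ∀ u v, u ++ v = w →
      ∑ s ∈ wordsLE u.length, γ s * convWord (fun c => conv (z 0 c) (conv (letterFn c) (z c 0))) s u =
      ∑ s ∈ wordsLE n, γ s * convWord (fun c => conv (z 0 c) (conv (letterFn c) (z c 0))) s u := by
    intro n hn u v huv
    refine (sum_wordsLE_stable (by subst huv; simp at hn; omega) _ fun s hs => ?_).symm
    rw [convWord_eq_zero (fun c => by simp [conv_nil, letterFn]) _ _ hs, mul_zero]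
  rw [conv_congr (f' := ∑ s ∈ wordsLE w.length,
    γ s • convWord (fun c => conv (z 0 c) (conv (letterFn c) (z c 0))) s) (g' := z 0 1)
    fun u v huv => ⟨by rw [hsum _ le_rfl u v huv]; simp, rfl⟩, conv_sum_left]
  simp only [conv_smul_left, Finset.sum_apply, Pi.smul_apply, smul_eq_mul]
  refine Finset.sum_congr rfl fun v _ => ?_
  rw [chain_eq hz, hz.same, unitFn_conv]

end Coproduct

/-- The sum over index sequences is a left-to-right scan of the word, deciding at each position
whether to select it. Multiplicativity of `z` splits the product over gaps. -/
lemma coproductFormula_eq_sum (w : Word) (f : RegInt ⊗[ℚ] RegInt →ₗ[ℚ] PowerSeries ℂ)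
    (z : RegInt → PowerSeries ℂ) (γ : RegInt → PowerSeries ℂ)
    (hzm : ∀ x y, z (x * y) = z x * z y) (hf : ∀ x y, f (x ⊗ₜ y) = z x * γ y) :
    f (coproductFormula 0 w 1) =
      gapSum (fun a b u => z (regInt a u b)) 0 [] w (fun v => γ (regInt 0 v 1)) := by
  set g : ℕ → Fin 2 := letter 0 w 1 with hg
  -- State of the scan: `i₀` is the last selected position, `j` the next candidate, and `m`
  -- positions remain. The positions strictly between `i₀` and `j` form the open gap.
  have key : ∀ m j i₀ (h : Word → PowerSeries ℂ), i₀ < j → j + m = w.length + 1 →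
      ((List.range' j m).sublists'.map fun i : List ℕ =>
        z ((List.zip (i₀ :: i) (i ++ [w.length + 1])).map fun pq : ℕ × ℕ =>
          regInt (g pq.1) ((List.range' (pq.1 + 1) (pq.2 - pq.1 - 1)).map g) (g pq.2)).prod
        * h (i.map g)).sum =
      gapSum (fun a b u => z (regInt a u b)) (g i₀)
        ((List.range' (i₀ + 1) (j - i₀ - 1)).map g) ((List.range' j m).map g) h := by
    intro m
    induction m with
    | zero =>
      intro j i₀ h hij hj
      have hlast : g (w.length + 1) = 1 := by
        simp [hg, letter]
      simp only [add_zero] at hj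
      subst hj
      simp [gapSum, hlast]
    | succ m ih =>
      intro j i₀ h hij hj
      rw [List.range'_succ, List.sublists'_cons, List.map_append, List.sum_append,
        ih (j + 1) i₀ h (by omega) (by omega), List.map_cons, gapSum, List.map_map]
      congr 1
      · congr 1
        obtain ⟨d, rfl⟩ := Nat.exists_eq_add_of_lt hij
        rw [show i₀ + d + 1 + 1 - i₀ - 1 = d + 1 by omega, show i₀ + d + 1 - i₀ - 1 = d by omega,
          List.range'_concat, List.map_append]
        simp; ring_nf
      · have := ih (j + 1) j (fun v => h (g j :: v)) (by omega) (by omega)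
        simp only [show j + 1 - j - 1 = 0 by omega, List.range'_zero, List.map_nil] at this
        rw [← this, ← List.sum_map_mul_left]
        congr 1
        refine List.map_congr_left fun i _ => ?_
        simp only [Function.comp_apply, List.cons_append, List.zip_cons_cons, List.map_cons,
          List.prod_cons, hzm, mul_assoc]
  have hw : (List.range' 1 w.length).map g = w := by
    refine List.ext_getElem (by simp) fun i h1 h2 => ?_
    simp [hg, letter, Nat.add_comm 1 i, List.getElem?_append_left h2, List.getElem?_eq_getElem h2]
  rw [coproductFormula, map_list_sum, List.map_map]
  have := key w.length 1 0 (fun v => γ (regInt 0 v 1)) (by omega) (by omega)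
  rw [hw] at this
  simp only [show g 0 = 0 from rfl, show 1 - 0 - 1 = 0 from rfl, List.range'_zero, List.map_nil] at this
  rw [← this]
  congr 1
  refine List.map_congr_left fun i _ => ?_
  rw [Function.comp_apply, hf]

end MES

namespace MES

/-! ### Multiple sums -/

section MultipleSums

variable {ι α R : Type} [CommRing R]

/-- The one-point multiple sum: `1` on the empty list, `φ i x` on `[i]`, and `0` on longer lists. -/
def pointFn (φ : ι → α → R) (x : α) : List ι → R
  | [] => 1
  | i :: n => φ i x * unitFn n

/-- The sum of `∏ φ iⱼ xⱼ` over the sublists `[x₁, …, x_r]` of `L`. -/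
def multiSum (φ : ι → α → R) : List α → List ι → R
  | [] => unitFn
  | x :: L => conv (pointFn φ x) (multiSum φ L)

lemma unitFn_concat (n : List ι) (i : ι) : (unitFn (n ++ [i]) : R) = 0 := by
  cases n <;> rfl

lemma pointFn_conv_nil (φ : ι → α → R) (x : α) (f : List ι → R) :
    conv (pointFn φ x) f [] = f [] := by simp [conv_nil, pointFn]

lemma pointFn_conv_cons (φ : ι → α → R) (x : α) (f : List ι → R) (i : ι) (n : List ι) :
    conv (pointFn φ x) f (i :: n) = f (i :: n) + φ i x * f n := by
  rw [conv_cons, show (fun u => pointFn φ x (i :: u)) = φ i x • unitFn from rfl, conv_smul_left,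
    unitFn_conv]
  simp [pointFn]

@[simp] lemma multiSum_nil_right (φ : ι → α → R) (L : List α) : multiSum φ L [] = 1 := by
  induction L with
  | nil => rfl
  | cons x L ih => rw [multiSum, pointFn_conv_nil, ih]

lemma multiSum_nil_cons (φ : ι → α → R) (i : ι) (n : List ι) : multiSum φ [] (i :: n) = 0 := rfl

lemma multiSum_cons_cons (φ : ι → α → R) (x : α) (L : List α) (i : ι) (n : List ι) :
    multiSum φ (x :: L) (i :: n) = multiSum φ L (i :: n) + φ i x * multiSum φ L n := by
  rw [multiSum, pointFn_conv_cons]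

lemma multiSum_append (φ : ι → α → R) (L L' : List α) :
    multiSum φ (L ++ L') = conv (multiSum φ L) (multiSum φ L') := by
  induction L with
  | nil => rw [List.nil_append, multiSum, unitFn_conv]
  | cons x L ih => rw [List.cons_append, multiSum, ih, multiSum, conv_assoc]

lemma multiSum_singleton (φ : ι → α → R) (x : α) : multiSum φ [x] = pointFn φ x := by
  rw [multiSum, multiSum, conv_unitFn]

lemma map_multiSum {S : Type} [CommRing S] (l : R →+* S) (φ : ι → α → R) (L : List α)
    (n : List ι) : l (multiSum φ L n) = multiSum (fun i x => l (φ i x)) L n := by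
  induction L generalizing n with
  | nil => cases n <;> simp [multiSum, unitFn]
  | cons x L ih =>
    cases n with
    | nil => simp
    | cons i n => rw [multiSum_cons_cons, multiSum_cons_cons, map_add, map_mul, ih, ih]

lemma multiSum_congr {φ ψ : ι → α → R} {L : List α} {n : List ι}
    (h : ∀ i ∈ n, ∀ x ∈ L, φ i x = ψ i x) : multiSum φ L n = multiSum ψ L n := by
  induction L generalizing n with
  | nil => rfl
  | cons x L ih =>
    cases n with
    | nil => simp
    | cons i n =>
      rw [multiSum_cons_cons, multiSum_cons_cons, ih fun j hj y hy => h j hj y (by simp [hy]),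
        ih fun j hj y hy => h j (by simp [hj]) y (by simp [hy]), h i (by simp) x (by simp)]

lemma multiSum_map {β : Type} (φ : ι → α → R) (e : β → α) (L : List β) (n : List ι) :
    multiSum φ (L.map e) n = multiSum (fun i x => φ i (e x)) L n := by
  induction L generalizing n with
  | nil => rfl
  | cons x L ih =>
    cases n with
    | nil => simp
    | cons i n => rw [List.map_cons, multiSum_cons_cons, multiSum_cons_cons, ih, ih]

lemma multiSum_map_right {κ : Type} (φ : ι → α → R) (e : κ → ι) (L : List α) (n : List κ) :
    multiSum φ L (n.map e) = multiSum (fun i x => φ (e i) x) L n := by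
  induction L generalizing n with
  | nil => cases n <;> rfl
  | cons x L ih =>
    cases n with
    | nil => simp
    | cons i n =>
      have := ih (i :: n)
      rw [List.map_cons] at this
      rw [List.map_cons, multiSum_cons_cons, multiSum_cons_cons, ih, this]

lemma multiSum_smul (c : ι → R) (φ : ι → α → R) (L : List α) (n : List ι) :
    multiSum (fun i x => c i * φ i x) L n = (n.map c).prod * multiSum φ L n := by
  induction L generalizing n with
  | nil => cases n <;> simp [multiSum, unitFn]
  | cons x L ih =>
    cases n with
    | nil => simp
    | cons i n =>
      rw [multiSum_cons_cons, multiSum_cons_cons, ih, ih, List.map_cons, List.prod_cons]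
      ring

lemma multiSum_concat_concat (φ : ι → α → R) (x : α) (L : List α) (i : ι) (n : List ι) :
    multiSum φ (L ++ [x]) (n ++ [i]) = multiSum φ L (n ++ [i]) + multiSum φ L n * φ i x := by
  rw [multiSum_append, multiSum_singleton, conv, lcut_append, add_comm]
  congr 1
  · simp [pointFn]
  · induction n using List.reverseRecOn with
    | nil => simp [pointFn, unitFn]
    | append_singleton n j _ =>
      rw [lcut_append, lcut_eq_zero, zero_add]
      · simp [pointFn, unitFn]
      · intro u v _
        cases v with
        | nil => simp [pointFn, unitFn]
        | cons k v => rw [List.append_assoc, List.cons_append, pointFn, ← List.append_assoc,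
            unitFn_concat, mul_zero, mul_zero]

lemma multiSum_reverse (φ : ι → α → R) (L : List α) (n : List ι) :
    multiSum φ L.reverse n.reverse = multiSum φ L n := by
  induction L generalizing n with
  | nil =>
    cases n with
    | nil => rfl
    | cons i n => rw [List.reverse_cons]; exact unitFn_concat _ _
  | cons x L ih =>
    cases n with
    | nil => simp
    | cons i n =>
      have := ih (i :: n)
      rw [List.reverse_cons] at this
      rw [List.reverse_cons, List.reverse_cons, multiSum_concat_concat, this, ih,
        multiSum_cons_cons, mul_comm]

open scoped Classical in
lemma sum_strictMono_nil [LinearOrder α] (φ : ι → α → R) (s : Finset α) :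
    ∑ u ∈ (Fintype.piFinset fun _ : Fin ([] : List ι).length => s).filter StrictMono,
      ∏ j, φ (([] : List ι).get j) (u j) = 1 := by
  rw [Finset.sum_eq_single fun i : Fin ([] : List ι).length => i.elim0]
  · exact Finset.prod_of_isEmpty (ι := Fin 0) _
  · intro u _ h
    exact absurd (funext fun i => i.elim0) h
  · intro h
    simp only [Finset.mem_filter, Fintype.mem_piFinset] at h
    exact absurd ⟨fun i => i.elim0, fun i => i.elim0⟩ h

open scoped Classical in
/-- The multiple sum as a sum over strictly increasing sequences. -/
lemma sum_strictMono_eq_multiSum [LinearOrder α] (φ : ι → α → R) (L : List α)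
    (hL : L.Pairwise (· < ·)) (n : List ι) (s : Finset α) (hs : ∀ x, x ∈ s ↔ x ∈ L) :
    ∑ u ∈ (Fintype.piFinset fun _ : Fin n.length => s).filter StrictMono,
      ∏ j, φ (n.get j) (u j) = multiSum φ L n := by
  induction L generalizing n s with
  | nil =>
    cases n with
    | nil =>
      rw [multiSum_nil_right, sum_strictMono_nil]
    | cons i n =>
      rw [multiSum_nil_cons, Finset.sum_eq_zero]
      intro u hu
      simp only [Finset.mem_filter, Fintype.mem_piFinset, hs] at hu
      exact absurd (hu.1 ⟨0, by simp⟩) (by simp)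
  | cons x L ih =>
    cases n with
    | nil =>
      rw [multiSum_nil_right, sum_strictMono_nil]
    | cons i n =>
      rw [List.pairwise_cons] at hL
      have hxL : x ∉ L := fun h => lt_irrefl _ (hL.1 x h)
      have ih1 := ih hL.2 (i :: n) L.toFinset (by simp)
      have ih2 := ih hL.2 n L.toFinset (by simp)
      rw [multiSum_cons_cons, ← ih1, ← ih2, Finset.mul_sum]
      change ∑ u ∈ (Fintype.piFinset fun _ : Fin (n.length + 1) => s).filter StrictMono,
        ∏ j : Fin (n.length + 1), φ ((i :: n).get j) (u j) = _
      -- Split by whether the first entry is the least element `x`. If it is not, strict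
      -- monotonicity keeps `x` out of every entry; if it is, the remaining entries lie in `L`.
      rw [← Finset.sum_filter_not_add_sum_filter _ fun u : Fin (n.length + 1) → α => u 0 = x]
      congr 1
      · refine Finset.sum_congr ?_ fun _ _ => rfl
        ext u
        simp only [Finset.mem_filter, Fintype.mem_piFinset, hs, List.mem_cons, List.mem_toFinset]
        constructor
        · rintro ⟨⟨h1, h2⟩, h3⟩
          refine ⟨fun j => ?_, h2⟩
          rcases h1 j with h | h
          · have h0 : u 0 ∈ L := (h1 0).resolve_left h3
            have := hL.1 _ h0
            rw [← h] at this
            exact absurd (h2.monotone (Fin.zero_le j)) (not_le.mpr this)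
          · exact h
        · rintro ⟨h1, h2⟩
          exact ⟨⟨fun j => Or.inr (h1 j), h2⟩, fun h => hxL (h ▸ h1 0)⟩
      · refine Finset.sum_bij' (fun u _ => Fin.tail u) (fun v _ => Fin.cons x v) ?_ ?_ ?_ ?_ ?_
        · intro u hu
          simp only [Finset.mem_filter, Fintype.mem_piFinset, hs, List.mem_cons,
            List.mem_toFinset] at hu ⊢
          obtain ⟨⟨h1, h2⟩, h3⟩ := hu
          refine ⟨fun j => (h1 j.succ).resolve_left fun h => ?_, fun j k hjk =>
            h2 (Fin.succ_lt_succ_iff.mpr hjk)⟩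
          have := h2 (Fin.succ_pos j)
          rw [h3] at this
          exact absurd h this.ne'
        · intro v hv
          simp only [Finset.mem_filter, Fintype.mem_piFinset, hs, List.mem_cons,
            List.mem_toFinset] at hv ⊢
          refine ⟨⟨fun j => ?_, ?_⟩, rfl⟩
          · refine Fin.cases (Or.inl rfl) (fun j => Or.inr ?_) j
            simpa using hv.1 j
          · intro j k
            refine Fin.cases ?_ (fun j => ?_) j <;> refine Fin.cases ?_ (fun k => ?_) k
            · intro h; exact absurd h (lt_irrefl _)
            · intro _; simpa using hL.1 _ (hv.1 k)
            · intro h; exact absurd h (by simp)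
            · intro h; simpa using hv.2 (Fin.succ_lt_succ_iff.mp h)
        · intro u hu
          simp only [Finset.mem_filter] at hu
          rw [← hu.2]
          exact Fin.cons_self_tail u
        · intro v hv
          exact Fin.tail_cons (α := fun _ => α) x v
        · intro u hu
          simp only [Finset.mem_filter] at hu
          rw [Fin.prod_univ_succ (n := n.length), ← hu.2]
          rfl

end MultipleSums

/-! ### Sums over compositions -/

section Compositions

variable {α : Type} {M : Type} [AddCommMonoid M]

lemma lcut_eq_sum (F : List α → List α → M) (w : List α) :
    lcut F w = ∑ k ∈ Finset.range (w.length + 1), F (w.take k) (w.drop k) := by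
  induction w generalizing F with
  | nil => simp
  | cons a w ih =>
    rw [lcut_cons, ih, List.length_cons, Finset.sum_range_succ' _ (w.length + 1), add_comm]
    simp

lemma sum_composition_succ (n : ℕ) (f : List ℕ → M) :
    ∑ c : Composition (n + 1), f c.blocks =
      ∑ k ∈ Finset.range (n + 1), ∑ c : Composition (n - k), f ((k + 1) :: c.blocks) := by
  rw [Finset.sum_sigma']
  symm
  refine Finset.sum_bij (fun x hx => ⟨(x.1 + 1) :: x.2.blocks, ?_, ?_⟩) ?_ ?_ ?_ ?_
  · intro i hi
    rcases List.mem_cons.mp hi with rfl | hi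
    · omega
    · exact x.2.blocks_pos hi
  · simp only [Finset.mem_sigma, Finset.mem_range] at hx
    rw [List.sum_cons, x.2.blocks_sum]; omega
  · intro x _; exact Finset.mem_univ _
  · rintro ⟨k, c⟩ _ ⟨k', c'⟩ _ h
    have h := congrArg Composition.blocks h
    simp only [List.cons.injEq, Nat.add_right_cancel_iff] at h
    obtain ⟨rfl, h⟩ := h
    rw [Composition.ext h]
  · intro c _
    rcases c with ⟨bl, hp, hs⟩
    cases bl with
    | nil => simp at hs
    | cons b bl =>
      have hb := hp (i := b) (by simp)
      simp only [List.sum_cons] at hs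
      refine ⟨⟨b - 1, ⟨bl, fun hi => hp (by simp [hi]), by omega⟩⟩, ?_, ?_⟩
      · simp; omega
      · ext1; simp; omega
  · intro x _; rfl

/-- The sum of `F` over all ways to split a list into nonempty blocks. -/
def blockSum (F : List (List α) → M) (z : List α) : M :=
  ∑ c : Composition z.length, F (z.splitWrtComposition c)

lemma blockSum_nil (F : List (List α) → M) : blockSum F [] = F [] := by
  have h : ∀ c : Composition 0, c.blocks = [] := fun c =>
    List.length_eq_zero_iff.mp (Nat.le_zero.mp c.length_le)
  have : ∀ c : Composition 0, c = Composition.ones 0 := fun c =>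
    Composition.ext ((h c).trans (h _).symm)
  exact (Finset.sum_eq_single (Composition.ones 0) (fun c _ hc => absurd (this c) hc)
    fun h => absurd (Finset.mem_univ _) h)

lemma blockSum_cons (F : List (List α) → M) (a : α) (z : List α) : blockSum F (a :: z) =
    lcut (fun z₁ z₂ => blockSum (fun B => F ((a :: z₁) :: B)) z₂) z := by
  have h := sum_composition_succ z.length fun b => F (List.splitWrtCompositionAux (a :: z) b)
  rw [lcut_eq_sum]
  refine h.trans (Finset.sum_congr rfl fun k hk => ?_)
  rw [blockSum, List.length_drop]
  refine Finset.sum_congr rfl fun c _ => ?_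
  rw [List.splitWrtCompositionAux_cons, List.take_succ_cons, List.drop_succ_cons]
  rfl

lemma blockSum_add (F G : List (List α) → M) (z : List α) :
    blockSum (fun B => F B + G B) z = blockSum F z + blockSum G z := Finset.sum_add_distrib

lemma blockSum_mul {R : Type} [CommRing R] (c : R) (F : List (List α) → R) (z : List α) :
    blockSum (fun B => c * F B) z = c * blockSum F z := (Finset.mul_sum _ _ _).symm

/-- Summing multiple sums over all splittings into blocks gives an iterated convolution. -/
lemma blockSum_multiSum {R X : Type} [CommRing R] (W : List α → X → R) (hW : ∀ x, W [] x = 1)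
    (L : List X) :
    blockSum (multiSum W L) = L.foldr (fun x f => conv (fun B => W B x) f) unitFn := by
  induction L with
  | nil =>
    funext z
    cases z with
    | nil => rw [blockSum_nil]; rfl
    | cons a z =>
      rw [blockSum_cons]
      exact lcut_eq_zero fun u v _ => Finset.sum_eq_zero fun c _ => rfl
  | cons x L ih =>
    funext z
    rw [List.foldr_cons, ← ih]
    cases z with
    | nil => rw [blockSum_nil, conv_nil, blockSum_nil, hW]; simp
    | cons a z =>
      -- The normalisation `W [] x = 1` accounts for the points `x` that carry no block.
      rw [conv_cons, hW, one_mul, blockSum_cons, blockSum_cons, conv]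
      simp only [multiSum_cons_cons, blockSum_add, blockSum_mul, lcut_add]

end Compositions

end MES

namespace MES

/-! ### Exponential characters -/

section LetterExp

open Polynomial in
lemma polynomial_eq_of_derivative_eq {p q : ℚ[X]} (h : derivative p = derivative q)
    (h0 : p.coeff 0 = q.coeff 0) : p = q := by
  ext n
  cases n with
  | zero => exact h0
  | succ n =>
    have := congrArg (fun r => r.coeff n) h
    simp only [coeff_derivative] at this
    exact mul_right_cancel₀ (by positivity) this

open Polynomial in
/-- The generating polynomial of the powers of the letter `a`. -/
noncomputable def letterPoly (a : Fin 2) : Sh →ₗ[ℚ] ℚ[X] :=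
  onWords fun w => if ∀ b ∈ w, b = a then C ((w.length.factorial : ℚ)⁻¹) * X ^ w.length else 0

open Polynomial in
lemma derivative_letterPoly (a : Fin 2) (x : Sh) :
    derivative (letterPoly a x) = letterPoly a (der a x) := by
  have : derivative ∘ₗ letterPoly a = letterPoly a ∘ₗ der a := sh_ext fun w => by
    simp only [LinearMap.comp_apply]
    cases w with
    | nil => rw [wd_nil, der_one, map_zero, ← wd_nil, letterPoly, onWords_wd]; simp
    | cons b w =>
      rw [der_cons]
      by_cases hb : b = a
      · rw [if_pos hb, letterPoly, onWords_wd, onWords_wd]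
        simp only [List.mem_cons, forall_eq_or_imp, hb, true_and]
        split_ifs
        · rw [List.length_cons, derivative_C_mul, derivative_X_pow, ← mul_assoc, ← C_mul,
            Nat.factorial_succ]
          congr 2
          push_cast
          have : (w.length : ℚ) + 1 ≠ 0 := by positivity
          field_simp
        · simp
      · rw [if_neg hb, map_zero, letterPoly, onWords_wd, if_neg (by simp [hb]), derivative_zero]
  exact LinearMap.congr_fun this x

open Polynomial in
lemma letterPoly_coeff_zero (a : Fin 2) (x : Sh) : (letterPoly a x).coeff 0 = eps x := by
  have : (lcoeff ℚ 0) ∘ₗ letterPoly a = eps := sh_ext fun w => by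
    simp only [LinearMap.comp_apply, letterPoly, eps, onWords_wd, lcoeff_apply]
    cases w with
    | nil => simp
    | cons b w => split_ifs <;> simp at *
  exact LinearMap.congr_fun this x

-- Both sides have the same derivative, by induction, since `letterPoly a` carries the derivation
-- `der a` to d/dX; their constant terms agree because `eps` is multiplicative.
open Polynomial in
lemma letterPoly_mul (a : Fin 2) (u v : Word) :
    letterPoly a (wd u * wd v) = letterPoly a (wd u) * letterPoly a (wd v) := by
  have h1 : letterPoly a 1 = 1 := by rw [← wd_nil, letterPoly, onWords_wd]; simp
  refine polynomial_eq_of_derivative_eq ?_ ?_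
  · rw [derivative_letterPoly, derivative_mul, derivative_letterPoly, derivative_letterPoly,
      der_mul, map_add]
    congr 1
    · cases u with
      | nil => rw [wd_nil, der_one]; simp
      | cons b u =>
        rw [der_cons]
        split_ifs
        · exact letterPoly_mul a u v
        · simp
    · cases v with
      | nil => rw [wd_nil, der_one]; simp
      | cons b v =>
        rw [der_cons]
        split_ifs
        · exact letterPoly_mul a u v
        · simp
  · rw [mul_coeff_zero, letterPoly_coeff_zero, letterPoly_coeff_zero, letterPoly_coeff_zero,
      eps_mul]
termination_by u.length + v.length

variable {R : Type} [CommRing R] [Algebra ℚ R]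

/-- The function `a^k ↦ t^{k+j} / (k+j)!`, vanishing on words which are not powers of `a`. -/
noncomputable def letterExpFrom (a : Fin 2) (t : R) (j : ℕ) : Word → R := fun w =>
  if ∀ b ∈ w, b = a then (((w.length + j).factorial : ℚ)⁻¹) • t ^ (w.length + j) else 0

/-- The character `a^k ↦ t^k / k!`, vanishing on words which are not powers of `a`. -/
noncomputable def letterExp (a : Fin 2) (t : R) : Word → R := letterExpFrom a t 0

lemma shChar_letterExp (a : Fin 2) (t : R) : ShChar (letterExp a t) := by
  have h : ∀ w, letterExp a t w = Polynomial.aeval t (letterPoly a (wd w)) := fun w => by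
    rw [letterPoly, onWords_wd, letterExp, letterExpFrom]
    split_ifs
    · simp [Algebra.smul_def]
    · simp
  have h2 : onWords (letterExp a t) = (Polynomial.aeval t).toLinearMap ∘ₗ letterPoly a :=
    sh_ext fun w => by rw [onWords_wd, h]; rfl
  constructor
  · simp [letterExp, letterExpFrom]
  · intro u v
    rw [h2, LinearMap.comp_apply, letterPoly_mul, AlgHom.toLinearMap_apply, map_mul, h, h]

lemma letterExpFrom_nil (a : Fin 2) (t : R) (j : ℕ) :
    letterExpFrom a t j [] = ((j.factorial : ℚ)⁻¹) • t ^ j := by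
  simp [letterExpFrom]

lemma letterExpFrom_cons_self (a : Fin 2) (t : R) (j : ℕ) :
    (fun w => letterExpFrom a t j (a :: w)) = letterExpFrom a t (j + 1) := by
  funext w
  simp only [letterExpFrom, List.mem_cons, forall_eq_or_imp, true_and, List.length_cons]
  rw [show w.length + 1 + j = w.length + (j + 1) by ring]

lemma letterExpFrom_cons_ne {a b : Fin 2} (h : b ≠ a) (t : R) (j : ℕ) :
    (fun w => letterExpFrom a t j (b :: w)) = 0 := by
  funext w
  simp [letterExpFrom, h]

lemma letterExpFrom_conv_cons_self (a : Fin 2) (t : R) (j : ℕ) (f : Word → R) (w : Word) :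
    conv (letterExpFrom a t j) f (a :: w) = (((j.factorial : ℚ)⁻¹) • t ^ j) * f (a :: w) +
      conv (letterExpFrom a t (j + 1)) f w := by
  rw [conv_cons, letterExpFrom_cons_self, letterExpFrom_nil]

lemma letterExpFrom_conv_of_ne {a : Fin 2} (t : R) (j : ℕ) (f : Word → R) (w : Word)
    (hw : ∀ v, w ≠ a :: v) :
    conv (letterExpFrom a t j) f w = (((j.factorial : ℚ)⁻¹) • t ^ j) * f w := by
  cases w with
  | nil => rw [conv_nil, letterExpFrom_nil]
  | cons b w =>
    have hb : b ≠ a := fun h => hw w (by rw [h])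
    rw [conv_cons, letterExpFrom_nil, letterExpFrom_cons_ne hb, conv_zero_left]; simp

lemma indexWord_ne_zero_cons (n : Index) (v : Word) : indexWord n ≠ 0 :: v := by
  cases n <;> simp [indexWord]

/-- The offset `j` counts zeros already absorbed by the exponential, so that the factorial stays
right along the recursion; the first letter 1 stops the absorption. -/
lemma letterExpFrom_conv_replicate (t : R) (j m : ℕ) (f : Word → R) (n : Index) :
    conv (letterExpFrom 0 t j) f (List.replicate m 0 ++ indexWord n) =
      ∑ p ∈ Finset.HasAntidiagonal.antidiagonal m, ((((p.1 + j).factorial : ℚ)⁻¹) • t ^ (p.1 + j)) *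
        f (List.replicate p.2 0 ++ indexWord n) := by
  induction m generalizing j with
  | zero =>
    rw [List.replicate_zero, List.nil_append,
      letterExpFrom_conv_of_ne t j f _ (indexWord_ne_zero_cons n)]
    simp
  | succ m ih =>
    rw [List.replicate_succ, List.cons_append, letterExpFrom_conv_cons_self, ih,
      Finset.Nat.sum_antidiagonal_succ]
    simp only [Nat.zero_add, List.replicate_succ, List.cons_append]
    congr 1
    refine Finset.sum_congr rfl fun p _ => ?_
    rw [show p.1 + (j + 1) = p.1 + 1 + j by ring]

lemma letterExp_conv_replicate (t : R) (m : ℕ) (f : Word → R) (n : Index) :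
    conv (letterExp 0 t) f (List.replicate m 0 ++ indexWord n) =
      ∑ p ∈ Finset.HasAntidiagonal.antidiagonal m, (((p.1.factorial : ℚ)⁻¹) • t ^ p.1) *
        f (List.replicate p.2 0 ++ indexWord n) :=
  letterExpFrom_conv_replicate t 0 m f n

lemma smul_pow_add (s t : R) (m : ℕ) : ((m.factorial : ℚ)⁻¹) • (s + t) ^ m =
    ∑ p ∈ Finset.HasAntidiagonal.antidiagonal m, (((p.1.factorial : ℚ)⁻¹) • s ^ p.1) *
      (((p.2.factorial : ℚ)⁻¹) • t ^ p.2) := by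
  rw [(Commute.all s t).add_pow', Finset.smul_sum]
  refine Finset.sum_congr rfl fun p hp => ?_
  obtain rfl := Finset.HasAntidiagonal.mem_antidiagonal.mp hp
  rw [smul_mul_smul_comm, ← Nat.cast_smul_eq_nsmul ℚ, smul_smul]
  congr 1
  have h := Nat.add_choose_mul_factorial_mul_factorial p.1 p.2
  have h1 : ((p.1 + p.2).factorial : ℚ) ≠ 0 := by positivity
  have h2 : (p.1.factorial : ℚ) ≠ 0 := by positivity
  have h3 : (p.2.factorial : ℚ) ≠ 0 := by positivity
  rw [inv_mul_eq_iff_eq_mul₀ h1, ← h]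
  push_cast
  field_simp
  rw [Nat.choose_symm_add]

lemma letterExp_conv_letterExp_neg (t : R) :
    conv (letterExp 0 (-t)) (letterExp 0 t) = unitFn := by
  funext w
  obtain ⟨m, n, rfl⟩ := exists_replicate_indexWord w
  rw [letterExp_conv_replicate]
  cases n with
  | nil =>
    have h : ∀ k, letterExp 0 t (List.replicate k 0 ++ indexWord []) =
        ((k.factorial : ℚ)⁻¹) • t ^ k := fun k => by
      simp [letterExp, letterExpFrom, indexWord]
    simp only [h]
    rw [← smul_pow_add, neg_add_cancel]
    cases m with
    | zero => simp [indexWord, unitFn]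
    | succ m => simp [unitFn, List.replicate_succ]
  | cons k n =>
    have h : ∀ m, letterExp 0 t (List.replicate m 0 ++ indexWord (k :: n)) = 0 := fun m => by
      rw [letterExp, letterExpFrom, if_neg]
      intro h
      simpa using h 1 (by simp [indexWord])
    simp only [h, mul_zero, Finset.sum_const_zero]
    cases m <;> simp [unitFn, indexWord, List.replicate_succ]

end LetterExp

/-! ### The character of the `q`-series -/

section QCharacter

/-- The ordered product of the exponentials attached to `u = N, …, 1`. -/
noncomputable def qChar : ℕ → Word → QSeries
  | 0 => unitFn
  | N + 1 => conv (letterExp 0 (-((N + 1 : ℕ) : QSeries)))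
      (conv (letterExp 1 (qFrac (N + 1))) (conv (letterExp 0 ((N + 1 : ℕ) : QSeries)) (qChar N)))

lemma shChar_unitFn {R : Type} [CommRing R] [Algebra ℚ R] : ShChar (unitFn : Word → R) := by
  convert shChar_letterExp (0 : Fin 2) (0 : R) using 1
  funext w
  cases w <;> simp [unitFn, letterExp, letterExpFrom]

lemma shChar_qChar (N : ℕ) : ShChar (qChar N) := by
  induction N with
  | zero => exact shChar_unitFn
  | succ N ih =>
    exact (shChar_letterExp _ _).conv ((shChar_letterExp _ _).conv ((shChar_letterExp _ _).conv ih))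

lemma X_pow_dvd_qFrac (u : ℕ) : PowerSeries.X ^ u ∣ qFrac u := ⟨_, rfl⟩

lemma dvd_lcut {α R : Type} [CommRing R] {d : R} {F : List α → List α → R} {w : List α}
    (h : ∀ u v, d ∣ F u v) : d ∣ lcut F w := by
  induction w generalizing F with
  | nil => exact h _ _
  | cons a w ih => exact dvd_add (h _ _) (ih fun u v => h _ _)

/-- If the middle exponential is replaced by the unit, the two outer ones cancel and `qChar N`
remains. The error is a multiple of q^{N+1}, because `qFrac (N + 1)` is. -/
lemma qChar_succ_sub_dvd (N : ℕ) (w : Word) :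
    PowerSeries.X ^ (N + 1) ∣ qChar (N + 1) w - qChar N w := by
  have h1 : letterExp 1 (qFrac (N + 1)) = unitFn + (letterExp 1 (qFrac (N + 1)) - unitFn) := by
    abel
  rw [qChar, h1, conv_add_left, conv_add_right, unitFn_conv, ← conv_assoc,
    letterExp_conv_letterExp_neg, unitFn_conv, Pi.add_apply, add_sub_cancel_left]
  refine dvd_lcut fun u v => dvd_mul_of_dvd_right (dvd_lcut fun s t => dvd_mul_of_dvd_left ?_ _) _
  refine (X_pow_dvd_qFrac (N + 1)).trans ?_
  cases s with
  | nil => simp [letterExp, letterExpFrom, unitFn]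
  | cons a s =>
    simp only [Pi.sub_apply, letterExp, letterExpFrom, unitFn, sub_zero]
    split_ifs
    · rw [Algebra.smul_def]
      exact dvd_mul_of_dvd_right (dvd_pow_self _ (by simp)) _
    · exact dvd_zero _

lemma coeff_qChar_eq {K N : ℕ} (h : K ≤ N) (w : Word) :
    PowerSeries.coeff K (qChar N w) = PowerSeries.coeff K (qChar K w) := by
  induction N, h using Nat.le_induction with
  | base => rfl
  | succ N h ih =>
    rw [← ih, ← sub_eq_zero, ← map_sub]
    exact PowerSeries.X_pow_dvd_iff.mp (qChar_succ_sub_dvd N w) K (by omega)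

/-- The limit of the characters `qChar N`. -/
noncomputable def qCharLim (w : Word) : QSeries :=
  PowerSeries.mk fun K => PowerSeries.coeff K (qChar K w)

lemma coeff_qCharLim {K N : ℕ} (h : K ≤ N) (w : Word) :
    PowerSeries.coeff K (qCharLim w) = PowerSeries.coeff K (qChar N w) := by
  rw [qCharLim, PowerSeries.coeff_mk, coeff_qChar_eq h]

lemma shChar_qCharLim : ShChar qCharLim where
  nil := by
    ext K
    rw [coeff_qCharLim le_rfl, (shChar_qChar K).nil]
  mul u v := by
    ext K
    have h : (PowerSeries.coeff K : QSeries →ₗ[ℚ] ℚ) ∘ₗ onWords qCharLim =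
        (PowerSeries.coeff K : QSeries →ₗ[ℚ] ℚ) ∘ₗ onWords (qChar K) := sh_ext fun w => by
      simp only [LinearMap.comp_apply, onWords_wd]
      exact coeff_qCharLim le_rfl w
    refine (LinearMap.congr_fun h (wd u * wd v)).trans ?_
    rw [LinearMap.comp_apply, (shChar_qChar K).mul, PowerSeries.coeff_mul, PowerSeries.coeff_mul]
    refine Finset.sum_congr rfl fun p hp => ?_
    have := Finset.HasAntidiagonal.mem_antidiagonal.mp hp
    rw [coeff_qCharLim (N := K) (by omega), coeff_qCharLim (N := K) (by omega)]

/-! ### Explicit sums for the values of `qChar` -/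

/-- The sum over weakly decreasing sequences `N ≥ v₁ ≥ ⋯ ≥ v_r ≥ 1` of `K [v₁, …, v_r]`, weighted by
`f(v₁) ⋯ f(v_r)` with `f(u) = q^u / (1 - q^u)`, divided by the factorials of the multiplicities. -/
noncomputable def weakSum {M : Type} [AddCommGroup M] [Module QSeries M] :
    ℕ → ℕ → (List ℕ → M) → M
  | 0, r, K => if r = 0 then K [] else 0
  | N + 1, r, K => ∑ s ∈ Finset.range (r + 1), (((s.factorial : ℚ)⁻¹) • qFrac (N + 1) ^ s) •
      weakSum N (r - s) fun v => K (List.replicate s (N + 1) ++ v)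

/-- A variant of the recursion for `weakSum`, where `j` further entries `N + 1` are counted. -/
noncomputable def weakSumFrom {M : Type} [AddCommGroup M] [Module QSeries M]
    (N j r : ℕ) (K : List ℕ → M) : M :=
  ∑ s ∈ Finset.range (r + 1), ((((s + j).factorial : ℚ)⁻¹) • qFrac (N + 1) ^ (s + j)) •
      weakSum N (r - s) fun v => K (List.replicate s (N + 1) ++ v)

section

variable {M M' : Type} [AddCommGroup M] [Module QSeries M] [AddCommGroup M'] [Module QSeries M']

lemma weakSum_succ (N r : ℕ) (K : List ℕ → M) : weakSum (N + 1) r K = weakSumFrom N 0 r K := rfl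

lemma weakSumFrom_zero (N j : ℕ) (K : List ℕ → M) : weakSumFrom N j 0 K =
    ((((j.factorial : ℚ)⁻¹) • qFrac (N + 1) ^ j)) • weakSum N 0 K := by
  simp [weakSumFrom]

lemma weakSumFrom_succ (N j r : ℕ) (K : List ℕ → M) : weakSumFrom N j (r + 1) K =
    ((((j.factorial : ℚ)⁻¹) • qFrac (N + 1) ^ j)) • weakSum N (r + 1) K +
      weakSumFrom N (j + 1) r fun v => K ((N + 1) :: v) := by
  rw [weakSumFrom, Finset.sum_range_succ', add_comm]
  congr 1
  · simp
  · refine Finset.sum_congr rfl fun s _ => ?_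
    rw [show s + 1 + j = s + (j + 1) by ring, show r + 1 - (s + 1) = r - s by omega]
    rfl

lemma map_weakSum (l : M →ₗ[QSeries] M') (N r : ℕ) (K : List ℕ → M) :
    l (weakSum N r K) = weakSum N r fun v => l (K v) := by
  induction N generalizing r K with
  | zero => simp only [weakSum]; split_ifs <;> simp
  | succ N ih => simp only [weakSum, map_sum, map_smul, ih]

lemma weakSum_congr {N r : ℕ} {K K' : List ℕ → M} (h : ∀ v, v.length = r → K v = K' v) :
    weakSum N r K = weakSum N r K' := by
  induction N generalizing r K K' with
  | zero =>
    simp only [weakSum]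
    split_ifs with hr
    · exact h _ (by simp [hr])
    · rfl
  | succ N ih =>
    simp only [weakSum]
    refine Finset.sum_congr rfl fun s hs => ?_
    congr 1
    refine ih fun v hv => h _ ?_
    simp only [Finset.mem_range] at hs
    simp [hv]; omega

lemma weakSum_sum {ι : Type} (S : Finset ι) (N r : ℕ) (K : ι → List ℕ → M) :
    weakSum N r (fun v => ∑ i ∈ S, K i v) = ∑ i ∈ S, weakSum N r (K i) := by
  induction N generalizing r K with
  | zero => simp only [weakSum]; split_ifs <;> simp
  | succ N ih =>
    simp only [weakSum, ih, Finset.smul_sum]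
    rw [Finset.sum_comm]

lemma weakSum_smul (c : QSeries) (N r : ℕ) (K : List ℕ → M) :
    weakSum N r (fun v => c • K v) = c • weakSum N r K :=
  (map_weakSum (LinearMap.lsmul QSeries M c) N r K).symm

lemma weakSum_zero (N r : ℕ) : weakSum N r (fun _ => (0 : M)) = 0 := by
  simpa using (map_weakSum (0 : M →ₗ[QSeries] M) N r fun _ => 0).symm

lemma weakSumFrom_sum {ι : Type} (S : Finset ι) (N j r : ℕ) (K : ι → List ℕ → M) :
    weakSumFrom N j r (fun v => ∑ i ∈ S, K i v) = ∑ i ∈ S, weakSumFrom N j r (K i) := by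
  simp only [weakSumFrom, weakSum_sum, Finset.smul_sum]
  rw [Finset.sum_comm]

lemma weakSumFrom_smul (c : QSeries) (N j r : ℕ) (K : List ℕ → M) :
    weakSumFrom N j r (fun v => c • K v) = c • weakSumFrom N j r K := by
  simp only [weakSumFrom, weakSum_smul, Finset.smul_sum, smul_comm c]

end

/-- The product of `(x - v₁)^a / a!` and the `(vᵢ - vᵢ₊₁)^{nᵢ-1} / (nᵢ-1)!`, with `v_{r+1} = 0`. -/
noncomputable def gapKernel : QSeries → ℕ → Index → List ℕ → QSeries
  | x, a, [], [] => ((a.factorial : ℚ)⁻¹) • x ^ a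
  | x, a, k :: n, y :: v => (((a.factorial : ℚ)⁻¹) • (x - y) ^ a) * gapKernel y k.natPred n v
  | _, _, _, _ => 0

/-- The binomial theorem moves the base point of the first gap from `x` to `z`. On the side of
characters this is convolution with an exponential of the letter 0. -/
lemma gapKernel_eq_sum (x z : QSeries) (a : ℕ) (n : Index) (v : List ℕ) : gapKernel x a n v =
    ∑ p ∈ Finset.HasAntidiagonal.antidiagonal a, (((p.1.factorial : ℚ)⁻¹) • (x - z) ^ p.1) • gapKernel z p.2 n v := by
  match n, v with
  | [], [] =>
    simp only [gapKernel, smul_eq_mul]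
    rw [← smul_pow_add, sub_add_cancel]
  | [], y :: v => simp [gapKernel]
  | k :: n, [] => simp [gapKernel]
  | k :: n, y :: v =>
    simp only [gapKernel, smul_eq_mul, ← mul_assoc, ← Finset.sum_mul]
    rw [← smul_pow_add, sub_add_sub_cancel]

/-- An entry of the sequence equal to `N + 1` corresponds to a letter 1 absorbed by the exponential
of 1. Both sides stop at the same place: a zero between two letters 1 blocks the exponential, and
the matching gap is a positive power of (N+1) - (N+1) = 0. The remaining factors are covered by
`ih`, after a change of base point from 0 to `N + 1`. -/
lemma weakSumFrom_gapKernel (N j m : ℕ) (n : Index)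
    (ih : ∀ a n, qChar N (List.replicate a 0 ++ indexWord n) =
      weakSum N n.length (gapKernel 0 a n)) :
    weakSumFrom N j n.length (gapKernel ((N + 1 : ℕ) : QSeries) m n) =
      conv (letterExpFrom 1 (qFrac (N + 1)) j) (conv (letterExp 0 ((N + 1 : ℕ) : QSeries)) (qChar N))
        (List.replicate m 0 ++ indexWord n) := by
  have hE : ∀ m n, weakSum N (List.length n) (gapKernel ((N + 1 : ℕ) : QSeries) m n) =
      conv (letterExp 0 ((N + 1 : ℕ) : QSeries)) (qChar N) (List.replicate m 0 ++ indexWord n) := by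
    intro m n
    rw [letterExp_conv_replicate, weakSum_congr fun v _ => gapKernel_eq_sum _ 0 m n v, weakSum_sum]
    simp only [weakSum_smul]
    simp only [sub_zero, ih, smul_eq_mul]
  induction n generalizing j m with
  | nil =>
    rw [List.length_nil, weakSumFrom_zero, letterExpFrom_conv_of_ne, ← hE m [], List.length_nil,
      smul_eq_mul]
    intro v
    cases m <;> simp [indexWord, List.replicate_succ]
  | cons k n ihn =>
    rw [List.length_cons, weakSumFrom_succ, ← List.length_cons (a := k), hE]
    cases m with
    | succ m =>
      rw [letterExpFrom_conv_of_ne _ _ _ _ (by simp [List.replicate_succ])]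
      have : ∀ v, gapKernel ((N + 1 : ℕ) : QSeries) (m + 1) (k :: n) ((N + 1) :: v) = 0 := fun v => by
        simp [gapKernel]
      simp only [this, weakSumFrom, weakSum_zero, smul_zero, Finset.sum_const_zero, add_zero]
      rw [smul_eq_mul]
    | zero =>
      have : ∀ v, gapKernel ((N + 1 : ℕ) : QSeries) 0 (k :: n) ((N + 1) :: v) =
          gapKernel ((N + 1 : ℕ) : QSeries) k.natPred n v := fun v => by
        simp [gapKernel]
      simp only [this]
      rw [ihn, List.replicate_zero, List.nil_append, indexWord, letterExpFrom_conv_cons_self,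
        smul_eq_mul]

/-- The values of `qChar N` as explicit sums. -/
lemma qChar_eq_weakSum (N a : ℕ) (n : Index) :
    qChar N (List.replicate a 0 ++ indexWord n) = weakSum N n.length (gapKernel 0 a n) := by
  induction N generalizing a n with
  | zero =>
    cases n with
    | nil => cases a <;> simp [qChar, weakSum, gapKernel, indexWord, unitFn, List.replicate_succ]
    | cons k n => cases a <;> simp [qChar, weakSum, indexWord, unitFn, List.replicate_succ]
  | succ N ih =>
    rw [weakSum_succ, qChar, letterExp_conv_replicate]
    -- The leftmost exponential, with argument -(N+1), moves the base point of the first gap from 0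
    -- to N+1.
    have : gapKernel 0 a n = fun v => ∑ p ∈ Finset.HasAntidiagonal.antidiagonal a,
        (((p.1.factorial : ℚ)⁻¹) • (-((N + 1 : ℕ) : QSeries)) ^ p.1) •
          gapKernel ((N + 1 : ℕ) : QSeries) p.2 n v := by
      funext v
      rw [gapKernel_eq_sum 0 ((N + 1 : ℕ) : QSeries), zero_sub]
    rw [this, weakSumFrom_sum]
    refine Finset.sum_congr rfl fun p _ => ?_
    rw [weakSumFrom_smul, weakSumFrom_gapKernel N 0 p.2 n ih, smul_eq_mul]
    rfl

end QCharacter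

end MES

namespace MES

/-! ### Exponentials of power series -/

section XExp

open MvPowerSeries

lemma coeff_pow_eq_zero_of_degree_lt {y : XSeries} (hy : constantCoeff y = 0) {n : ℕ}
    {e : ℕ →₀ ℕ} (h : e.degree < n) : coeff e (y ^ n) = 0 := by
  refine coeff_of_lt_order (lt_of_lt_of_le ?_ (le_order_pow_of_constantCoeff_eq_zero n hy))
  exact_mod_cast h

lemma coeff_xExp {y : XSeries} (hy : constantCoeff y = 0) {e : ℕ →₀ ℕ} {K : ℕ} (hK : e.degree < K) :
    coeff e (xExp y) = ∑ n ∈ Finset.range K, ((n.factorial : ℚ)⁻¹) • coeff e (y ^ n) := by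
  rw [xExp, PowerSeries.coeff_subst (PowerSeries.HasSubst.of_constantCoeff_zero hy),
    finsum_eq_sum_of_support_subset (s := Finset.range K)]
  · refine Finset.sum_congr rfl fun n _ => ?_
    rw [PowerSeries.coeff_exp]; simp
  · intro n hn
    simp only [Finset.coe_range, Set.mem_Iio]
    by_contra h
    refine hn ?_
    simp only
    rw [coeff_pow_eq_zero_of_degree_lt hy (by omega), smul_zero]

lemma xExp_zero : xExp 0 = 1 := by
  ext e : 1
  rw [coeff_xExp (map_zero _) (Nat.lt_succ_self _), Finset.sum_range_succ']
  simp

lemma xExp_add {a b : XSeries} (ha : constantCoeff a = 0) (hb : constantCoeff b = 0) :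
    xExp (a + b) = xExp a * xExp b := by
  classical
  ext e : 1
  set K := e.degree + 1 with hK
  have hab : constantCoeff (a + b) = 0 := by rw [map_add, ha, hb, add_zero]
  have h1 : coeff e (xExp a * xExp b) = ∑ i ∈ Finset.range K, ∑ j ∈ Finset.range K,
      coeff e ((((i.factorial : ℚ)⁻¹) • a ^ i) * (((j.factorial : ℚ)⁻¹) • b ^ j)) := by
    simp only [coeff_mul]
    rw [Finset.sum_congr rfl fun i _ => Finset.sum_comm, Finset.sum_comm]
    refine Finset.sum_congr rfl fun p hp => ?_
    have hp' := Finset.HasAntidiagonal.mem_antidiagonal.mp hp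
    have hd : p.1.degree + p.2.degree = e.degree := by rw [← hp', map_add]
    rw [coeff_xExp ha (K := K) (by omega), coeff_xExp hb (K := K) (by omega), Finset.sum_mul_sum]
    refine Finset.sum_congr rfl fun i _ => Finset.sum_congr rfl fun j _ => ?_
    rfl
  rw [h1, coeff_xExp hab (K := K) (by omega), ← Finset.sum_product']
  have h2 : ∀ n ∈ Finset.range K, ((n.factorial : ℚ)⁻¹) • coeff e ((a + b) ^ n) =
      ∑ p ∈ Finset.HasAntidiagonal.antidiagonal n,
        coeff e ((((p.1.factorial : ℚ)⁻¹) • a ^ p.1) * (((p.2.factorial : ℚ)⁻¹) • b ^ p.2)) := by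
    intro n _
    rw [← map_sum, ← smul_pow_add]
    rfl
  rw [Finset.sum_congr rfl h2, Finset.sum_sigma']
  -- The binomial expansion gives the triangle i + j < K inside the square of the product of
  -- truncated exponentials. Outside it, the order of a^i b^j exceeds the degree of `e`.
  refine Finset.sum_of_injOn (fun x => x.2) ?_ ?_ ?_ ?_
  · rintro ⟨n, p⟩ h ⟨n', p'⟩ h' hpp
    simp only [Finset.coe_sigma, Set.mem_sigma_iff, Finset.mem_coe,
      Finset.HasAntidiagonal.mem_antidiagonal] at h h' hpp
    subst hpp
    obtain rfl : n = n' := h.2.symm.trans h'.2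
    rfl
  · rintro ⟨n, p⟩ h
    simp only [Finset.coe_sigma, Set.mem_sigma_iff, Finset.mem_coe, Finset.mem_range,
      Finset.HasAntidiagonal.mem_antidiagonal, Finset.mem_product] at h ⊢
    omega
  · rintro ⟨i, j⟩ _ h
    simp only [Set.mem_image, Finset.mem_coe, Finset.mem_sigma, Finset.mem_range,
      Finset.HasAntidiagonal.mem_antidiagonal, Sigma.exists, exists_eq_right, not_exists, not_and] at h
    have hij : e.degree < i + j := by
      by_contra h'
      exact h (i + j) (by omega) rfl
    rw [smul_mul_smul_comm]
    rw [show ∀ (c : ℚ) (x : XSeries), coeff e (c • x) = c • coeff e x from fun _ _ => rfl,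
      coeff_of_lt_order, smul_zero]
    calc ((e.degree : ℕ) : ℕ∞) < ((i + j : ℕ) : ℕ∞) := by exact_mod_cast hij
      _ ≤ (a ^ i).order + (b ^ j).order := by
        push_cast
        exact add_le_add (le_order_pow_of_constantCoeff_eq_zero i ha)
          (le_order_pow_of_constantCoeff_eq_zero j hb)
      _ ≤ _ := le_order_mul
  · intro x _; rfl

lemma constantCoeff_list_sum {l : List XSeries} (h : ∀ y ∈ l, constantCoeff y = 0) :
    constantCoeff l.sum = 0 := by
  rw [map_list_sum]
  exact List.sum_eq_zero (by simpa using h)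

/-- The coefficients of the exponential of a linear form. -/
lemma coeff_xExp_linear (a : ℕ →₀ QSeries) (e : ℕ →₀ ℕ) :
    coeff e (xExp (a.linearCombination QSeries (MvPowerSeries.X : ℕ → XSeries))) =
      e.prod fun i m => ((m.factorial : ℚ)⁻¹) • a i ^ m := by
  have hcoe : a.linearCombination QSeries (MvPowerSeries.X : ℕ → XSeries) =
      ((a.linearCombination QSeries MvPolynomial.X : MvPolynomial ℕ QSeries) : XSeries) := by
    rw [Finsupp.linearCombination_apply, Finsupp.linearCombination_apply, Finsupp.sum, Finsupp.sum]
    rw [← MvPolynomial.coeToMvPowerSeries.ringHom_apply, map_sum]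
    refine Finset.sum_congr rfl fun i _ => ?_
    rw [MvPolynomial.coeToMvPowerSeries.ringHom_apply, MvPolynomial.coe_smul, MvPolynomial.coe_X]
  have hc : constantCoeff (a.linearCombination QSeries (MvPowerSeries.X : ℕ → XSeries)) = 0 := by
    rw [Finsupp.linearCombination_apply, Finsupp.sum, map_sum]
    exact Finset.sum_eq_zero fun i _ => by simp [smul_eq_C_mul]
  have hdeg : (e.sum fun _ m => m) = e.degree := rfl
  rw [coeff_xExp hc (Nat.lt_succ_self _), Finset.sum_eq_single e.degree]
  · rw [hcoe, ← MvPolynomial.coe_pow, MvPolynomial.coeff_coe, MvPolynomial.coeff_linearCombination_X_pow,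
      if_pos hdeg]
    have h := Nat.multinomial_spec e.support e
    have h2 : (∏ i ∈ e.support, ((e i).factorial : ℚ)⁻¹) =
        ((e.degree.factorial : ℚ)⁻¹) * e.multinomial := by
      rw [Finset.prod_inv_distrib, eq_inv_mul_iff_mul_eq₀ (by positivity), ← div_eq_mul_inv,
        div_eq_iff (Finset.prod_ne_zero_iff.mpr fun i _ => by positivity), mul_comm]
      rw [show e.degree = ∑ i ∈ e.support, e i from rfl, ← h]
      push_cast
      rfl
    rw [Finsupp.prod, Finsupp.prod, Finset.prod_smul, h2, mul_smul]
    congr 1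
    rw [Algebra.smul_def, map_natCast]
  · intro n _ hn
    rw [hcoe, ← MvPolynomial.coe_pow, MvPolynomial.coeff_coe, MvPolynomial.coeff_linearCombination_X_pow,
      if_neg (fun h => hn (h.symm.trans hdeg)), smul_zero]
  · intro h
    exact absurd (Finset.mem_range.mpr (Nat.lt_succ_self _)) h

end XExp

/-! ### The coefficients of the generating series -/

section Coefficients

open MvPowerSeries

/-- The product of the `exp(vᵢ zᵢ)`. -/
noncomputable def expProd (z : List XSeries) (v : List ℕ) : XSeries :=
  (List.zipWith (fun y u => xExp (u • y)) z v).prod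

lemma expProd_append (z z' : List XSeries) (v v' : List ℕ) (h : z.length = v.length) :
    expProd (z ++ z') (v ++ v') = expProd z v * expProd z' v' := by
  rw [expProd, List.zipWith_append h, List.prod_append]; rfl

lemma constantCoeff_nsmul_eq_zero {y : XSeries} (hy : constantCoeff y = 0) (u : ℕ) :
    constantCoeff (u • y) = 0 := by rw [map_nsmul, hy, smul_zero]

lemma expProd_replicate {z : List XSeries} (hz : ∀ y ∈ z, constantCoeff y = 0) (u : ℕ) :
    expProd z (List.replicate z.length u) = xExp (u • z.sum) := by
  induction z with
  | nil => simp [expProd, xExp_zero]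
  | cons y z ih =>
    have hz' : ∀ y ∈ z, constantCoeff y = 0 := fun y hy => hz y (by simp [hy])
    rw [List.sum_cons, nsmul_add, xExp_add (constantCoeff_nsmul_eq_zero (hz y (by simp)) u)
      (constantCoeff_nsmul_eq_zero (constantCoeff_list_sum hz') u), ← ih hz']
    rfl

/-- The summand of a block of variables at `u`. -/
noncomputable def blockFn (B : List XSeries) (u : ℕ) : XSeries :=
  ((B.length.factorial : ℚ)⁻¹) • (xExp (u • B.sum) * C (qFrac u ^ B.length))

lemma blockFn_nil (u : ℕ) : blockFn [] u = 1 := by simp [blockFn, xExp_zero]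

lemma foldr_conv_append {α X R : Type} [CommRing R] (W : X → List α → R) (L : List X) (x : X) :
    (L ++ [x]).foldr (fun x f => conv (W x) f) unitFn =
      conv (L.foldr (fun x f => conv (W x) f) unitFn) (W x) := by
  induction L with
  | nil => simp [conv_unitFn, unitFn_conv]
  | cons y L ih => rw [List.cons_append, List.foldr_cons, ih, List.foldr_cons, conv_assoc]

/-- A block of s variables placed at u contributes e^{u·(sum)} f(u)^s / s!, which is the
contribution of s equal entries u in a weakly monotone sequence. Splittings into blocks with
strictly increasing points are thus weakly monotone sequences; the list is reversed because
`weakSum` starts from the largest value. -/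
lemma blockSum_blockFn (N : ℕ) {z : List XSeries} (hz : ∀ y ∈ z, constantCoeff y = 0) :
    blockSum (multiSum blockFn (List.range' 1 N)) z.reverse =
      weakSum N z.length (expProd z) := by
  rw [blockSum_multiSum blockFn blockFn_nil]
  induction N generalizing z with
  | zero =>
    cases z with
    | nil => simp [weakSum, expProd, unitFn]
    | cons y z =>
      rw [List.reverse_cons, List.range'_zero, List.foldr_nil, unitFn_concat]
      simp [weakSum]
  | succ N ih =>
    rw [List.range'_concat, foldr_conv_append, conv, lcut_reverse, lcut_eq_sum, weakSum]
    refine Finset.sum_congr rfl fun s hs => ?_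
    have hs : s ≤ z.length := by simpa [Nat.lt_succ_iff] using hs
    have hzs : ∀ y ∈ z.drop s, constantCoeff y = 0 := fun y hy => hz y (List.mem_of_mem_drop hy)
    have hzt : ∀ y ∈ z.take s, constantCoeff y = 0 := fun y hy => hz y (List.mem_of_mem_take hy)
    have hlen : (z.take s).length = s := by simp [hs]
    rw [ih hzs, List.length_drop]
    have : ∀ v, expProd z (List.replicate s (N + 1) ++ v) =
        xExp ((N + 1) • (z.take s).sum) * expProd (z.drop s) v := fun v => by
      conv_lhs => rw [← List.take_append_drop s z]
      rw [expProd_append _ _ _ _ (by simp [hs])]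
      congr 1
      have h := expProd_replicate hzt (N + 1)
      rwa [hlen] at h
    simp only [this]
    have h := map_weakSum (LinearMap.mulLeft QSeries (xExp ((N + 1) • (z.take s).sum))) N
      (z.length - s) (expProd (z.drop s))
    simp only [LinearMap.mulLeft_apply] at h
    rw [← h, blockFn, List.length_reverse, hlen, List.sum_reverse, one_mul, Nat.add_comm 1 N,
      smul_eq_C_mul]
    have hC : ∀ (c : ℚ) (x : QSeries), (C (c • x) : XSeries) = c • C x := fun c x => by
      classical
      ext e : 1
      change _ = c • coeff e (C x)
      rw [coeff_C, coeff_C]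
      split_ifs <;> simp
    rw [hC]
    simp only [mul_smul_comm, smul_mul_assoc]
    congr 1
    ring

/-- Pairs each composition with its factorials, so that `hExp` becomes a sum over blocks; for the
coefficient of q^N, points up to `N` suffice by the definition of `hSeries`. -/
lemma coeff_coeff_hExp (z : List XSeries) (N : ℕ) (d : ℕ →₀ ℕ) :
    PowerSeries.coeff N (coeff d (hExp z)) =
      PowerSeries.coeff N (coeff d (blockSum (multiSum blockFn (List.range' 1 N)) z)) := by
  rw [hExp, blockSum, map_sum, map_sum, map_sum, map_sum]
  refine Finset.sum_congr rfl fun c _ => ?_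
  have hcoef : ∀ (r : ℚ) (s : XSeries), PowerSeries.coeff N (coeff d (r • s)) =
      r * PowerSeries.coeff N (coeff d s) := fun r s => rfl
  have hb : c.blocks = (z.splitWrtComposition c).map List.length :=
    (List.map_length_splitWrtComposition z c).symm
  have hW : multiSum blockFn (List.range' 1 N) (z.splitWrtComposition c) =
      ((c.blocks.map fun i => ((i.factorial : ℚ)⁻¹)).prod) •
        hTrunc ((z.splitWrtComposition c).map fun s => (s.length, s.sum)) N := by
    have := multiSum_smul (fun B : List XSeries => algebraMap ℚ XSeries ((B.length.factorial : ℚ)⁻¹))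
      (fun (B : List XSeries) (u : ℕ) => xExp (u • B.sum) * C (qFrac u ^ B.length))
      (List.range' 1 N) (z.splitWrtComposition c)
    rw [hb, List.map_map, Algebra.smul_def, map_list_prod, List.map_map]
    have h2 := sum_strictMono_eq_multiSum
      (fun (p : ℕ × XSeries) (u : ℕ) => xExp (u • p.2) * C (qFrac u ^ p.1)) (List.range' 1 N)
      (List.pairwise_lt_range') ((z.splitWrtComposition c).map fun s => (s.length, s.sum))
      (Finset.Icc 1 N) (by intro x; simp; omega)
    rw [hTrunc, h2, multiSum_map_right]
    refine Eq.trans ?_ this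
    exact multiSum_congr fun B _ u _ => by rw [blockFn, Algebra.smul_def]
  rw [hW, hcoef, hcoef]
  congr 1
  have h : ∀ l, coeff d (hSeries l) =
      PowerSeries.mk fun N => PowerSeries.coeff N (coeff d (hTrunc l N)) := fun l => rfl
  rw [h, PowerSeries.coeff_mk]

/-! ### Summation by parts in the exponents -/

/-- The linear form `x X_b + ∑ vᵢ (X_{b+1+i} - X_{b+i})`. -/
noncomputable def gapForm : ℕ → QSeries → List ℕ → ℕ →₀ QSeries
  | b, x, [] => Finsupp.single b x
  | b, x, y :: v => Finsupp.single b (x - y) + gapForm (b + 1) y v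

/-- The exponent `a` at `b` and `nᵢ - 1` at `b + 1 + i`. -/
noncomputable def gapExponent : ℕ → ℕ → Index → ℕ →₀ ℕ
  | b, a, [] => Finsupp.single b a
  | b, a, k :: n => Finsupp.single b a + gapExponent (b + 1) k.natPred n

lemma gapForm_apply_of_lt {b i : ℕ} (h : i < b) (x : QSeries) (v : List ℕ) :
    gapForm b x v i = 0 := by
  induction v generalizing b x with
  | nil => rw [gapForm, Finsupp.single_apply, if_neg (by omega)]
  | cons y v ih =>
    rw [gapForm, Finsupp.add_apply, ih (by omega), Finsupp.single_apply, if_neg (by omega), add_zero]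

lemma gapExponent_apply_of_lt {b i : ℕ} (h : i < b) (a : ℕ) (n : Index) :
    gapExponent b a n i = 0 := by
  induction n generalizing b a with
  | nil => rw [gapExponent, Finsupp.single_apply, if_neg (by omega)]
  | cons k n ih =>
    rw [gapExponent, Finsupp.add_apply, ih (by omega), Finsupp.single_apply, if_neg (by omega)]

lemma prod_gapExponent (b : ℕ) (x : QSeries) (a : ℕ) (n : Index) (v : List ℕ)
    (h : v.length = n.length) :
    ((gapExponent b a n).prod fun i m => ((m.factorial : ℚ)⁻¹) • gapForm b x v i ^ m) =
      gapKernel x a n v := by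
  induction n generalizing b x a v with
  | nil =>
    obtain rfl := List.length_eq_zero_iff.mp h
    rw [gapExponent, Finsupp.prod_single_index (by simp), gapForm, Finsupp.single_eq_same, gapKernel]
  | cons k n ih =>
    cases v with
    | nil => simp at h
    | cons y v =>
      rw [gapExponent, gapKernel, Finsupp.prod_add_index_of_disjoint]
      · congr 1
        · rw [Finsupp.prod_single_index (by simp), gapForm, Finsupp.add_apply,
            Finsupp.single_eq_same, gapForm_apply_of_lt (Nat.lt_succ_self b), add_zero]
        · rw [← ih (b + 1) y k.natPred v (by simpa using h)]
          refine Finsupp.prod_congr fun i hi => ?_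
          have hib : b ≠ i := by
            rintro rfl
            exact Finsupp.mem_support_iff.mp hi (gapExponent_apply_of_lt (Nat.lt_succ_self _) _ _)
          rw [gapForm, Finsupp.add_apply, Finsupp.single_apply, if_neg hib, zero_add]
      · rw [Finset.disjoint_left]
        intro i hi hi'
        have := Finset.mem_singleton.mp (Finsupp.support_single_subset hi)
        subst this
        exact Finsupp.mem_support_iff.mp hi' (gapExponent_apply_of_lt (Nat.lt_succ_self _) _ _)

lemma exponent_cons (k : ℕ+) (n : Index) : exponent (k :: n) = gapExponent 0 k.natPred n := by
  have h : ∀ b k (n : Index), gapExponent b (PNat.natPred k) n = ∑ i : Fin (n.length + 1),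
      Finsupp.single (b + (i : ℕ)) (((k :: n).get i : ℕ) - 1) := by
    intro b k n
    induction n generalizing b k with
    | nil => simp [gapExponent, PNat.natPred]
    | cons l n ih =>
      rw [gapExponent, ih]
      refine Eq.trans ?_ (Fin.sum_univ_succ (n := n.length + 1) _).symm
      simp only [List.get_eq_getElem, Fin.val_succ, List.getElem_cons_succ, Nat.add_assoc,
        Nat.add_comm 1]
      simp [PNat.natPred]
  rw [h, exponent]
  simp

lemma constantCoeff_xDiff (i : ℕ) : constantCoeff (xDiff i) = 0 := by
  cases i <;> simp [xDiff]

/-- Summation by parts: ∑ vᵢ (xᵢ - xᵢ₋₁) = ∑ (vᵢ - vᵢ₊₁) xᵢ. The substitution of differences in g_sh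
is what makes the gaps of `gapKernel` appear as exponents. -/
lemma xExp_gapForm (b x : ℕ) (v : List ℕ) :
    xExp ((gapForm b (x : QSeries) v).linearCombination QSeries (MvPowerSeries.X : ℕ → XSeries)) =
      xExp (x • MvPowerSeries.X b) * expProd ((List.range' (b + 1) v.length).map xDiff) v := by
  have hX : ∀ (u i : ℕ), constantCoeff (u • (MvPowerSeries.X i : XSeries)) = 0 := fun u i =>
    constantCoeff_nsmul_eq_zero (by simp) u
  induction v generalizing b x with
  | nil =>
    rw [gapForm, Finsupp.linearCombination_single, Nat.cast_smul_eq_nsmul]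
    simp [expProd]
  | cons y v ih =>
    have hc : constantCoeff ((gapForm (b + 1) (y : QSeries) v).linearCombination QSeries
        (MvPowerSeries.X : ℕ → XSeries)) = 0 := by
      rw [Finsupp.linearCombination_apply, Finsupp.sum, map_sum]
      exact Finset.sum_eq_zero fun i _ => by simp [smul_eq_C_mul]
    have hc2 : constantCoeff (((x : QSeries) - y) • (MvPowerSeries.X b : XSeries)) = 0 := by
      simp [smul_eq_C_mul]
    rw [gapForm, map_add, xExp_add (by rw [Finsupp.linearCombination_single]; exact hc2) hc, ih,
      Finsupp.linearCombination_single, List.length_cons, List.range'_succ, List.map_cons]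
    change _ = _ * (xExp (y • xDiff (b + 1)) * expProd _ v)
    rw [← mul_assoc, ← mul_assoc, ← xExp_add hc2 (hX _ _),
      ← xExp_add (hX _ _) (constantCoeff_nsmul_eq_zero (constantCoeff_xDiff _) _)]
    congr 2
    rw [sub_smul, Nat.cast_smul_eq_nsmul, Nat.cast_smul_eq_nsmul, xDiff, nsmul_sub]
    abel

lemma coeff_expProd (n : Index) (v : List ℕ) (h : v.length = n.length) :
    coeff (exponent n) (expProd ((List.range n.length).map xDiff) v) = gapKernel 0 0 n v := by
  cases n with
  | nil =>
    obtain rfl := List.length_eq_zero_iff.mp h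
    simp [expProd, exponent, gapKernel]
  | cons k n =>
    cases v with
    | nil => simp at h
    | cons y v =>
      have hl : v.length = n.length := by simpa using h
      rw [exponent_cons, gapKernel, ← prod_gapExponent 0 y _ n v hl, ← coeff_xExp_linear,
        xExp_gapForm, List.length_cons, List.range_eq_range', List.range'_succ, List.map_cons, hl]
      simp only [Nat.factorial_zero, Nat.cast_one, inv_one, pow_zero, one_smul, one_mul]
      rfl

/-- The `q`-series `g^sh` are the values of a character of the shuffle algebra. -/
lemma coeff_gShSeries (n : Index) :
    coeff (exponent n) (gShSeries n.length) = qCharLim (indexWord n) := by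
  ext N
  rw [gShSeries, coeff_coeff_hExp, blockSum_blockFn N, coeff_qCharLim le_rfl, map_weakSum]
  · have := qChar_eq_weakSum N 0 n
    rw [List.replicate_zero, List.nil_append] at this
    rw [this, List.length_map, List.length_range, weakSum_congr fun v hv => coeff_expProd n v hv]
  · intro y hy
    obtain ⟨i, _, rfl⟩ := List.mem_map.mp hy
    exact constantCoeff_xDiff i

lemma length_indexWord (n : Index) : (indexWord n).length = (n.map fun k : ℕ+ => (k : ℕ)).sum := by
  induction n with
  | nil => rfl
  | cons k n ih =>
    rw [indexWord, List.length_cons, List.length_append, ih, List.length_replicate, List.map_cons,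
      List.sum_cons, ← PNat.natPred_add_one k]
    ring

/-- The character of the shuffle algebra with values `g^sh`. -/
noncomputable def gChar (w : Word) : PowerSeries ℂ :=
  (algebraMap ℂ (PowerSeries ℂ) (-2 * (Real.pi : ℂ) * Complex.I)) ^ w.length *
    PowerSeries.map (algebraMap ℚ ℂ) (qCharLim w)

lemma shChar_gChar : ShChar gChar :=
  (shChar_qCharLim.comp (PowerSeries.mapAlgHom (Algebra.ofId ℚ ℂ))).twist _

lemma gSh_eq (n : Index) : gSh n = gChar (indexWord n) := by
  rw [gSh, coeff_gShSeries, gChar, length_indexWord, Algebra.smul_def, map_pow]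

lemma gMap_mul (x y : RegInt) : gMap (x * y) = gMap x * gMap y :=
  constr_mul gSh (onWords gChar) (fun n => by rw [onWords_wd, gSh_eq])
    (fun n m => by rw [shChar_gChar.mul, gSh_eq, gSh_eq]) x y

end Coefficients

end MES

namespace MES

/-! ### The duality of words -/

/-- Reversal of words and exchange of the two letters. -/
noncomputable def dual : Sh →ₗ[ℚ] Sh := onWords fun w => wd (w.map (1 - ·)).reverse

/-- Exchange of the two letters. -/
noncomputable def swap : Sh →ₗ[ℚ] Sh := onWords fun w => wd (w.map (1 - ·))

lemma swap_pre (a : Fin 2) (x : Sh) : swap (pre a x) = pre (1 - a) (swap x) := by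
  have : swap ∘ₗ pre a = pre (1 - a) ∘ₗ swap := sh_ext fun w => by
    simp only [LinearMap.comp_apply, ← wd_cons, swap, onWords_wd, List.map_cons]
  exact LinearMap.congr_fun this x

lemma swap_one : swap 1 = 1 := by rw [← wd_nil, swap, onWords_wd]; rfl

lemma swap_mul_wd (u v : Word) : swap (wd u * wd v) = swap (wd u) * swap (wd v) := by
  match u, v with
  | [], v => rw [wd_nil, one_mul, swap_one, one_mul]
  | a :: u, [] => rw [wd_nil, mul_one, swap_one, mul_one]
  | a :: u, b :: v =>
    have h1 := swap_mul_wd u (b :: v)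
    have h2 := swap_mul_wd (a :: u) v
    simp only [wd_cons, pre_mul, map_add, swap_pre] at h1 h2 ⊢
    rw [h1, h2]
termination_by u.length + v.length

lemma dual_wd (w : Word) : dual (wd w) = wd (w.map (1 - ·)).reverse := by rw [dual, onWords_wd]

lemma dual_eq : dual = rev ∘ₗ swap := sh_ext fun w => by
  rw [dual_wd, LinearMap.comp_apply, swap, onWords_wd, rev_wd]

lemma dual_mul (x y : Sh) : dual (x * y) = dual x * dual y := by
  have : (LinearMap.mul ℚ Sh).compr₂ swap = (LinearMap.mul ℚ Sh).compl₁₂ swap swap :=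
    sh_ext₂ fun u v => swap_mul_wd u v
  have h := LinearMap.congr_fun (LinearMap.congr_fun this x) y
  simp only [LinearMap.compr₂_apply, LinearMap.compl₁₂_apply, LinearMap.mul_apply'] at h
  rw [dual_eq, LinearMap.comp_apply, h, rev_mul]; rfl

lemma dual_dual (x : Sh) : dual (dual x) = x := by
  have : dual ∘ₗ dual = LinearMap.id := sh_ext fun w => by
    rw [LinearMap.comp_apply, dual_wd, dual_wd]
    simp
  exact LinearMap.congr_fun this x

/-- Removing a final letter `1`. -/
noncomputable def derLast : Sh →ₗ[ℚ] Sh := dual ∘ₗ der 0 ∘ₗ dual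

/-- Reversal combined with exchange of letters is an involutive automorphism of the shuffle algebra.
It turns a leading 0 into a final 1, so what holds for `der 0` transfers. -/
lemma derLast_mul (x y : Sh) : derLast (x * y) = derLast x * y + x * derLast y := by
  simp only [derLast, LinearMap.comp_apply, dual_mul, der_mul, map_add, dual_dual]

lemma derLast_one : derLast 1 = 0 := by
  rw [derLast, LinearMap.comp_apply, LinearMap.comp_apply, ← wd_nil, dual_wd]
  change dual (der 0 1) = 0
  rw [der_one, map_zero]

lemma derLast_concat (w : Word) (a : Fin 2) :
    derLast (wd (w ++ [a])) = if a = 1 then wd w else 0 := by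
  rw [derLast, LinearMap.comp_apply, LinearMap.comp_apply, dual_wd, List.map_append,
    List.reverse_append, List.map_singleton, List.reverse_singleton, List.singleton_append, der_cons]
  by_cases h : a = 1
  · rw [if_pos (by simp [h]), if_pos h, dual_wd]
    simp
  · obtain rfl : a = 0 := by omega
    simp

lemma der_derLast (c : Fin 2) (x : Sh) : der c (derLast x) = derLast (der c x) := by
  have : der c ∘ₗ derLast = derLast ∘ₗ der c := sh_ext fun w => by
    simp only [LinearMap.comp_apply]
    match w with
    | [] => rw [wd_nil, derLast_one, der_one, map_zero, map_zero]
    | [a] =>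
      have h := derLast_concat [] a
      rw [List.nil_append] at h
      rw [h, der_cons]
      split_ifs <;> simp [wd_nil, der_one, derLast_one]
    | a :: b :: w =>
      obtain ⟨v, e, hv⟩ : ∃ v e, b :: w = v ++ [e] :=
        ⟨_, _, (List.dropLast_append_getLast (List.cons_ne_nil b w)).symm⟩
      rw [hv, ← List.cons_append, derLast_concat, List.cons_append, der_cons]
      split_ifs <;> simp [*, der_cons, derLast_concat]
  exact LinearMap.congr_fun this x

lemma coef_concat_one (w : Word) (x : Sh) : coef (w ++ [1]) x = coef w (derLast x) := by
  have : coef (w ++ [1]) = coef w ∘ₗ derLast := sh_ext fun v => by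
    rw [LinearMap.comp_apply]
    induction v using List.reverseRecOn with
    | nil => rw [wd_nil, derLast_one, map_zero, ← wd_nil, coef_wd, if_neg (by simp)]
    | append_singleton v b _ =>
      rw [derLast_concat, coef_wd]
      by_cases hb : b = 1
      · subst hb
        rw [if_pos rfl, coef_wd]
        simp
      · rw [if_neg hb, map_zero, if_neg]
        intro h
        exact hb (by simpa using (List.append_inj' h rfl).2)
  rw [this]; rfl

/-! ### The regularisation map -/

lemma eq_zero_of_derLast_one_mul {x : Sh} (h : derLast (wd [1] * x) = 0) : x = 0 := by
  have h0 : dual (wd [1]) = wd [0] := by rw [dual_wd]; rfl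
  have h1 : der 0 (wd [0] * dual x) = 0 := by
    rw [← h0, ← dual_mul, ← dual_dual (der 0 _)]
    exact (congrArg dual h).trans (map_zero _)
  rw [← dual_dual x, eq_zero_of_der_zero_mul h1, map_zero]

lemma exists_derLast_eq_zero (x : Sh) : ∃ y z, derLast y = 0 ∧ x = y + wd [1] * z := by
  obtain ⟨y, z, hy, hx⟩ := exists_der_eq_zero (dual x)
  have h0 : dual (wd [0]) = wd [1] := by rw [dual_wd]; rfl
  refine ⟨dual y, dual z, ?_, ?_⟩
  · rw [derLast, LinearMap.comp_apply, LinearMap.comp_apply, dual_dual, hy, map_zero]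
  · rw [← h0, ← dual_mul, ← map_add, ← hx, dual_dual]

/-- The sum of the kernel of `derLast` and the ideal generated by the word 1 is direct. Together
with `exists_derLast_eq_zero` this makes `regPart` a well-determined projection. -/
lemma eq_of_add_one_mul_eq {y z y' z' : Sh} (hy : derLast y = 0) (hy' : derLast y' = 0)
    (h : y + wd [1] * z = y' + wd [1] * z') : y = y' ∧ z = z' := by
  have h1 : wd [1] * (z - z') = y' - y := by rw [mul_sub]; linear_combination h
  have h2 : z - z' = 0 := eq_zero_of_derLast_one_mul (by rw [h1, map_sub, hy, hy', sub_zero])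
  obtain rfl := sub_eq_zero.mp h2
  exact ⟨add_right_cancel h, rfl⟩

lemma exists_regular_part (x : Sh) : ∃ y, derLast y = 0 ∧ ∃ z, x = y + wd [1] * z := by
  obtain ⟨y, z, hy, hx⟩ := exists_derLast_eq_zero x
  exact ⟨y, hy, z, hx⟩

/-- The projection onto the span of the words not ending with `1` that kills the multiples of
the word `1`. -/
noncomputable def regPart (x : Sh) : Sh := (exists_regular_part x).choose

lemma derLast_regPart (x : Sh) : derLast (regPart x) = 0 := (exists_regular_part x).choose_spec.1

lemma regPart_spec (x : Sh) : ∃ z, x = regPart x + wd [1] * z :=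
  (exists_regular_part x).choose_spec.2

lemma regPart_eq {x y z : Sh} (hy : derLast y = 0) (h : x = y + wd [1] * z) : regPart x = y := by
  obtain ⟨z', hz'⟩ := regPart_spec x
  exact (eq_of_add_one_mul_eq (derLast_regPart x) hy (hz'.symm.trans h)).1

/-- A projection onto a subalgebra along an ideal is multiplicative; the kernel of a derivation is a
subalgebra. -/
lemma regPart_mul (x y : Sh) : regPart (x * y) = regPart x * regPart y := by
  obtain ⟨z, hz⟩ := regPart_spec x
  obtain ⟨z', hz'⟩ := regPart_spec y
  refine regPart_eq (z := z * regPart y + regPart x * z' + wd [1] * z * z') ?_ ?_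
  · rw [derLast_mul, derLast_regPart, derLast_regPart, zero_mul, mul_zero, add_zero]
  · conv_lhs => rw [hz, hz']
    ring

lemma regPart_add (x y : Sh) : regPart (x + y) = regPart x + regPart y := by
  obtain ⟨z, hz⟩ := regPart_spec x
  obtain ⟨z', hz'⟩ := regPart_spec y
  refine regPart_eq (z := z + z') ?_ ?_
  · rw [map_add, derLast_regPart, derLast_regPart, add_zero]
  · conv_lhs => rw [hz, hz']
    ring

lemma regPart_smul (c : ℚ) (x : Sh) : regPart (c • x) = c • regPart x := by
  obtain ⟨z, hz⟩ := regPart_spec x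
  refine regPart_eq (z := c • z) ?_ ?_
  · rw [map_smul, derLast_regPart, smul_zero]
  · conv_lhs => rw [hz]
    rw [smul_add, mul_smul_comm]

/-- The regularisation map, as a linear map. -/
noncomputable def regMap : Sh →ₗ[ℚ] Sh where
  toFun := regPart
  map_add' := regPart_add
  map_smul' := regPart_smul

lemma regMap_mul (x y : Sh) : regMap (x * y) = regMap x * regMap y := regPart_mul x y

lemma derLast_regMap (x : Sh) : derLast (regMap x) = 0 := derLast_regPart x

lemma regMap_one_mul (x : Sh) : regMap (wd [1] * x) = 0 :=
  regPart_eq (z := x) (map_zero _) (zero_add _).symm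

lemma regMap_of_derLast {x : Sh} (h : derLast x = 0) : regMap x = x :=
  regPart_eq (z := 0) h (by rw [mul_zero, add_zero])

/-- Apply `der 0` to the decomposition of `x`. It kills the word 1 and commutes with `derLast`, so
it yields a decomposition of zero, and uniqueness applies. -/
lemma der_zero_regMap {x : Sh} (h : der 0 x = 0) : der 0 (regMap x) = 0 := by
  obtain ⟨z, hz⟩ := regPart_spec x
  have h1 : der 0 (regPart x) + wd [1] * der 0 z = 0 + wd [1] * 0 := by
    have := congrArg (der 0) hz
    rw [h, map_add, der_mul, der_cons, if_neg (by decide), zero_mul, zero_add] at this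
    rw [← this, zero_add, mul_zero]
  exact (eq_of_add_one_mul_eq (by rw [← der_derLast, derLast_regPart, map_zero]) (map_zero _) h1).1

/-! ### Convergent words -/

/-- An index is convergent when it is empty or its last letter is at least `2`. -/
def IsConv (n : Index) : Prop := ∀ m k, n = m ++ [k] → 2 ≤ k

lemma indexWord_append (m n : Index) : indexWord (m ++ n) = indexWord m ++ indexWord n := by
  induction m with
  | nil => rfl
  | cons k m ih => rw [List.cons_append, indexWord, ih, indexWord]; simp

lemma indexWord_singleton (k : ℕ+) : indexWord [k] = 1 :: List.replicate k.natPred 0 := by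
  rw [indexWord, indexWord, List.append_nil]

lemma derLast_indexWord {n : Index} (h : IsConv n) : derLast (wd (indexWord n)) = 0 := by
  induction n using List.reverseRecOn with
  | nil => exact derLast_one
  | append_singleton n k _ =>
    have h2 : 2 ≤ k := h n k rfl
    obtain ⟨j, hj⟩ : ∃ j, k.natPred = j + 1 := by
      have : (2 : ℕ) ≤ k := by exact_mod_cast h2
      exact ⟨k.natPred - 1, by have := k.natPred_add_one; omega⟩
    rw [indexWord_append, indexWord_singleton, hj, List.replicate_succ', ← List.cons_append,
      ← List.append_assoc, derLast_concat, if_neg (by decide)]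

/-- The two conditions exclude words that start with 0 and words that end with 1; what is left are
the words of convergent indices. -/
lemma mem_span_convergent {x : Sh} (h0 : der 0 x = 0) (h1 : derLast x = 0) :
    x ∈ Submodule.span ℚ ((fun n => wd (indexWord n)) '' {n | IsConv n}) := by
  have h : x = Finsupp.sum (M := ℚ) (α := Word) x fun w c => c • wd w := by
    have : ∀ w (c : ℚ), c • wd w = Finsupp.single w c := fun w c => by
      refine (Finsupp.smul_single c w (1 : ℚ)).trans ?_
      rw [smul_eq_mul, mul_one]
    simp only [this]
    exact (Finsupp.sum_single x).symm
  rw [h]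
  refine Submodule.sum_mem _ fun w hw => Submodule.smul_mem _ _ ?_
  have hw' : coef w x ≠ 0 := Finsupp.mem_support_iff (α := Word).mp hw
  obtain ⟨n, rfl⟩ := exists_indexWord w <| by
    rintro v rfl
    exact hw' (by rw [coef_cons, h0, map_zero])
  refine Submodule.subset_span ⟨n, ?_, rfl⟩
  rintro m k rfl
  by_contra hk
  obtain rfl : k = 1 := by
    have : (k : ℕ) < 2 := by exact_mod_cast not_le.mp hk
    exact PNat.eq (le_antisymm (by simpa using Nat.lt_succ_iff.mp this) k.pos)
  refine hw' ?_
  rw [indexWord_append, indexWord_singleton]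
  exact (coef_concat_one _ _).trans (by rw [h1, map_zero])

/-! ### Regularised zeta values as a functional on words -/

/-- The map `w ↦ ζ^sh(w)` on the shuffle algebra. -/
noncomputable def zetaLin : Sh →ₗ[ℚ] ℝ := (onWords fun w => mzv (wordIndex w)) ∘ₗ regMap

lemma zetaLin_one_mul (x : Sh) : zetaLin (wd [1] * x) = 0 := by
  rw [zetaLin, LinearMap.comp_apply, regMap_one_mul, map_zero]

lemma zetaLin_of_derLast {x : Sh} (h : derLast x = 0) :
    zetaLin x = onWords (fun w => mzv (wordIndex w)) x := by
  rw [zetaLin, LinearMap.comp_apply, regMap_of_derLast h]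

lemma one_mul_app_one (x : Sh) : wd [1] * app 1 x = app 1 (app 1 x) + app 1 (wd [1] * x) := by
  have : LinearMap.mulLeft ℚ (wd [1]) ∘ₗ app 1 =
      app 1 ∘ₗ app 1 + app 1 ∘ₗ LinearMap.mulLeft ℚ (wd [1]) := sh_ext fun w => by
    simp only [LinearMap.comp_apply, LinearMap.add_apply, LinearMap.mulLeft_apply, app_wd]
    have h := wd_snoc_mul 1 1 [] w
    rw [List.nil_append, wd_nil, one_mul, app_wd] at h
    exact h
  exact LinearMap.congr_fun this x

lemma one_mul_app_zero (x : Sh) : wd [1] * app 0 x = app 1 (app 0 x) + app 0 (wd [1] * x) := by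
  have : LinearMap.mulLeft ℚ (wd [1]) ∘ₗ app 0 =
      app 1 ∘ₗ app 0 + app 0 ∘ₗ LinearMap.mulLeft ℚ (wd [1]) := sh_ext fun w => by
    simp only [LinearMap.comp_apply, LinearMap.add_apply, LinearMap.mulLeft_apply, app_wd]
    have h := wd_snoc_mul 1 0 [] w
    rw [List.nil_append, wd_nil, one_mul, app_wd] at h
    exact h
  exact LinearMap.congr_fun this x

lemma one_mul_app_pow (k : ℕ) (x : Sh) : wd [1] * (app 1 ^ k) (app 0 x) =
    ((k : ℚ) + 1) • (app 1 ^ (k + 1)) (app 0 x) + (app 1 ^ k) (app 0 (wd [1] * x)) := by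
  induction k with
  | zero => simp [one_mul_app_zero]
  | succ k ih =>
    rw [pow_succ' _ k, Module.End.mul_apply, one_mul_app_one, ih, map_add, map_smul,
      ← Module.End.mul_apply (app 1) (app 1 ^ k), ← Module.End.mul_apply (app 1) (app 1 ^ (k + 1)),
      ← Module.End.mul_apply (app 1) (app 1 ^ k), ← pow_succ', ← pow_succ']
    rw [← Module.End.mul_apply, ← pow_succ']
    push_cast
    module

lemma one_mul_app_pow_one (k : ℕ) : wd [1] * (app 1 ^ k) 1 =
    ((k : ℚ) + 1) • (app 1 ^ (k + 1)) 1 := by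
  induction k with
  | zero =>
    rw [pow_zero, Module.End.one_apply, mul_one, zero_add, pow_one, ← wd_nil, app_wd]
    simp
  | succ k ih =>
    rw [pow_succ' _ k, Module.End.mul_apply, one_mul_app_one, ih, map_smul,
      ← Module.End.mul_apply (app 1) (app 1 ^ k), ← Module.End.mul_apply (app 1) (app 1 ^ (k + 1)),
       ← pow_succ', ← pow_succ', ← Module.End.mul_apply, ← pow_succ']
    push_cast
    module

lemma app_one_pow_wd (k : ℕ) (w : Word) : (app 1 ^ k) (wd w) = wd (w ++ List.replicate k 1) := by
  induction k with
  | zero => simp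
  | succ k ih =>
    rw [pow_succ', Module.End.mul_apply, ih, app_wd, List.replicate_succ', List.append_assoc]

/-- At T = 0 the term with `X` disappears from the recursion for `zetaRegAux`. What remains is
`zetaLin` applied to `one_mul_app_pow`, whose left side is killed as a multiple of the word 1. -/
lemma coeff_zetaRegAux (u : Word) (k : ℕ) :
    (zetaRegAux u k).coeff 0 = zetaLin ((app 1 ^ k) (app 0 (wd u))) := by
  induction k generalizing u with
  | zero =>
    rw [zetaRegAux, Polynomial.coeff_C_zero, pow_zero, Module.End.one_apply, app_wd,
      zetaLin_of_derLast (by rw [derLast_concat, if_neg (by decide)]), onWords_wd]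
  | succ k ih =>
    have h := congrArg zetaLin (one_mul_app_pow k (wd u))
    have h2 : zetaLin ((app 1 ^ k) (app 0 (wd [1] * wd u))) =
        (shuffle [1] u).sum fun v (c : ℚ) => (c : ℝ) * (zetaRegAux v k).coeff 0 := by
      have h3 := onWords_shuffle (fun v => (zetaRegAux v k).coeff 0) [1] u
      rw [Finsupp.linearCombination_apply] at h3
      simp only [Rat.smul_def] at h3
      rw [h3]
      have : zetaLin ∘ₗ (app 1 ^ k) ∘ₗ app 0 = onWords fun v => (zetaRegAux v k).coeff 0 :=
        sh_ext fun v => by rw [onWords_wd, ih]; rfl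
      rw [← this]; rfl
    rw [zetaLin_one_mul, map_add, map_smul, h2, Rat.smul_def] at h
    rw [zetaRegAux, Polynomial.coeff_C_mul, Polynomial.coeff_sub, Polynomial.coeff_X_mul_zero,
      Finsupp.sum, Polynomial.finsetSum_coeff]
    simp only [Polynomial.coeff_C_mul]
    rw [Finsupp.sum] at h
    have hk : ((k : ℝ) + 1) ≠ 0 := by positivity
    field_simp
    push_cast at h
    linear_combination h

lemma coeff_zetaReg (w : Word) : (zetaReg w).coeff 0 = zetaLin (wd w) := by
  have hsplit := List.takeWhile_append_dropWhile (p := fun a : Fin 2 => decide (a = 1))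
    (l := w.reverse)
  have hrep : w.reverse.takeWhile (· = 1) =
      List.replicate (w.reverse.takeWhile (· = 1)).length 1 := by
    refine List.eq_replicate_of_mem fun a ha => ?_
    simpa using List.mem_takeWhile_imp ha
  have hw : w = (w.reverse.dropWhile (· = 1)).reverse ++
      List.replicate (w.reverse.takeWhile (· = 1)).length 1 := by
    conv_lhs => rw [← List.reverse_reverse w, ← hsplit, List.reverse_append]
    rw [hrep, List.reverse_replicate, List.length_replicate]
  have hhead : ∀ b u, w.reverse.dropWhile (· = 1) = b :: u → b = 0 := fun b u h => by
    have := List.head_dropWhile_not (fun a : Fin 2 => decide (a = 1)) (l := w.reverse)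
      (by simp [h])
    simp only [h, List.head_cons, decide_eq_false_iff_not] at this
    omega
  rw [zetaReg]
  generalize (w.reverse.takeWhile (· = 1)).length = k at hw ⊢
  generalize w.reverse.dropWhile (· = 1) = r at hw hhead ⊢
  match r with
  | [] =>
    rw [hw]
    simp only [List.reverse_nil]
    rw [← app_one_pow_wd, wd_nil, Polynomial.coeff_C_mul, Polynomial.coeff_X_pow]
    cases k with
    | zero =>
      rw [pow_zero, Module.End.one_apply, zetaLin_of_derLast derLast_one, ← wd_nil, onWords_wd]
      have : mzv (wordIndex []) = 1 := by
        rw [show wordIndex [] = [] from rfl, mzv]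
        have hp : ∀ m : {m : Fin ([] : Index).length → ℕ // StrictMono m ∧ ∀ i, 0 < m i},
            ∏ i, ((m.1 i : ℝ) ^ (([] : Index).get i : ℕ))⁻¹ = 1 := fun m =>
          Finset.prod_of_isEmpty (ι := Fin 0) _
        simp only [hp]
        rw [tsum_eq_single ⟨fun i => i.elim0, fun i => i.elim0, fun i => i.elim0⟩]
        intro m hm
        exact absurd (Subtype.ext (funext fun i => i.elim0)) hm
      simp [this]
    | succ k =>
      -- A positive power 1^{k+1} is a rational multiple of the shuffle of 1 with 1^k, so its
      -- regularised value is zero, like the constant term of T^{k+1}.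
      have h := congrArg zetaLin (one_mul_app_pow_one k)
      rw [zetaLin_one_mul, map_smul] at h
      have hk : ((k : ℚ) + 1) ≠ 0 := by positivity
      rw [(smul_eq_zero.mp h.symm).resolve_left hk]
      simp
  | b :: u =>
    obtain rfl := hhead b u rfl
    change (zetaRegAux u.reverse k).coeff 0 = _
    rw [coeff_zetaRegAux, app_wd, app_one_pow_wd, hw]
    simp

lemma zetaSh_eq (n : Index) : zetaSh n = zetaLin (wd (indexWord n)) := coeff_zetaReg _

end MES

namespace MES

/-! ### Multiple polylogarithms -/

section Polylog

open PowerSeries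

/-- The primitive of `f dx / x` without constant term, for `f` without constant term. -/
noncomputable def thetaInt (f : ℝ⟦X⟧) : ℝ⟦X⟧ := mk fun n => (n : ℝ)⁻¹ * coeff n f

/-- The derivation `x d/dx`. -/
noncomputable def theta (f : ℝ⟦X⟧) : ℝ⟦X⟧ := X * derivative ℝ f

lemma coeff_theta (f : ℝ⟦X⟧) (n : ℕ) : coeff n (theta f) = n * coeff n f := by
  cases n with
  | zero => simp [theta]
  | succ n => rw [theta, coeff_succ_X_mul, coeff_derivative]; push_cast; ring

lemma theta_thetaInt (f : ℝ⟦X⟧) : theta (thetaInt f) = f - C (constantCoeff f) := by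
  ext n
  rw [coeff_theta, thetaInt, coeff_mk, map_sub]
  cases n with
  | zero => simp
  | succ n =>
    have : ((n + 1 : ℕ) : ℝ) ≠ 0 := by positivity
    rw [mul_inv_cancel_left₀ this, coeff_C, if_neg (by simp), sub_zero]

lemma theta_mul (f g : ℝ⟦X⟧) : theta (f * g) = theta f * g + f * theta g := by
  rw [theta, Derivation.leibniz, theta, theta]; simp only [smul_eq_mul]; ring

lemma theta_add (f g : ℝ⟦X⟧) : theta (f + g) = theta f + theta g := by
  rw [theta, map_add, theta, theta]; ring

lemma eq_of_theta_eq {f g : ℝ⟦X⟧} (h : theta f = theta g)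
    (h0 : constantCoeff f = constantCoeff g) : f = g := by
  ext n
  cases n with
  | zero => simpa using h0
  | succ n =>
    have := congrArg (coeff (n + 1)) h
    rw [coeff_theta, coeff_theta] at this
    exact mul_left_cancel₀ (by positivity) this

/-- The form attached to a letter, `1` or `x / (1 - x)`, divided by `dx / x`. -/
noncomputable def letterForm (a : Fin 2) : ℝ⟦X⟧ := if a = 0 then 1 else X * mk 1

/-- The generating series of a reversed word. -/
noncomputable def polylogRev : Word → ℝ⟦X⟧
  | [] => 1
  | a :: w => thetaInt (letterForm a * polylogRev w)

/-- The generating series of a word. -/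
noncomputable def polylog (w : Word) : ℝ⟦X⟧ := polylogRev w.reverse

lemma polylog_nil : polylog [] = 1 := rfl

lemma polylog_concat (w : Word) (a : Fin 2) :
    polylog (w ++ [a]) = thetaInt (letterForm a * polylog w) := by
  rw [polylog, List.reverse_append]; rfl

lemma constantCoeff_thetaInt (f : ℝ⟦X⟧) : constantCoeff (thetaInt f) = 0 := by
  rw [← coeff_zero_eq_constantCoeff_apply, thetaInt, coeff_mk]; simp

/-- Appending a letter is integration, which `theta` undoes up to the constant term. This term is
zero unless the form is dx/x and the word is empty, the logarithmic case excluded here. -/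
lemma theta_polylog_concat (w : Word) (a : Fin 2) (h : a = 0 → w ≠ []) :
    theta (polylog (w ++ [a])) = letterForm a * polylog w := by
  rw [polylog_concat, theta_thetaInt, map_mul]
  by_cases ha : a = 0
  · obtain ⟨v, b, rfl⟩ : ∃ v b, w = v ++ [b] :=
      ⟨_, _, (List.dropLast_append_getLast (h ha)).symm⟩
    rw [polylog_concat, constantCoeff_thetaInt]; simp
  · rw [letterForm, if_neg ha]; simp

lemma theta_onWords_app (a : Fin 2) (x : Sh) : theta (onWords polylog (app a x)) =
    letterForm a * onWords polylog x -
      C (constantCoeff (letterForm a * onWords polylog x)) := by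
  induction x using sh_induction with
  | h0 =>
    simp only [map_zero, mul_zero, sub_zero]
    rw [theta, map_zero, mul_zero]
  | hs w => rw [app_wd, onWords_wd, onWords_wd, polylog_concat, theta_thetaInt]
  | ha x y hx hy => simp only [map_add, theta_add, hx, hy, mul_add]; ring
  | hc c x hx =>
    have h1 : ∀ f : ℝ⟦X⟧, theta (c • f) = c • theta f := fun f => by
      ext n
      rw [coeff_theta]
      change (n : ℝ) * (c • coeff n f) = c • coeff n (theta f)
      rw [coeff_theta, mul_smul_comm]
    have h2 : ∀ f : ℝ⟦X⟧, C (constantCoeff (c • f)) = c • C (constantCoeff f) := fun f => by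
      rw [show constantCoeff (c • f) = c • constantCoeff f from rfl]
      ext n
      change _ = c • coeff n (C (constantCoeff f))
      rw [coeff_C, coeff_C]
      split_ifs <;> simp
    rw [map_smul, map_smul, h1, map_smul, hx, mul_smul_comm, h2, smul_sub]

lemma constantCoeff_onWords_app (a : Fin 2) (x : Sh) :
    constantCoeff (onWords polylog (app a x)) = 0 := by
  induction x using sh_induction with
  | h0 => simp
  | hs w => rw [app_wd, onWords_wd, polylog_concat, constantCoeff_thetaInt]
  | ha x y hx hy => simp only [map_add, hx, hy, add_zero]
  | hc c x hx =>
    rw [map_smul, map_smul]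
    change c • constantCoeff (onWords polylog (app a x)) = 0
    rw [hx, smul_zero]

/-- Multiplicativity of polylogarithms, for words not starting with `0`. -/
lemma onWords_polylog_mul (u v : Word) (hu : ∀ w, u ≠ 0 :: w) (hv : ∀ w, v ≠ 0 :: w) :
    onWords polylog (wd u * wd v) = polylog u * polylog v := by
  induction hn : u.length + v.length using Nat.strong_induction_on generalizing u v with
  | _ n ih =>
    rcases List.eq_nil_or_concat u with rfl | ⟨u, a, rfl⟩
    · rw [wd_nil, one_mul, onWords_wd, polylog_nil, one_mul]
    rcases List.eq_nil_or_concat v with rfl | ⟨v, b, rfl⟩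
    · rw [wd_nil, mul_one, onWords_wd, polylog_nil, mul_one]
    simp only [List.concat_eq_append] at *
    have pref : ∀ (u : Word) (a : Fin 2), (∀ w, u ++ [a] ≠ 0 :: w) →
        (∀ w, u ≠ 0 :: w) ∧ (a = 0 → u ≠ []) := fun u a h =>
      ⟨fun w hw => h (w ++ [a]) (by rw [hw]; rfl), fun ha hu => h [] (by rw [ha, hu]; rfl)⟩
    obtain ⟨hu1, hu2⟩ := pref u a hu
    obtain ⟨hv1, hv2⟩ := pref v b hv
    simp only [List.length_append, List.length_singleton] at hn
    have ih1 := ih (u.length + (v.length + 1)) (by omega) u (v ++ [b]) hu1 hv (by simp)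
    have ih2 := ih (u.length + 1 + v.length) (by omega) (u ++ [a]) v hu hv1 (by simp)
    have hc : ∀ w (c : Fin 2), constantCoeff (polylog (w ++ [c])) = 0 := fun w c => by
      rw [polylog_concat, constantCoeff_thetaInt]
    rw [wd_snoc_mul]
    -- The recursion of the shuffle product on last letters is the Leibniz rule for `theta`; both
    -- sides have zero constant term.
    refine eq_of_theta_eq ?_ ?_
    · rw [map_add, theta_add, theta_onWords_app, theta_onWords_app, ih1, ih2, theta_mul,
        theta_polylog_concat u a hu2, theta_polylog_concat v b hv2]
      simp only [map_mul, hc]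
      simp
      ring
    · rw [map_add, map_add, constantCoeff_onWords_app, constantCoeff_onWords_app, map_mul, hc]
      simp

/-! ### Partial sums of multiple zeta values -/

/-- The summand `m^{-k}` of multiple zeta values. -/
noncomputable def zetaFn (k : ℕ+) (m : ℕ) : ℝ := ((m : ℝ) ^ (k : ℕ))⁻¹

lemma coeff_succ_X_mul_mk_one (f : ℝ⟦X⟧) (n : ℕ) :
    coeff (n + 1) (X * mk 1 * f) = ∑ m ∈ Finset.range (n + 1), coeff m f := by
  rw [mul_assoc, coeff_succ_X_mul, mul_comm, coeff_mul, Finset.Nat.sum_antidiagonal_eq_sum_range_succ_mk]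
  simp

lemma polylog_indexWord_concat (n : Index) (k : ℕ+) (m : ℕ) :
    coeff m (polylog (indexWord (n ++ [k]))) =
      zetaFn k m * coeff m (X * mk 1 * polylog (indexWord n)) := by
  have h : ∀ j, coeff m (polylog (indexWord n ++ 1 :: List.replicate j 0)) =
      ((m : ℝ) ^ (j + 1))⁻¹ * coeff m (X * mk 1 * polylog (indexWord n)) := by
    intro j
    induction j with
    | zero =>
      rw [List.replicate_zero, polylog_concat, thetaInt, coeff_mk, letterForm, if_neg (by decide)]
      simp
    | succ j ih =>
      rw [List.replicate_succ', ← List.cons_append, ← List.append_assoc, polylog_concat, thetaInt,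
        coeff_mk, letterForm, if_pos rfl, one_mul, ih, pow_succ _ (j + 1), mul_inv]
      ring
  rw [indexWord_append, indexWord_singleton, h, PNat.natPred_add_one, zetaFn]

/-- Multiplication by x/(1-x) forms partial sums of coefficients. Summing the coefficients thus
amounts to evaluating the polylogarithm at x = 1, with the truncated multiple sum as partial sum. -/
lemma sum_coeff_polylog (n : Index) (N : ℕ) :
    ∑ m ∈ Finset.range (N + 1), coeff m (polylog (indexWord n)) =
      multiSum zetaFn (List.range' 1 N) n := by
  induction n using List.reverseRecOn generalizing N with
  | nil =>
    rw [multiSum_nil_right, Finset.sum_range_succ']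
    simp [indexWord, polylog_nil, coeff_one]
  | append_singleton n k ih =>
    induction N with
    | zero =>
      simp only [zero_add, Finset.sum_range_one, List.range'_zero, multiSum, unitFn_concat]
      rw [polylog_indexWord_concat]
      simp [zetaFn]
    | succ N ihN =>
      rw [Finset.sum_range_succ, ihN, polylog_indexWord_concat, coeff_succ_X_mul_mk_one, ih,
        List.range'_concat, multiSum_concat_concat, one_mul, Nat.add_comm 1 N]
      ring

lemma zetaFn_nonneg (k : ℕ+) (m : ℕ) : 0 ≤ zetaFn k m := by unfold zetaFn; positivity

lemma conv_nonneg {ι : Type} {f g : List ι → ℝ} (hf : ∀ n, 0 ≤ f n) (hg : ∀ n, 0 ≤ g n)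
    (n : List ι) : 0 ≤ conv f g n := by
  rw [conv, lcut_eq_sum]
  exact Finset.sum_nonneg fun i _ => mul_nonneg (hf _) (hg _)

lemma unitFn_nonneg {ι : Type} (n : List ι) : (0 : ℝ) ≤ unitFn n := by
  cases n <;> simp [unitFn]

lemma multiSum_nonneg {ι α : Type} {φ : ι → α → ℝ} (h : ∀ i x, 0 ≤ φ i x) (L : List α)
    (n : List ι) : 0 ≤ multiSum φ L n := by
  induction L generalizing n with
  | nil => exact unitFn_nonneg n
  | cons x L ih =>
    refine conv_nonneg (fun n => ?_) ih n
    cases n with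
    | nil => exact zero_le_one
    | cons i n => exact mul_nonneg (h _ _) (unitFn_nonneg n)

lemma coeff_polylog_nonneg (n : Index) (m : ℕ) : 0 ≤ coeff m (polylog (indexWord n)) := by
  induction n using List.reverseRecOn with
  | nil => rw [indexWord, polylog_nil, coeff_one]; split_ifs <;> simp
  | append_singleton n k _ =>
    rw [polylog_indexWord_concat]
    cases m with
    | zero => simp
    | succ m =>
      rw [coeff_succ_X_mul_mk_one, sum_coeff_polylog]
      exact mul_nonneg (zetaFn_nonneg _ _) (multiSum_nonneg zetaFn_nonneg _ _)

/-- Drop the ordering and replace each exponent by 1: every entry then contributes at most a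
harmonic number. Logarithmic growth is all that convergence with a last entry of at least 2
requires. -/
lemma multiSum_zetaFn_le (n : Index) (N : ℕ) :
    multiSum zetaFn (List.range' 1 N) n ≤ (1 + Real.log N) ^ n.length := by
  have hmono : ∀ n : Index, Monotone fun N => multiSum zetaFn (List.range' 1 N) n := fun n => by
    refine monotone_nat_of_le_succ fun N => ?_
    rw [← sum_coeff_polylog, ← sum_coeff_polylog, Finset.sum_range_succ _ (N + 1)]
    exact le_add_of_nonneg_right (coeff_polylog_nonneg _ _)
  have hH : ∀ N : ℕ, ∑ m ∈ Finset.range N, ((m + 1 : ℕ) : ℝ)⁻¹ ≤ 1 + Real.log N := fun N => by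
    have := harmonic_le_one_add_log N
    rw [_root_.harmonic] at this
    push_cast at this ⊢
    exact this
  induction n using List.reverseRecOn with
  | nil => simp
  | append_singleton n k ih =>
    have h1 : multiSum zetaFn (List.range' 1 N) (n ++ [k]) =
        ∑ m ∈ Finset.range N, zetaFn k (m + 1) * multiSum zetaFn (List.range' 1 m) n := by
      rw [← sum_coeff_polylog, Finset.sum_range_succ']
      simp only [polylog_indexWord_concat, coeff_succ_X_mul_mk_one, sum_coeff_polylog]
      simp
    rw [h1, List.length_append, List.length_singleton, pow_succ']
    calc _ ≤ ∑ m ∈ Finset.range N, ((m + 1 : ℕ) : ℝ)⁻¹ * multiSum zetaFn (List.range' 1 N) n := by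
          refine Finset.sum_le_sum fun m hm => ?_
          refine mul_le_mul ?_ (hmono n (Finset.mem_range.mp hm).le)
            (multiSum_nonneg zetaFn_nonneg _ _) (by positivity)
          rw [zetaFn]
          refine inv_anti₀ (by positivity) ?_
          refine le_self_pow₀ ?_ k.ne_zero
          push_cast
          linarith [Nat.cast_nonneg (α := ℝ) m]
      _ ≤ _ := by
          rw [← Finset.sum_mul]
          refine mul_le_mul (hH N) ih (multiSum_nonneg zetaFn_nonneg _ _) ?_
          exact le_trans (Finset.sum_nonneg fun _ _ => by positivity) (hH N)

lemma summable_log_pow (r : ℕ) : Summable fun m : ℕ => (1 + Real.log m) ^ r * ((m : ℝ) ^ 2)⁻¹ := by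
  -- A power of the logarithm is O(x^{1/2}), which leaves terms of size m^{-3/2}.
  have h1 : (fun x : ℝ => (1 + Real.log x) ^ r) =O[Filter.atTop] fun x => x ^ (1 / 2 : ℝ) := by
    have ha : (fun x : ℝ => 1 + Real.log x) =O[Filter.atTop] Real.log := by
      refine Asymptotics.IsBigO.add ?_ (Asymptotics.isBigO_refl _ _)
      exact (Real.isLittleO_const_log_atTop (c := 1)).isBigO
    refine (ha.pow r).trans ?_
    have := (isLittleO_log_rpow_rpow_atTop (r : ℝ) (show (0 : ℝ) < 1 / 2 by norm_num)).isBigO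
    simpa using this
  have h2 := (h1.comp_tendsto tendsto_natCast_atTop_atTop).mul
    (Asymptotics.isBigO_refl (fun m : ℕ => ((m : ℝ) ^ 2)⁻¹) Filter.atTop)
  refine summable_of_isBigO_nat (Real.summable_nat_rpow_inv.mpr (show (1 : ℝ) < 3 / 2 by norm_num))
    (h2.trans (Asymptotics.IsBigO.of_bound 1 ?_))
  filter_upwards [Filter.eventually_gt_atTop 0] with m hm
  have hm : (0 : ℝ) < m := by exact_mod_cast hm
  simp only [Function.comp_apply]
  rw [← Real.rpow_natCast, ← Real.rpow_neg hm.le, ← Real.rpow_neg hm.le, ← Real.rpow_add hm, one_mul]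
  norm_num

lemma summable_coeff_polylog {n : Index} (hn : IsConv n) :
    Summable fun m => coeff m (polylog (indexWord n)) := by
  rcases List.eq_nil_or_concat n with rfl | ⟨n, k, rfl⟩
  · refine summable_of_ne_finset_zero (s := {0}) fun m hm => ?_
    rw [indexWord, polylog_nil, coeff_one, if_neg (by simpa using hm)]
  · rw [List.concat_eq_append] at *
    have hk : (2 : ℕ) ≤ k := by exact_mod_cast hn n k rfl
    refine Summable.of_nonneg_of_le (coeff_polylog_nonneg _) (fun m => ?_)
      (summable_log_pow n.length)
    rw [polylog_indexWord_concat]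
    cases m with
    | zero => simp
    | succ m =>
      rw [coeff_succ_X_mul_mk_one, sum_coeff_polylog, mul_comm]
      have hm : (1 : ℝ) ≤ (m + 1 : ℕ) := by push_cast; linarith [Nat.cast_nonneg (α := ℝ) m]
      refine mul_le_mul ((multiSum_zetaFn_le n m).trans ?_) ?_ (zetaFn_nonneg _ _) ?_
      · have h0 : (0 : ℝ) ≤ Real.log m := Real.log_natCast_nonneg m
        refine pow_le_pow_left₀ (by linarith) ?_ _
        rcases Nat.eq_zero_or_pos m with rfl | hm
        · simp
        · have hm : (0 : ℝ) < m := by exact_mod_cast hm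
          gcongr
          simp
      · exact inv_anti₀ (by positivity) (pow_le_pow_right₀ hm hk)
      · have := Real.log_nonneg hm
        positivity

/-! ### Multiple zeta values as limits of truncated sums -/

/-- A sum of nonnegative terms, computed along an exhaustion by finite sets. -/
lemma hasSum_of_tendsto_sum {X : Type} {f : X → ℝ} (hf : ∀ x, 0 ≤ f x) {F : ℕ → Finset X}
    (hF : Monotone F) (hx : ∀ x, ∃ N, x ∈ F N) {a : ℝ}
    (ha : Filter.Tendsto (fun N => ∑ x ∈ F N, f x) Filter.atTop (nhds a)) : HasSum f a := by
  have hF' := Filter.tendsto_atTop_finset_of_monotone hF hx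
  have hmono : Monotone fun N => ∑ x ∈ F N, f x := fun i j hij =>
    Finset.sum_le_sum_of_subset_of_nonneg (hF hij) fun _ _ _ => hf _
  have hsum : Summable f := summable_of_sum_le hf (c := a) fun s => by
    obtain ⟨N, hN⟩ := ((Filter.tendsto_atTop.mp hF' s)).exists
    exact (Finset.sum_le_sum_of_subset_of_nonneg hN fun _ _ _ => hf _).trans
      (hmono.ge_of_tendsto ha N)
  obtain ⟨b, hb⟩ := hsum
  rwa [tendsto_nhds_unique ha (hb.comp hF')]

/-- The terms are nonnegative, so the unordered sum can be computed along the boxes u_r ≤ N, which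
exhaust the index set because each entry is at most the sum of all entries. -/
lemma hasSum_mzv {n : Index} {a : ℝ} (h : Filter.Tendsto
    (fun N => multiSum zetaFn (List.range' 1 N) n) Filter.atTop (nhds a)) : mzv n = a := by
  classical
  let s : ℕ → Finset (Fin n.length → ℕ) := fun N =>
    (Fintype.piFinset fun _ => Finset.Icc 1 N).filter StrictMono
  have hs : ∀ N, ∀ m ∈ s N, StrictMono m ∧ ∀ i, 0 < m i := fun N m hm => by
    simp only [s, Finset.mem_filter, Fintype.mem_piFinset, Finset.mem_Icc] at hm
    exact ⟨hm.2, fun i => (hm.1 i).1⟩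
  refine HasSum.tsum_eq (hasSum_of_tendsto_sum (F := fun N => (s N).subtype _) ?_ ?_ ?_ ?_)
  · exact fun m => Finset.prod_nonneg fun i _ => by positivity
  · intro N M hNM m hm
    simp only [s, Finset.mem_subtype, Finset.mem_filter, Fintype.mem_piFinset, Finset.mem_Icc]
      at hm ⊢
    exact ⟨fun i => ⟨(hm.1 i).1, (hm.1 i).2.trans hNM⟩, hm.2⟩
  · intro m
    refine ⟨∑ i, m.1 i, ?_⟩
    simp only [s, Finset.mem_subtype, Finset.mem_filter, Fintype.mem_piFinset, Finset.mem_Icc]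
    exact ⟨fun i => ⟨m.2.2 i, Finset.single_le_sum (f := m.1) (fun _ _ => Nat.zero_le _)
      (Finset.mem_univ i)⟩, m.2.1⟩
  · refine h.congr fun N => ?_
    rw [Finset.sum_subtype_of_mem (fun m : Fin n.length → ℕ => ∏ i, ((m i : ℝ) ^ (n.get i : ℕ))⁻¹)
      (hs N)]
    exact (sum_strictMono_eq_multiSum zetaFn (List.range' 1 N) List.pairwise_lt_range' n
      (Finset.Icc 1 N) (by intro x; simp; omega)).symm

lemma hasSum_coeff_polylog {n : Index} (hn : IsConv n) :
    HasSum (fun m => coeff m (polylog (indexWord n))) (mzv n) := by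
  obtain ⟨a, ha⟩ := summable_coeff_polylog hn
  have h := (ha.tendsto_sum_nat.comp (Filter.tendsto_add_atTop_nat 1)).congr
    fun N => sum_coeff_polylog n N
  rwa [hasSum_mzv h]

lemma tendsto_multiSum_mzv {n : Index} (hn : IsConv n) : Filter.Tendsto
    (fun N => multiSum zetaFn (List.range' 1 N) n) Filter.atTop (nhds (mzv n)) :=
  ((hasSum_coeff_polylog hn).tendsto_sum_nat.comp (Filter.tendsto_add_atTop_nat 1)).congr
    fun N => sum_coeff_polylog n N

lemma zetaSh_eq_mzv {n : Index} (hn : IsConv n) : zetaSh n = mzv n := by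
  rw [zetaSh_eq, zetaLin_of_derLast (derLast_indexWord hn), onWords_wd, wordIndex_indexWord]

lemma hasSum_onWords_polylog {x : Sh}
    (hx : x ∈ Submodule.span ℚ ((fun n => wd (indexWord n)) '' {n | IsConv n})) :
    HasSum (fun m => coeff m (onWords polylog x)) (onWords (fun w => mzv (wordIndex w)) x) := by
  induction hx using Submodule.span_induction with
  | mem x hx =>
    obtain ⟨n, hn, rfl⟩ := hx
    simp only [onWords_wd, wordIndex_indexWord]
    exact hasSum_coeff_polylog hn
  | zero => simp [hasSum_zero]
  | add x y _ _ hx hy => simpa using hx.add hy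
  | smul c x _ hx =>
    have h := hx.const_smul c
    rw [← map_smul] at h
    convert h using 2 with m
    rw [map_smul]; rfl

/-- The product of polylogarithms is a Cauchy product of series whose coefficients are absolutely
summable. Shuffles of convergent words are combinations of convergent words, since `der 0` and
`derLast` are derivations. -/
lemma onWords_mzv_mul {x y : Sh}
    (hx : x ∈ Submodule.span ℚ ((fun n => wd (indexWord n)) '' {n | IsConv n}))
    (hy : y ∈ Submodule.span ℚ ((fun n => wd (indexWord n)) '' {n | IsConv n})) :
    onWords (fun w => mzv (wordIndex w)) (x * y) =
      onWords (fun w => mzv (wordIndex w)) x * onWords (fun w => mzv (wordIndex w)) y := by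
  induction hx using Submodule.span_induction with
  | zero => simp
  | add x x' _ _ h h' => simp only [add_mul, map_add, h, h']
  | smul c x _ h => simp only [smul_mul_assoc, map_smul, h]
  | mem x hx =>
  induction hy using Submodule.span_induction with
  | zero => simp
  | add x x' _ _ h h' => simp only [mul_add, map_add, h, h']
  | smul c x _ h => simp only [mul_smul_comm, map_smul, h]
  | mem y hy =>
  obtain ⟨n, hn, rfl⟩ := hx
  obtain ⟨k, hk, rfl⟩ := hy
  have h1 := hasSum_onWords_polylog (x := wd (indexWord n) * wd (indexWord k))
    (mem_span_convergent (by rw [der_mul, der_indexWord, der_indexWord, zero_mul, mul_zero, add_zero])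
      (by rw [derLast_mul, derLast_indexWord hn, derLast_indexWord hk, zero_mul, mul_zero, add_zero]))
  rw [onWords_polylog_mul _ _ (indexWord_ne_zero_cons n) (indexWord_ne_zero_cons k)] at h1
  rw [← h1.tsum_eq, onWords_wd, onWords_wd]
  simp only [wordIndex_indexWord, coeff_mul]
  rw [← (hasSum_coeff_polylog hn).tsum_eq, ← (hasSum_coeff_polylog hk).tsum_eq,
    tsum_mul_tsum_eq_tsum_sum_antidiagonal_of_summable_norm
      (summable_coeff_polylog hn).norm (summable_coeff_polylog hk).norm]

/-- Regularisation is multiplicative and lands in the span of convergent words, where the preceding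
lemma applies. -/
lemma zMap_mul (x y : RegInt) : zMap (x * y) = zMap x * zMap y := by
  refine constr_mul zetaSh zetaLin (fun n => (zetaSh_eq n).symm) (fun n m => ?_) x y
  have hmem : ∀ n, regMap (wd (indexWord n)) ∈
      Submodule.span ℚ ((fun n => wd (indexWord n)) '' {n | IsConv n}) := fun n =>
    mem_span_convergent (der_zero_regMap (der_indexWord n)) (derLast_regMap _)
  rw [zetaSh_eq, zetaSh_eq, zetaLin, LinearMap.comp_apply, regMap_mul,
    onWords_mzv_mul (hmem n) (hmem m)]
  rfl

end Polylog

end MES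

namespace MES

/-! ### The regularised multiple Eisenstein series as a character of the shuffle algebra -/

section Eisenstein

/-- The image of `I(a; w; b)` under `𝔷^sh`, as a power series. -/
noncomputable def zFam (a b : Fin 2) (w : Word) : PowerSeries ℂ :=
  algebraMap ℝ (PowerSeries ℂ) (zMap (regInt a w b))

/-- The image of `I(0; w; 1)` under `𝔤^sh`. -/
noncomputable def gFam (w : Word) : PowerSeries ℂ := gMap (regInt 0 w 1)

lemma shChar_regInt {M : Type} [CommRing M] [Algebra ℚ M] (f : RegInt →ₗ[ℚ] M)
    (h1 : f 1 = 1) (hf : ∀ x y, f (x * y) = f x * f y) (a b : Fin 2) :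
    ShChar fun w => f (regInt a w b) where
  nil := by rw [regInt_nil, h1]
  mul u v := by
    rw [← hf, regInt_mul]
    exact (LinearMap.congr_fun (f := onWords fun w => f (regInt a w b))
      (g := f ∘ₗ onWords fun w => regInt a w b) (sh_ext fun w => by
        rw [onWords_wd, LinearMap.comp_apply, onWords_wd]) (wd u * wd v))

lemma regIdx_nil : regIdx [] = 1 := regInt_nil 0 1

lemma zMap_one : zMap 1 = 1 := by
  rw [← regIdx_nil, ← regBasis_apply, zMap, Module.Basis.constr_basis,
    zetaSh_eq_mzv fun m k h => by simp at h]
  have h : IsConv [] := fun m k h => by simp at h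
  exact tendsto_nhds_unique (tendsto_multiSum_mzv h)
    (tendsto_const_nhds.congr fun N => (multiSum_nil_right _ _).symm)

lemma gMap_one : gMap 1 = 1 := by
  rw [← regIdx_nil, ← regBasis_apply, gMap, Module.Basis.constr_basis, gSh_eq]
  exact shChar_gChar.nil

lemma shChar_zFam (a b : Fin 2) : ShChar (zFam a b) :=
  shChar_regInt ((IsScalarTower.toAlgHom ℚ ℝ (PowerSeries ℂ)).toLinearMap ∘ₗ zMap)
    (by simp [zMap_one]) (fun x y => by simp [zMap_mul]) a b

lemma shChar_gFam : ShChar gFam := shChar_regInt gMap gMap_one gMap_mul 0 1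

lemma pathFamily_zFam : PathFamily zFam where
  same a := by
    funext w
    cases w with
    | nil => rw [zFam, regInt_nil, zMap_one, map_one]; rfl
    | cons b w => rw [zFam, regInt_same a _ (by simp), map_zero, map_zero]; rfl
  path a b c := by
    funext w
    rw [zFam, regInt_path a b c w, cut_eq_lcut, map_lcut, map_lcut]
    exact lcut_congr fun u v _ => by rw [zMap_mul, map_mul]; rfl

/-- The regularised multiple Eisenstein series of a word. -/
noncomputable def eisChar (w : Word) : PowerSeries ℂ := gapSum zFam 0 [] w gFam

lemma shChar_eisChar : ShChar eisChar := shChar_gapSum pathFamily_zFam shChar_zFam shChar_gFam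

lemma eisensteinSh_eq (n : Index) : eisensteinSh n = eisChar (indexWord n) := by
  rw [eisensteinSh, ← regBasis_apply, coproduct, Module.Basis.constr_basis]
  refine coproductFormula_eq_sum (indexWord n) zgMap
    (fun x => algebraMap ℝ (PowerSeries ℂ) (zMap x)) gMap (fun x y => ?_) fun x y => ?_
  · rw [zMap_mul, map_mul]
  · change ((zMap x : ℝ) : ℂ) • gMap y = _
    rw [Algebra.smul_def, IsScalarTower.algebraMap_apply ℝ ℂ (PowerSeries ℂ)]
    rfl

lemma zgMap_coproduct (x : RegInt) : zgMap (coproduct x) = regBasis.constr ℚ eisensteinSh x := by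
  have : zgMap ∘ₗ coproduct = regBasis.constr ℚ eisensteinSh := regBasis.ext fun n => by
    rw [LinearMap.comp_apply, Module.Basis.constr_basis, regBasis_apply]; rfl
  rw [← this]; rfl

/-- Obtained from the fact that `eisChar` is a shuffle character. Since Δ is given on the basis
only, the values of `eisChar` at other words enter solely through the proof of that fact. -/
lemma zgMap_coproduct_mul (x y : RegInt) :
    zgMap (coproduct (x * y)) = zgMap (coproduct x) * zgMap (coproduct y) := by
  simp only [zgMap_coproduct]
  exact constr_mul eisensteinSh (onWords eisChar) (fun n => by rw [onWords_wd, eisensteinSh_eq])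
    (fun n m => by rw [shChar_eisChar.mul, eisensteinSh_eq, eisensteinSh_eq]) x y

lemma indexWord_wordIndex {w : Word} (hw : ∀ v, w ≠ 0 :: v) : indexWord (wordIndex w) = w := by
  obtain ⟨n, rfl⟩ := exists_indexWord w hw
  rw [wordIndex_indexWord]

lemma eisensteinSh_mul_shuffle (n m : Index) : eisensteinSh n * eisensteinSh m =
    (shuffle (indexWord n) (indexWord m)).sum fun w c => c • eisensteinSh (wordIndex w) := by
  rw [eisensteinSh_eq, eisensteinSh_eq, ← shChar_eisChar.mul, ← onWords_shuffle,
    Finsupp.linearCombination_apply]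
  refine Finsupp.sum_congr fun w hw => ?_
  rw [eisensteinSh_eq, indexWord_wordIndex]
  -- No word of the shuffle starts with 0, because `der 0` is a derivation killing both factors; so
  -- the index can be read back from the word.
  rintro v rfl
  refine Finsupp.mem_support_iff.mp hw ?_
  rw [← wd_mul]
  change coef (0 :: v) (wd (indexWord n) * wd (indexWord m)) = 0
  rw [coef_cons, der_mul, der_indexWord, der_indexWord, zero_mul, mul_zero, add_zero, map_zero]

lemma har_regIdx (n m : Index) :
    har (regIdx n) (regIdx m) = (harmonic n m).sum fun w c => c • regIdx w := by
  rw [← regBasis_apply, ← regBasis_apply, har, Module.Basis.constr_basis,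
    Module.Basis.constr_basis]

end Eisenstein

end MES

namespace MES

/-! ### The `q`-series for indices with entries at least `2` -/

section QSeriesSums

/-- The divided power `x^j / j!`. -/
noncomputable def divPow (j : ℕ) (x : QSeries) : QSeries := ((j.factorial : ℚ)⁻¹) • x ^ j

lemma divPow_zero_right {j : ℕ} (hj : j ≠ 0) : divPow j 0 = 0 := by simp [divPow, hj]

/-- The sum over `x > y₂ > ⋯ > y_r > 0` of `f(x) f(y₂) ⋯ f(y_r)` times the divided powers of the
successive differences, with `f(u) = q^u / (1 - q^u)`. -/
noncomputable def gapSeries : Index → ℕ → QSeries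
  | [], x => if x = 0 then 1 else 0
  | k :: n, x => qFrac x *
      ∑ y ∈ Finset.range x, divPow k.natPred ((x : QSeries) - y) * gapSeries n y

lemma gapSeries_cons_zero (k : ℕ+) (n : Index) : gapSeries (k :: n) 0 = 0 := by simp [gapSeries]

lemma natPred_ne_zero {k : ℕ+} (hk : 2 ≤ k) : k.natPred ≠ 0 := by
  have h : (2 : ℕ) ≤ k := by exact_mod_cast hk
  have := k.natPred_add_one
  omega

lemma weakSum_zero_right (N : ℕ) (K : List ℕ → QSeries) : weakSum N 0 K = K [] := by
  induction N generalizing K with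
  | zero => simp [weakSum]
  | succ N ih => simp [weakSum, ih]

/-- For entries at least 2 the gap between successive points enters with a positive exponent, so
repeated points contribute zero. The weakly decreasing sum becomes strict and its factorials
disappear. -/
lemma weakSum_gapKernel (N : ℕ) (x : QSeries) (a : ℕ) {n : Index} (hn : ∀ k ∈ n, 2 ≤ k) :
    weakSum N n.length (gapKernel x a n) =
      ∑ y ∈ Finset.range (N + 1), divPow a (x - (y : QSeries)) * gapSeries n y := by
  induction n generalizing N x a with
  | nil =>
    rw [List.length_nil, weakSum_zero_right, Finset.sum_eq_single 0]
    · simp [gapKernel, gapSeries, divPow]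
    · intro y _ hy
      rw [gapSeries, if_neg hy, mul_zero]
    · simp
  | cons k n ihn =>
    have hn' : ∀ k ∈ n, 2 ≤ k := fun l hl => hn l (by simp [hl])
    have hk : k.natPred ≠ 0 := natPred_ne_zero (hn k (by simp))
    have h1 : ∀ N, weakSumFrom N 1 n.length (gapKernel ((N + 1 : ℕ) : QSeries) k.natPred n) =
        gapSeries (k :: n) (N + 1) := by
      intro N
      rw [gapSeries, ← ihn N _ _ hn']
      cases n with
      | nil => rw [List.length_nil, weakSumFrom_zero]; simp
      | cons l n =>
        rw [List.length_cons, weakSumFrom_succ]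
        have : ∀ v, gapKernel ((N + 1 : ℕ) : QSeries) k.natPred (l :: n) ((N + 1) :: v) = 0 :=
          fun v => by simp [gapKernel, hk]
        simp only [this, weakSumFrom, weakSum_zero, smul_zero, Finset.sum_const_zero, add_zero]
        simp
    induction N with
    | zero => simp [weakSum, gapSeries_cons_zero]
    | succ N ih =>
      have h2 : ∀ v, gapKernel x a (k :: n) ((N + 1) :: v) =
          divPow a (x - ((N + 1 : ℕ) : QSeries)) • gapKernel ((N + 1 : ℕ) : QSeries) k.natPred n v :=
        fun v => rfl
      rw [weakSum_succ, List.length_cons, weakSumFrom_succ, Finset.sum_range_succ, ← ih]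
      simp only [h2]
      rw [weakSumFrom_smul, h1, List.length_cons, smul_eq_mul]
      simp

/-- The `q`-series `∑_{d > 0} d^{k-1} / (k-1)! q^{l d}`, for `k ≥ 2`. -/
noncomputable def divisorSeries (k : ℕ+) (l : ℕ) : QSeries := PowerSeries.mk fun n =>
  if l ∣ n then ((k.natPred.factorial : ℚ)⁻¹) * ((n / l : ℕ) : ℚ) ^ k.natPred else 0

lemma dvd_divisorSeries_sub (k : ℕ+) {l : ℕ} (hl : 0 < l) (N : ℕ) :
    PowerSeries.X ^ (N + 1) ∣ divisorSeries k l -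
      ∑ d ∈ Finset.range (N + 1), divPow k.natPred d * PowerSeries.X ^ (l * d) := by
  rw [PowerSeries.X_pow_dvd_iff]
  intro m hm
  have h : ∀ d : ℕ, PowerSeries.coeff m (divPow k.natPred d * PowerSeries.X ^ (l * d)) =
      if m = l * d then ((k.natPred.factorial : ℚ)⁻¹) * (d : ℚ) ^ k.natPred else 0 := fun d => by
    have : divPow k.natPred (d : QSeries) =
        PowerSeries.C (((k.natPred.factorial : ℚ)⁻¹) * (d : ℚ) ^ k.natPred) := by
      rw [divPow, Algebra.smul_def]
      simp
    rw [this, PowerSeries.coeff_C_mul, PowerSeries.coeff_X_pow]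
    simp
  rw [map_sub, map_sum, divisorSeries, PowerSeries.coeff_mk, sub_eq_zero]
  simp only [h]
  split_ifs with hd
  · obtain ⟨d, rfl⟩ := hd
    rw [Finset.sum_eq_single d]
    · rw [if_pos rfl, Nat.mul_div_cancel_left _ hl]
    · intro e _ he
      rw [if_neg fun h' => he (Nat.eq_of_mul_eq_mul_left hl h').symm]
    · intro h'
      have : d < N + 1 := lt_of_le_of_lt (Nat.le_mul_of_pos_left d hl) hm
      exact absurd (Finset.mem_range.mpr this) h'
  · exact (Finset.sum_eq_zero fun d _ => if_neg fun h' => hd ⟨d, h'⟩).symm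

variable {A : Type} [CommRing A] (π : QSeries →+* A) {N : ℕ}

/-- The sum of `q^{l x} U(x)` over `x ≤ N`, for `U = gapSeries n`. -/
noncomputable def gapTotal (N l : ℕ) (n : Index) : A :=
  ∑ x ∈ Finset.range (N + 1), π PowerSeries.X ^ (l * x) * π (gapSeries n x)

lemma gapTotal_nil (l : ℕ) : gapTotal π N l [] = 1 := by
  rw [gapTotal, Finset.sum_eq_single 0]
  · simp [gapSeries]
  · intro x _ hx
    rw [gapSeries, if_neg hx, map_zero, mul_zero]
  · simp

lemma pow_eq_zero_of_lt (hπ : π PowerSeries.X ^ (N + 1) = 0) {m : ℕ} (h : N < m) :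
    π PowerSeries.X ^ m = 0 := by
  obtain ⟨j, rfl⟩ := Nat.exists_eq_add_of_lt h
  rw [show N + j + 1 = (N + 1) + j by ring, pow_add, hπ, zero_mul]

lemma one_sub_mul_qFrac {x : ℕ} (hx : 0 < x) :
    (1 - PowerSeries.X ^ x) * qFrac x = PowerSeries.X ^ x := by
  rw [qFrac, mul_left_comm, PowerSeries.mul_inv_cancel, mul_one]
  simp [hx.ne']

/-- From f(x) = q^x + q^x f(x) one gets q^{lx} f(x) = q^{(l+1)x} f(x) + q^{(l+1)x}. In the last term
x = d + y separates the sum over the first difference d, a divisor series, from the rest. The value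
d = 0 contributes nothing as k ≥ 2, and d + y > N contributes nothing since q^{N+1} maps to zero. -/
lemma gapTotal_cons (hπ : π PowerSeries.X ^ (N + 1) = 0) (l : ℕ) {k : ℕ+} (hk : 2 ≤ k)
    (n : Index) : gapTotal π N l (k :: n) =
      gapTotal π N (l + 1) (k :: n) + π (divisorSeries k (l + 1)) * gapTotal π N (l + 1) n := by
  set t := π PowerSeries.X with ht
  have hφ : π (divisorSeries k (l + 1)) =
      ∑ d ∈ Finset.range (N + 1), π (divPow k.natPred d) * t ^ ((l + 1) * d) := by
    obtain ⟨c, hc⟩ := dvd_divisorSeries_sub k (Nat.succ_pos l) N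
    have := congrArg π hc
    rw [map_sub, map_mul, map_pow, hπ, zero_mul, sub_eq_zero] at this
    simpa [map_sum] using this
  have h1 : ∀ x, t ^ (l * x) * π (gapSeries (k :: n) x) =
      t ^ ((l + 1) * x) * π (gapSeries (k :: n) x) + ∑ y ∈ Finset.range x,
        t ^ ((l + 1) * x) * (π (divPow k.natPred ((x : QSeries) - y)) * π (gapSeries n y)) := by
    intro x
    rcases Nat.eq_zero_or_pos x with rfl | hx
    · simp [gapSeries_cons_zero]
    · have := congrArg π (one_sub_mul_qFrac hx)
      rw [map_mul, map_sub, map_pow, map_one, ← ht] at this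
      rw [gapSeries, map_mul, map_sum, ← Finset.mul_sum]
      simp only [map_mul]
      rw [show (l + 1) * x = l * x + x by ring, pow_add]
      linear_combination (t ^ (l * x) * ∑ y ∈ Finset.range x,
        π (divPow k.natPred ((x : QSeries) - y)) * π (gapSeries n y)) * this
  rw [gapTotal, Finset.sum_congr rfl fun x _ => h1 x, Finset.sum_add_distrib, hφ, gapTotal, gapTotal,
    Finset.sum_mul_sum, ← Finset.sum_product', Finset.sum_sigma']
  congr 1
  refine Finset.sum_of_injOn (fun p => (p.1 - p.2, p.2)) ?_ ?_ ?_ ?_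
  · rintro ⟨x, y⟩ h ⟨x', y'⟩ h' hp
    simp only [Finset.coe_sigma, Set.mem_sigma_iff, Finset.mem_coe, Finset.mem_range] at h h'
    simp only [Prod.mk.injEq] at hp
    obtain rfl := hp.2
    obtain rfl : x = x' := by omega
    rfl
  · rintro ⟨x, y⟩ h
    simp only [Finset.coe_sigma, Set.mem_sigma_iff, Finset.mem_coe, Finset.mem_range,
      Finset.mem_product] at h ⊢
    omega
  · rintro ⟨d, y⟩ _ h
    simp only [Set.mem_image, Finset.mem_coe, Finset.mem_sigma, Finset.mem_range, Sigma.exists,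
      Prod.mk.injEq, not_exists, not_and] at h
    rcases Nat.eq_zero_or_pos d with rfl | hd
    · rw [Nat.cast_zero, divPow_zero_right (natPred_ne_zero hk)]; simp
    · have hN : N < d + y := by
        by_contra h'
        exact h (d + y) y (by omega) (by omega) rfl
      have : t ^ ((l + 1) * d) * t ^ ((l + 1) * y) = 0 := by
        rw [← pow_add, ← mul_add]
        exact pow_eq_zero_of_lt π hπ (lt_of_lt_of_le hN (Nat.le_mul_of_pos_left _ (Nat.succ_pos l)))
      simp only
      linear_combination (π (divPow k.natPred d) * π (gapSeries n y)) * this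
  · rintro ⟨x, y⟩ h
    simp only [Finset.mem_sigma, Finset.mem_range] at h
    simp only
    rw [Nat.cast_sub h.2.le]
    have : t ^ ((l + 1) * x) = t ^ ((l + 1) * (x - y)) * t ^ ((l + 1) * y) := by
      rw [← pow_add, ← mul_add, Nat.sub_add_cancel h.2.le]
    rw [this]
    ring

/-- Both sides satisfy the same recursion in `l`. It starts at `l = N`, where each term with x ≥ 1
contains q^{Nx} f(x), a multiple of q^{(N+1)x}, which maps to zero. -/
lemma multiSum_divisorSeries (hπ : π PowerSeries.X ^ (N + 1) = 0) {n : Index}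
    (hn : ∀ k ∈ n, 2 ≤ k) (l j : ℕ) (hl : l + j = N) :
    multiSum (fun k l => π (divisorSeries k l)) (List.range' (l + 1) j) n = gapTotal π N l n := by
  induction j generalizing l n with
  | zero =>
    cases n with
    | nil => rw [gapTotal_nil, multiSum_nil_right]
    | cons k n =>
      rw [List.range'_zero, multiSum_nil_cons, gapTotal]
      refine (Finset.sum_eq_zero fun x _ => ?_).symm
      rcases Nat.eq_zero_or_pos x with rfl | hx
      · simp [gapSeries_cons_zero]
      · rw [gapSeries, qFrac, map_mul, map_mul, map_pow, mul_assoc, ← mul_assoc, ← pow_add,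
          pow_eq_zero_of_lt π hπ, zero_mul]
        nlinarith
  | succ j ih =>
    cases n with
    | nil => rw [gapTotal_nil, multiSum_nil_right]
    | cons k n =>
      have hn' : ∀ k ∈ n, 2 ≤ k := fun l hl => hn l (by simp [hl])
      rw [List.range'_succ, multiSum_cons_cons, ih hn (l + 1) (by omega), ih hn' (l + 1) (by omega),
        gapTotal_cons π hπ l (hn k (by simp))]

lemma map_qCharLim (hπ : π PowerSeries.X ^ (N + 1) = 0) {n : Index} (hn : ∀ k ∈ n, 2 ≤ k) :
    π (qCharLim (indexWord n)) =
      multiSum (fun k l => π (divisorSeries k l)) (List.range' 1 N) n := by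
  have hd : PowerSeries.X ^ (N + 1) ∣ qCharLim (indexWord n) - qChar N (indexWord n) := by
    rw [PowerSeries.X_pow_dvd_iff]
    intro m hm
    rw [map_sub, coeff_qCharLim (Nat.lt_succ_iff.mp hm), sub_self]
  obtain ⟨c, hc⟩ := hd
  have h := congrArg π hc
  rw [map_sub, map_mul, map_pow, hπ, zero_mul, sub_eq_zero] at h
  have h2 := qChar_eq_weakSum N 0 n
  rw [List.replicate_zero, List.nil_append, weakSum_gapKernel N 0 0 hn] at h2
  have h3 := multiSum_divisorSeries π hπ hn 0 N (zero_add N)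
  rw [zero_add] at h3
  rw [h, h2, h3, gapTotal, map_sum]
  refine Finset.sum_congr rfl fun x _ => ?_
  simp [divPow]

end QSeriesSums

end MES

namespace MES

/-! ### The block decomposition of the coproduct formula -/

section Blocks

variable {R : Type} [CommRing R]

lemma map_conv {α S : Type} [CommRing S] (π : R →+* S) (f g : List α → R) (w : List α) :
    π (conv f g w) = conv (fun v => π (f v)) (fun v => π (g v)) w := by
  rw [conv, map_lcut, conv]
  exact lcut_congr fun u v _ => map_mul π _ _

lemma map_unitFn {α S : Type} [CommRing S] (π : R →+* S) (w : List α) :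
    π (unitFn w) = unitFn w := by
  cases w <;> simp [unitFn]

lemma map_gapSum {S : Type} [CommRing S] (π : R →+* S) (z : Fin 2 → Fin 2 → Word → R) (a : Fin 2)
    (p w : Word) (h : Word → R) :
    π (gapSum z a p w h) = gapSum (fun a b u => π (z a b u)) a p w fun v => π (h v) := by
  induction w generalizing a p h with
  | nil => rw [gapSum, gapSum, map_mul]
  | cons c w ih => rw [gapSum, gapSum, map_add, map_mul, ih, ih]

lemma PathFamily.map {S : Type} [CommRing S] {z : Fin 2 → Fin 2 → Word → R} (hz : PathFamily z)
    (π : R →+* S) : PathFamily fun a b u => π (z a b u) where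
  same a := funext fun w => by rw [hz.same, map_unitFn]
  path a b c := funext fun w => by rw [← map_conv, hz.path]

/-- The convolution by `k` letters `0`. -/
def zeroShift (g : Word → R) : ℕ → Word → R
  | 0 => g
  | j + 1 => conv (letterFn 0) (zeroShift g j)

lemma letterFn_zero_conv_eq_zero (g : Word → R) {w : Word} (hw : ∀ v, w ≠ 0 :: v) :
    conv (letterFn 0) g w = 0 := by
  cases w with
  | nil => rw [letterFn_conv_nil]
  | cons a w => rw [letterFn_conv_cons, if_neg]; rintro rfl; exact hw w rfl

lemma zeroShift_eq_zero (g : Word → R) {j : ℕ} {w : Word} (h : w.length < j) :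
    zeroShift g j w = 0 := by
  induction j generalizing w with
  | zero => simp at h
  | succ j ih =>
    rw [zeroShift]
    cases w with
    | nil => rw [letterFn_conv_nil]
    | cons a w => rw [letterFn_conv_cons, ih (by simpa using h), ite_self]

lemma zeroShift_succ' (g : Word → R) (j : ℕ) :
    zeroShift g (j + 1) = zeroShift (conv (letterFn 0) g) j := by
  induction j with
  | zero => rfl
  | succ j ih => rw [zeroShift, ih, zeroShift]

lemma zeroShift_conv (f g : Word → R) (j : ℕ) : zeroShift (conv f g) j = conv (zeroShift f j) g := by
  induction j with
  | zero => rfl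
  | succ j ih => rw [zeroShift, ih, zeroShift, conv_assoc]

lemma zeroShift_add (f g : Word → R) (j : ℕ) :
    zeroShift (f + g) j = zeroShift f j + zeroShift g j := by
  induction j with
  | zero => rfl
  | succ j ih => rw [zeroShift, ih, zeroShift, zeroShift, conv_add_right]

lemma zeroShift_smul (c : R) (f : Word → R) (j : ℕ) : zeroShift (c • f) j = c • zeroShift f j := by
  induction j with
  | zero => rfl
  | succ j ih => rw [zeroShift, ih, zeroShift, conv_smul_right]

/-- The function `z₁₀ * [0]^j * z₀₁`. -/
def tauFn (z : Fin 2 → Fin 2 → Word → R) (j : ℕ) : Word → R := conv (z 1 0) (zeroShift (z 0 1) j)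

lemma tauFn_zero {z : Fin 2 → Fin 2 → Word → R} (hz : PathFamily z) : tauFn z 0 = unitFn := by
  rw [tauFn, zeroShift, hz.path, hz.same]

lemma conv_zeroShift_eq_zero (f g : Word → R) {j : ℕ} {w : Word} (h : w.length < j) :
    conv f (zeroShift g j) w = 0 := by
  refine lcut_eq_zero fun u v huv => ?_
  rw [zeroShift_eq_zero, mul_zero]
  subst huv
  simp at h
  omega

lemma tauFn_eq_zero (z : Fin 2 → Fin 2 → Word → R) {j : ℕ} {w : Word} (h : w.length < j) :
    tauFn z j w = 0 := conv_zeroShift_eq_zero _ _ h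

/-- The sum over all subwords, as a function of the word. -/
def subwordSum (z : Fin 2 → Fin 2 → Word → R) (h : Word → R) (w : Word) : R := gapSum z 0 [] w h

lemma subwordSum_eq_sum (z : Fin 2 → Fin 2 → Word → R) (h : Word → R) {n : ℕ} {w : Word}
    (hw : w.length ≤ n) : subwordSum z h w = (∑ v ∈ wordsLE n, h v • chain z 0 v) w := by
  rw [subwordSum, gapSum_eq z 0 [] w h n hw, Finset.sum_apply]
  simp only [chainFrom_nil, Pi.smul_apply, smul_eq_mul]

/-- Sort by the first selected letter: none, 0 or 1. A selected 0 must be the first letter of the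
word, as z 0 0 is the unit. After a selected 1 the path restarts from 1, and z 1 0 brings it back to
the base point. -/
lemma subwordSum_eq {z : Fin 2 → Fin 2 → Word → R} (hz : PathFamily z) (h : Word → R) :
    subwordSum z h = h [] • z 0 1 + conv (letterFn 0) (subwordSum z fun v => h (0 :: v)) +
      conv (z 0 1) (conv (letterFn 1) (conv (z 1 0) (subwordSum z fun v => h (1 :: v)))) := by
  funext w
  have hch : ∀ v, chain z 1 v = conv (z 1 0) (chain z 0 v) := fun v => by
    rw [chain_eq hz, chain_eq hz 0, hz.same, unitFn_conv]
  have e : ∀ (f g : Word → R) (w' : Word), w'.length ≤ w.length →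
      (∀ v : Word, v.length ≤ w.length → f v = g v) → ∀ k, conv k f w' = conv k g w' :=
    fun f g w' hw' hfg k => conv_congr fun u v huv => ⟨rfl, hfg v (by subst huv; simp at hw'; omega)⟩
  have hK : ∀ (h : Word → R) (v : Word), v.length ≤ w.length →
      subwordSum z h v = (∑ v ∈ wordsLE w.length, h v • chain z 0 v) v := fun h v hv =>
    subwordSum_eq_sum z h hv
  rw [subwordSum_eq_sum z h (Nat.le_succ w.length), Finset.sum_apply, sum_wordsLE_succ, Pi.add_apply,
    Pi.add_apply, add_assoc]
  congr 1
  rw [Fin.sum_univ_two]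
  congr 1
  · rw [e _ _ w le_rfl (hK _), conv_sum_right, Finset.sum_apply]
    refine Finset.sum_congr rfl fun v _ => ?_
    rw [conv_smul_right, chain, hz.same, unitFn_conv]
  · rw [e _ _ w le_rfl fun v hv => e _ _ v hv (fun v' hv' => e _ _ v' hv' (hK _) _) _,
      conv_sum_right, conv_sum_right, conv_sum_right, Finset.sum_apply]
    refine Finset.sum_congr rfl fun v _ => ?_
    rw [conv_smul_right, conv_smul_right, conv_smul_right, chain, hch]

/-- The sum over all subwords, after a letter `1`. -/
def subwordSumOne (z : Fin 2 → Fin 2 → Word → R) (h : Word → R) : Word → R :=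
  conv (z 1 0) (subwordSum z h)

/-- After a selected 1 comes a run of j selected zeros, then the end or another selected 1. Because
z 0 0 is the unit, these zeros are adjacent in the word, and the run contributes z 1 0 * [0]^j * z 0
1. The remainder with J zeros vanishes for lack of letters. -/
lemma subwordSumOne_eq {z : Fin 2 → Fin 2 → Word → R} (hz : PathFamily z) (h : Word → R) {w : Word}
    {J : ℕ} (hJ : w.length < J) : subwordSumOne z h w = ∑ j ∈ Finset.range J,
      (h (List.replicate j 0) * tauFn z j w + conv (tauFn z j) (conv (letterFn 1)
        (subwordSumOne z fun v => h (List.replicate j 0 ++ 1 :: v))) w) := by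
  have key : ∀ J, subwordSumOne z h w = ∑ j ∈ Finset.range J,
      (h (List.replicate j 0) * tauFn z j w + conv (tauFn z j) (conv (letterFn 1)
        (subwordSumOne z fun v => h (List.replicate j 0 ++ 1 :: v))) w) +
      conv (z 1 0) (zeroShift (subwordSum z fun v => h (List.replicate J 0 ++ v)) J) w := by
    intro J
    induction J with
    | zero => simp [subwordSumOne, zeroShift]
    | succ J ih =>
      rw [ih, Finset.sum_range_succ, add_assoc]
      congr 1
      conv_lhs => rw [subwordSum_eq hz]
      have e : ∀ v : Word, List.replicate (J + 1) (0 : Fin 2) ++ v = List.replicate J 0 ++ 0 :: v :=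
        fun v => by rw [List.replicate_succ', List.append_assoc]; rfl
      rw [zeroShift_add, zeroShift_add, zeroShift_smul, ← zeroShift_succ', zeroShift_conv,
        conv_add_right, conv_add_right, conv_smul_right, ← conv_assoc (z 1 0)]
      simp only [e, Pi.add_apply, Pi.smul_apply, smul_eq_mul, List.append_nil, tauFn,
        subwordSumOne]
      ring
  rw [key J, conv_zeroShift_eq_zero _ _ hJ, add_zero]

/-! ### From words to indices -/

/-- The values of a function on words at the words `0^{b-1} 1 ⋯`, as a function on indices. -/
def tailFn (G : Word → R) : Index → R
  | [] => 0
  | b :: n => G (List.replicate b.natPred 0 ++ indexWord n)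

/-- Cutting a word at one of its letters 1 is the same as cutting the index before the corresponding
entry; so convolution on words becomes convolution on indices. -/
lemma conv_conv_letterFn_one (f G : Word → R) (a : ℕ) (n : Index) :
    conv f (conv (letterFn 1) G) (List.replicate a 0 ++ indexWord n) =
      conv (fun m => f (List.replicate a 0 ++ indexWord m)) (tailFn G) n := by
  induction n generalizing f a with
  | nil =>
    induction a generalizing f with
    | zero =>
      rw [List.replicate_zero, List.nil_append, indexWord, conv_nil, letterFn_conv_nil, conv_nil]
      rfl
    | succ a ih =>
      rw [List.replicate_succ, List.cons_append, conv_cons, ih, letterFn_conv_cons,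
        if_neg (by decide), mul_zero, zero_add]
      rfl
  | cons b n ihn =>
    induction a generalizing f with
    | zero =>
      rw [List.replicate_zero, List.nil_append, indexWord, conv_cons, ihn, letterFn_conv_cons,
        if_pos rfl, conv_cons]
      rfl
    | succ a ih =>
      rw [List.replicate_succ, List.cons_append, conv_cons, ih, letterFn_conv_cons,
        if_neg (by decide), mul_zero, zero_add]
      rfl

/-- The part of the sum over all subwords starting with the first letter. -/
def blockValue (z : Fin 2 → Fin 2 → Word → R) (h : Word → R) : Index → R :=
  h [] • unitFn + tailFn (subwordSumOne z fun v => h (1 :: v))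

lemma subwordSum_indexWord {z : Fin 2 → Fin 2 → Word → R} (hz : PathFamily z) (h : Word → R)
    (n : Index) :
    subwordSum z h (indexWord n) = conv (fun m => z 0 1 (indexWord m)) (blockValue z h) n := by
  have h1 := conv_conv_letterFn_one (z 0 1) (subwordSumOne z fun v => h (1 :: v)) 0 n
  rw [List.replicate_zero, List.nil_append] at h1
  rw [subwordSum_eq hz, blockValue, conv_add_right, conv_smul_right, conv_unitFn]
  simp only [Pi.add_apply, Pi.smul_apply]
  rw [letterFn_zero_conv_eq_zero _ (indexWord_ne_zero_cons n), add_zero]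
  congr 1

lemma blockValue_nil (z : Fin 2 → Fin 2 → Word → R) (h : Word → R) : blockValue z h [] = h [] := by
  simp [blockValue, unitFn, tailFn]

/-- The coefficients of the blocks. -/
def blockCoeff (z : Fin 2 → Fin 2 → Word → R) (j : ℕ) : Index → R := tailFn (tauFn z j)

lemma blockCoeff_eq_zero (z : Fin 2 → Fin 2 → Word → R) {j : ℕ} {n : Index}
    (h : (indexWord n).length ≤ j) : blockCoeff z j n = 0 := by
  cases n with
  | nil => rfl
  | cons b n => exact tauFn_eq_zero z (Nat.lt_of_succ_le (by simpa [indexWord] using h))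

/-- For j = 0 the block reduces to z 1 0 * z 0 1, the unit, evaluated at a word starting with 0. In
terms of multitangent functions: no term with a simple pole sum ∑ (τ+m)^{-1} survives. This is a
principal use of entries at least 2. -/
lemma blockCoeff_zero {z : Fin 2 → Fin 2 → Word → R} (hz : PathFamily z) {n : Index}
    (hn : ∀ k ∈ n, 2 ≤ k) : blockCoeff z 0 n = 0 := by
  cases n with
  | nil => rfl
  | cons b n =>
    rw [blockCoeff, tailFn, tauFn_zero hz]
    obtain ⟨j, hj⟩ := Nat.exists_eq_succ_of_ne_zero (natPred_ne_zero (hn b (by simp)))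
    rw [hj, List.replicate_succ]
    rfl

lemma blockValue_cons {z : Fin 2 → Fin 2 → Word → R} (hz : PathFamily z) (h : Word → R) (b : ℕ+)
    (n : Index) {J : ℕ} (hJ : (indexWord (b :: n)).length ≤ J) :
    blockValue z h (b :: n) = ∑ j ∈ Finset.range J, conv (fun m => blockCoeff z j (b :: m))
      (blockValue z fun v => h (1 :: (List.replicate j 0 ++ v))) n := by
  have h1 : blockValue z h (b :: n) = subwordSumOne z (fun v => h (1 :: v))
      (List.replicate b.natPred 0 ++ indexWord n) := by simp [blockValue, unitFn, tailFn]
  rw [h1, subwordSumOne_eq hz _ (Nat.lt_of_succ_le (n := _) (m := J) (by simpa [indexWord] using hJ))]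
  refine Finset.sum_congr rfl fun j _ => ?_
  rw [conv_conv_letterFn_one, blockValue, conv_add_right, conv_smul_right, conv_unitFn]
  simp [blockCoeff, tailFn]

lemma indexWord_succPNat (j : ℕ) (k : Index) :
    indexWord (j.succPNat :: k) = 1 :: (List.replicate j 0 ++ indexWord k) := by
  rw [indexWord, Nat.natPred_succPNat]

lemma two_le_succPNat {j : ℕ} (hj : j ≠ 0) : 2 ≤ j.succPNat := by
  rw [← PNat.coe_le_coe, Nat.succPNat_coe]
  change 2 ≤ j + 1
  omega

/-- Linearity of the block values; only indices with entries at least `2` matter. -/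
lemma blockValue_linear {z : Fin 2 → Fin 2 → Word → R} (hz : PathFamily z) {h h₁ h₂ : Word → R}
    {c : R} (hh : ∀ k : Index, (∀ l ∈ k, 2 ≤ l) →
      h (indexWord k) = h₁ (indexWord k) + c * h₂ (indexWord k))
    {n : Index} (hn : ∀ l ∈ n, 2 ≤ l) :
    blockValue z h n = blockValue z h₁ n + c * blockValue z h₂ n := by
  induction hlen : n.length using Nat.strong_induction_on generalizing n h h₁ h₂ with
  | _ N ih =>
    cases n with
    | nil =>
      rw [blockValue_nil, blockValue_nil, blockValue_nil]
      exact hh [] (by simp)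
    | cons b n =>
      rw [blockValue_cons hz h b n le_rfl, blockValue_cons hz h₁ b n le_rfl,
        blockValue_cons hz h₂ b n le_rfl, Finset.mul_sum, ← Finset.sum_add_distrib]
      refine Finset.sum_congr rfl fun j _ => ?_
      rw [conv, conv, conv, ← lcut_mul_left, ← lcut_add]
      refine lcut_congr fun u v huv => ?_
      have hu : ∀ l ∈ b :: u, 2 ≤ l := fun l hl => hn l (by subst huv; simp at hl ⊢; tauto)
      have hv : ∀ l ∈ v, 2 ≤ l := fun l hl => hn l (by subst huv; simp [hl])
      -- The term j = 0 drops out, so the recursion evaluates `h` only at indices whose new entry j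
      -- + 1 is at least 2.
      rcases Nat.eq_zero_or_pos j with rfl | hj
      · rw [blockCoeff_zero hz hu]; simp
      · rw [ih v.length (by subst huv; simp at hlen; omega) (h := fun v => h (1 :: (List.replicate j 0 ++ v)))
          (h₁ := fun v => h₁ (1 :: (List.replicate j 0 ++ v)))
          (h₂ := fun v => h₂ (1 :: (List.replicate j 0 ++ v))) ?_ hv rfl]
        · ring
        · intro k hk
          simp only [← indexWord_succPNat]
          refine hh _ fun l hl => ?_
          rcases List.mem_cons.mp hl with rfl | hl
          · exact two_le_succPNat hj.ne'
          · exact hk l hl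

/-- The generating function of the block coefficients. -/
def blockGen {X : Type} (z : Fin 2 → Fin 2 → Word → R) (φ : ℕ+ → X → R) (x : X) : Index → R
  | [] => 1
  | b :: n => ∑ j ∈ Finset.range (indexWord (b :: n)).length,
      blockCoeff z j (b :: n) * φ j.succPNat x

lemma blockGen_cons {X : Type} (z : Fin 2 → Fin 2 → Word → R) (φ : ℕ+ → X → R) (x : X) (b : ℕ+)
    (n : Index) {J : ℕ} (hJ : (indexWord (b :: n)).length ≤ J) : blockGen z φ x (b :: n) =
      ∑ j ∈ Finset.range J, blockCoeff z j (b :: n) * φ j.succPNat x := by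
  refine Finset.sum_subset (Finset.range_mono hJ) fun j _ hj => ?_
  rw [blockCoeff_eq_zero z (by simpa using hj), zero_mul]

/-- If the values at the selected words are multiple sums over the list `L`, the whole sum factors
into one block function per point of `L`, in order. -/
lemma blockValue_multiSum {X : Type} {z : Fin 2 → Fin 2 → Word → R} (hz : PathFamily z)
    (φ : ℕ+ → X → R) (L : List X) {h : Word → R}
    (hh : ∀ k : Index, (∀ l ∈ k, 2 ≤ l) → h (indexWord k) = multiSum φ L k)
    {n : Index} (hn : ∀ l ∈ n, 2 ≤ l) :
    blockValue z h n = L.foldr (fun x f => conv (blockGen z φ x) f) unitFn n := by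
  have hzero : ∀ (h : Word → R), (∀ k : Index, (∀ l ∈ k, 2 ≤ l) → h (indexWord k) = 0) →
      ∀ n : Index, (∀ l ∈ n, 2 ≤ l) → blockValue z h n = 0 := by
    intro h hh n hn
    have h0 : blockValue z (0 : Word → R) n = 0 := by
      have := blockValue_linear hz (h := 0) (h₁ := 0) (h₂ := 0) (c := 1) (fun k _ => by simp) hn
      simpa using this
    rw [blockValue_linear hz (h := h) (h₁ := 0) (h₂ := 0) (c := 1)
      (fun k hk => by simpa using hh k hk) hn, h0]
    simp
  have hsplit : ∀ {b : ℕ+} {n u v : Index}, (∀ l ∈ b :: n, 2 ≤ l) → u ++ v = n →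
      (∀ l ∈ b :: u, 2 ≤ l) ∧ ∀ l ∈ v, 2 ≤ l := fun hn huv => by
    subst huv
    exact ⟨fun l hl => hn l (by simp at hl ⊢; tauto), fun l hl => hn l (by simp [hl])⟩
  induction L generalizing h n with
  | nil =>
    cases n with
    | nil =>
      rw [blockValue_nil]
      exact hh [] (by simp)
    | cons b n =>
      rw [blockValue_cons hz h b n le_rfl]
      refine Finset.sum_eq_zero fun j _ => lcut_eq_zero fun u v huv => ?_
      obtain ⟨hu, hv⟩ := hsplit hn huv
      simp only
      rcases Nat.eq_zero_or_pos j with rfl | hj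
      · rw [blockCoeff_zero hz hu, zero_mul]
      · rw [hzero _ ?_ v hv, mul_zero]
        intro k hk
        rw [← indexWord_succPNat, hh, multiSum_nil_cons]
        intro l hl
        rcases List.mem_cons.mp hl with rfl | hl
        · exact two_le_succPNat hj.ne'
        · exact hk l hl
  | cons x L ih =>
    cases n with
    | nil =>
      rw [blockValue_nil]
      have h1 := hh [] (by simp)
      have h2 : ∀ L : List X, L.foldr (fun x f => conv (blockGen z φ x) f) unitFn [] = 1 := by
        intro L
        induction L with
        | nil => rfl
        | cons x L ih => rw [List.foldr_cons, conv_nil, ih, blockGen, one_mul]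
      rw [h2, ← multiSum_nil_right φ (x :: L)]
      exact h1
    | cons b n =>
      set h₀ : Word → R := fun w => multiSum φ L (wordIndex w) with hh₀
      have hh₀' : ∀ k : Index, (∀ l ∈ k, 2 ≤ l) → h₀ (indexWord k) = multiSum φ L k :=
        fun k _ => by rw [hh₀]; simp only [wordIndex_indexWord]
      set J := (indexWord (b :: n)).length with hJ
      -- The recursion of `multiSum` on its first point says that either `x` is unused, or the first
      -- run 1 0^j sits at `x` with weight φ_{j+1}(x) and the rest uses `L`. By linearity this peels
      -- off the block at `x`.
      have hstep : blockValue z h (b :: n) = blockValue z h₀ (b :: n) +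
          conv (fun m => blockGen z φ x (b :: m)) (blockValue z h₀) n := by
        have e1 : conv (fun m => blockGen z φ x (b :: m)) (blockValue z h₀) n =
            ∑ j ∈ Finset.range J, conv (fun m => blockCoeff z j (b :: m) * φ j.succPNat x)
              (blockValue z h₀) n := by
          rw [← Finset.sum_apply, ← conv_sum_left]
          refine conv_congr fun u v huv => ⟨?_, rfl⟩
          rw [blockGen_cons (J := J) z φ x b u (by subst huv; simp [hJ, indexWord, indexWord_append]),
            Finset.sum_apply]
        rw [e1, blockValue_cons hz h b n le_rfl, blockValue_cons hz h₀ b n le_rfl, ← hJ,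
          ← Finset.sum_add_distrib]
        refine Finset.sum_congr rfl fun j _ => ?_
        rw [conv, conv, conv, ← lcut_add]
        refine lcut_congr fun u v huv => ?_
        obtain ⟨hu, hv⟩ := hsplit hn huv
        rcases Nat.eq_zero_or_pos j with rfl | hj
        · rw [blockCoeff_zero hz hu]; simp
        · rw [blockValue_linear hz (h := fun v => h (1 :: (List.replicate j 0 ++ v)))
            (h₁ := fun v => h₀ (1 :: (List.replicate j 0 ++ v))) (h₂ := h₀) (c := φ j.succPNat x)
            ?_ hv]
          · ring
          · intro k hk
            have hk' : ∀ l ∈ j.succPNat :: k, 2 ≤ l := fun l hl => by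
              rcases List.mem_cons.mp hl with rfl | hl
              · exact two_le_succPNat hj.ne'
              · exact hk l hl
            simp only [← indexWord_succPNat]
            rw [hh _ hk', hh₀' _ hk', hh₀' _ hk, multiSum_cons_cons]
      rw [hstep, List.foldr_cons, conv_cons, blockGen, one_mul, ih hh₀' hn]
      congr 1
      exact conv_congr fun u v huv => ⟨rfl, ih hh₀' (hsplit hn huv).2⟩

end Blocks

end MES

namespace MES

/-! ### Expansions of the truncated Hurwitz-type sums -/

section Hurwitz

open PowerSeries

/-- The power series `(d + x)⁻¹`, for `d ≠ 0`. -/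
noncomputable def invSeries (d : ℂ) : ℂ⟦X⟧ := (C d + X)⁻¹

lemma add_X_mul_invSeries {d : ℂ} (hd : d ≠ 0) : (C d + X) * invSeries d = 1 :=
  PowerSeries.mul_inv_cancel _ (by simpa using hd)

lemma derivative_invSeries {d : ℂ} (hd : d ≠ 0) :
    derivative ℂ (invSeries d) = -invSeries d ^ 2 := by
  have h := congrArg (derivative ℂ) (add_X_mul_invSeries hd)
  rw [Derivation.leibniz, map_add, derivative_C, derivative_X, zero_add, smul_eq_mul, smul_eq_mul,
    mul_one, show (1 : ℂ⟦X⟧) = C 1 from rfl, derivative_C] at h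
  have h1 := add_X_mul_invSeries hd
  linear_combination invSeries d * h - derivative ℂ (invSeries d) * h1

/-- The summand `(m + x)^{-k}` as a power series. -/
noncomputable def hurwitzFn (k : ℕ+) (m : ℕ) : ℂ⟦X⟧ := invSeries m ^ (k : ℕ)

/-- The operator `f ↦ ∑ nᵢ f(n₁, …, nᵢ + 1, …, n_r)`. -/
noncomputable def raise {M : Type} [AddCommMonoid M] (f : Index → M) : Index → M
  | [] => 0
  | k :: n => (k : ℕ) • f ((k + 1) :: n) + raise (fun m => f (k :: m)) n

lemma raise_add {M : Type} [AddCommMonoid M] (f g : Index → M) (n : Index) :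
    raise (fun m => f m + g m) n = raise f n + raise g n := by
  induction n generalizing f g with
  | nil => simp [raise]
  | cons k n ih => simp only [raise, ih, smul_add]; abel

lemma map_raise {M N : Type} [AddCommMonoid M] [AddCommMonoid N] (l : M →+ N) (f : Index → M)
    (n : Index) : l (raise f n) = raise (fun m => l (f m)) n := by
  induction n generalizing f with
  | nil => simp [raise]
  | cons k n ih => simp only [raise, map_add, map_nsmul, ih]

lemma raise_mul {R : Type} [CommRing R] (c : R) (f : Index → R) (n : Index) :
    raise (fun m => c * f m) n = c * raise f n :=
  (map_raise (AddMonoidHom.mulLeft c) f n).symm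

lemma derivative_hurwitzFn (k : ℕ+) {m : ℕ} (hm : m ≠ 0) :
    derivative ℂ (hurwitzFn k m) = -((k : ℕ) • hurwitzFn (k + 1) m) := by
  rw [hurwitzFn, Derivation.leibniz_pow, derivative_invSeries (by exact_mod_cast hm), hurwitzFn,
    PNat.add_coe, PNat.one_coe, ← k.natPred_add_one]
  simp only [smul_eq_mul, nsmul_eq_mul, Nat.add_sub_cancel]
  ring

/-- Leibniz rule: differentiating (m + x)^{-k} raises its exponent and brings down -k. -/
lemma derivative_multiSum (L : List ℕ) (hL : ∀ m ∈ L, m ≠ 0) (n : Index) :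
    derivative ℂ (multiSum hurwitzFn L n) = -raise (multiSum hurwitzFn L) n := by
  have h1 : derivative ℂ (1 : ℂ⟦X⟧) = 0 := derivative_C
  induction L generalizing n with
  | nil =>
    cases n with
    | nil => simp [h1, raise]
    | cons k n =>
      have : ∀ n : Index, raise (fun m : Index => multiSum hurwitzFn [] (k :: m)) n = 0 := fun n => by
        simp only [multiSum_nil_cons]
        exact (map_raise (0 : ℂ⟦X⟧ →+ ℂ⟦X⟧) (fun _ => 0) n).symm
      rw [multiSum_nil_cons, map_zero, raise, this, multiSum_nil_cons]; simp
  | cons x L ih =>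
    have hx : x ≠ 0 := hL x (by simp)
    have hL' : ∀ m ∈ L, m ≠ 0 := fun m hm => hL m (by simp [hm])
    cases n with
    | nil => rw [multiSum_nil_right, h1, raise, neg_zero]
    | cons k n =>
      rw [multiSum_cons_cons, map_add, ih hL', Derivation.leibniz, ih hL', raise, raise,
        derivative_hurwitzFn k hx]
      simp only [multiSum_cons_cons, raise_add, raise_mul, smul_eq_mul, nsmul_eq_mul]
      ring

/-! ### Shuffling with the letter 0 -/

lemma zero_mul_replicate_indexWord {n : Index}
    (h : wd [0] * wd (indexWord n) = wd (0 :: indexWord n) + raise (fun m => wd (indexWord m)) n)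
    (j : ℕ) : wd [0] * wd (List.replicate j 0 ++ indexWord n) =
      (j + 1) • wd (List.replicate (j + 1) 0 ++ indexWord n) +
        raise (fun m => wd (List.replicate j 0 ++ indexWord m)) n := by
  induction j with
  | zero => simpa using h
  | succ j ih =>
    have e : ∀ w : Word, wd [0] * wd (0 :: w) = wd (0 :: 0 :: w) + pre 0 (wd [0] * wd w) := fun w => by
      rw [wd_cons 0 [], wd_cons 0 w, pre_mul, ← wd_cons, ← wd_cons, wd_nil, one_mul, ← wd_cons]
    rw [List.replicate_succ, List.cons_append, e, ih, map_add, map_nsmul, ← wd_cons]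
    rw [show pre 0 (raise (fun m => wd (List.replicate j 0 ++ indexWord m)) n) = _ from
      map_raise (pre 0).toAddMonoidHom _ n]
    simp only [List.replicate_succ, List.cons_append, LinearMap.toAddMonoidHom_coe, ← wd_cons]
    rw [succ_nsmul' _ (j + 1)]
    abel

/-- The letter 0 is inserted either in front, or after one of the letters of a block 1 0^{k-1}; the
k positions in that block all lengthen it by one zero. -/
lemma zero_mul_indexWord (n : Index) :
    wd [0] * wd (indexWord n) = wd (0 :: indexWord n) + raise (fun m => wd (indexWord m)) n := by
  induction n with
  | nil => rw [indexWord, wd_nil, mul_one, raise, add_zero]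
  | cons k n ih =>
    have e : ∀ w : Word, wd [0] * wd (1 :: w) = wd (0 :: 1 :: w) + pre 1 (wd [0] * wd w) := fun w => by
      rw [wd_cons 0 [], wd_cons 1 w, pre_mul, ← wd_cons, ← wd_cons, wd_nil, one_mul, ← wd_cons]
    rw [indexWord, e, zero_mul_replicate_indexWord ih, map_add, map_nsmul, ← wd_cons, raise,
      k.natPred_add_one]
    rw [show pre 1 (raise (fun m => wd (List.replicate k.natPred 0 ++ indexWord m)) n) = _ from
      map_raise (pre 1).toAddMonoidHom _ n]
    have hk : (k + 1).natPred = k.natPred + 1 := by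
      have h1 := (k + 1).natPred_add_one
      have h2 := k.natPred_add_one
      rw [PNat.add_coe, PNat.one_coe] at h1
      omega
    have h1 : indexWord ((k + 1) :: n) =
        1 :: (List.replicate (k.natPred + 1) 0 ++ indexWord n) := by rw [indexWord, hk]
    have h2 : ∀ m : Index, wd (indexWord (k :: m)) =
        pre 1 (wd (List.replicate k.natPred 0 ++ indexWord m)) := fun m => by
      rw [indexWord, wd_cons]
    rw [h1, k.natPred_add_one]
    simp only [h2, LinearMap.toAddMonoidHom_coe]

/-- The value of `ζ^sh` at a word. -/
noncomputable def zetaWord (w : Word) : ℂ := (zMap (regInt 0 w 1) : ℝ)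

lemma isConv_of_two_le {n : Index} (hn : ∀ k ∈ n, 2 ≤ k) : IsConv n := by
  rintro m k rfl
  exact hn k (by simp)

lemma zetaWord_indexWord {n : Index} (hn : ∀ k ∈ n, 2 ≤ k) : zetaWord (indexWord n) = mzv n := by
  rw [zetaWord]
  change ((zMap (regIdx n) : ℝ) : ℂ) = _
  rw [← regBasis_apply, zMap, Module.Basis.constr_basis, zetaSh_eq_mzv (isConv_of_two_le hn)]

/-- Apply ζ^sh to the shuffle with 0, which vanishes because I(0;0;1) = 0. The outcome is the
recursion that the Taylor coefficients of Hurwitz sums satisfy. -/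
lemma zetaWord_replicate_succ (j : ℕ) (n : Index) :
    ((j : ℂ) + 1) * zetaWord (List.replicate (j + 1) 0 ++ indexWord n) =
      -raise (fun m => zetaWord (List.replicate j 0 ++ indexWord m)) n := by
  set l : Sh →+ ℂ := Complex.ofRealHom.toAddMonoidHom.comp (zMap ∘ₗ ofSh).toAddMonoidHom with hl
  have hl' : ∀ w, l (wd w) = zetaWord w := fun w => by
    rw [hl]
    change ((zMap (ofSh (wd w)) : ℝ) : ℂ) = _
    rw [ofSh_wd]; rfl
  have h := congrArg l (zero_mul_replicate_indexWord (zero_mul_indexWord n) j)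
  have h0 : l (wd [0] * wd (List.replicate j 0 ++ indexWord n)) = 0 := by
    change ((zMap (ofSh _) : ℝ) : ℂ) = 0
    rw [ofSh_mul, ofSh_wd [0], regInt_zero, zero_mul, map_zero, Complex.ofReal_zero]
  rw [h0, map_add, map_nsmul, map_raise] at h
  simp only [hl', nsmul_eq_mul] at h
  push_cast at h
  linear_combination -h

/-- Differentiation in x on one side and shuffling with 0 on the other give the same recursion in
`c`, which raises entries and so keeps them at least 2. For c = 0 both sides are the multiple zeta
value. -/
lemma tendsto_coeff_multiSum_hurwitzFn (c : ℕ) {n : Index} (hn : ∀ k ∈ n, 2 ≤ k) :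
    Filter.Tendsto (fun N => coeff c (multiSum hurwitzFn (List.range' 1 N) n)) Filter.atTop
      (nhds (zetaWord (List.replicate c 0 ++ indexWord n))) := by
  induction c generalizing n with
  | zero =>
    rw [List.replicate_zero, List.nil_append, zetaWord_indexWord hn]
    refine ((Complex.continuous_ofReal.tendsto _).comp
      (tendsto_multiSum_mzv (isConv_of_two_le hn))).congr fun N => ?_
    rw [Function.comp_apply, coeff_zero_eq_constantCoeff_apply, map_multiSum,
      ← Complex.ofRealHom_eq_coe, map_multiSum]
    refine multiSum_congr fun k _ m _ => ?_
    simp [zetaFn, hurwitzFn, invSeries]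
  | succ c ih =>
    have h1 : ∀ N, coeff (c + 1) (multiSum hurwitzFn (List.range' 1 N) n) = ((c : ℂ) + 1)⁻¹ *
        -raise (fun m => coeff c (multiSum hurwitzFn (List.range' 1 N) m)) n := by
      intro N
      have h := congrArg (coeff c) (derivative_multiSum (List.range' 1 N)
        (fun m hm => by simp at hm; omega) n)
      rw [coeff_derivative, map_neg] at h
      have h2 := map_raise (coeff (R := ℂ) c).toAddMonoidHom (multiSum hurwitzFn (List.range' 1 N)) n
      simp only [LinearMap.toAddMonoidHom_coe] at h2
      rw [h2] at h
      have hc : (c : ℂ) + 1 ≠ 0 := by exact_mod_cast Nat.succ_ne_zero c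
      rw [← h]
      field_simp
    have h2 : zetaWord (List.replicate (c + 1) 0 ++ indexWord n) = ((c : ℂ) + 1)⁻¹ *
        -raise (fun m => zetaWord (List.replicate c 0 ++ indexWord m)) n := by
      have hc : (c : ℂ) + 1 ≠ 0 := by exact_mod_cast Nat.succ_ne_zero c
      rw [← zetaWord_replicate_succ]
      field_simp
    have hlim : ∀ (f : ℕ → Index → ℂ) (g : Index → ℂ) (n : Index), (∀ k ∈ n, 2 ≤ k) →
        (∀ m : Index, (∀ k ∈ m, 2 ≤ k) → Filter.Tendsto (fun N => f N m) Filter.atTop (nhds (g m))) →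
        Filter.Tendsto (fun N => raise (f N) n) Filter.atTop (nhds (raise g n)) := by
      intro f g n hn hfg
      induction n generalizing f g with
      | nil => exact tendsto_const_nhds
      | cons k n ihn =>
        have hk : 2 ≤ k := hn k (by simp)
        have hn' : ∀ l ∈ n, 2 ≤ l := fun l hl => hn l (by simp [hl])
        refine Filter.Tendsto.add (Filter.Tendsto.const_smul (hfg _ ?_) _)
          (ihn (fun N m => f N (k :: m)) (fun m => g (k :: m)) hn' fun m hm => hfg _ ?_)
        · intro l hl
          rcases List.mem_cons.mp hl with rfl | hl
          · exact hk.trans (PNat.lt_add_right k 1).le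
          · exact hn' l hl
        · intro l hl
          rcases List.mem_cons.mp hl with rfl | hl
          · exact hk
          · exact hm l hl
    simp only [h1, h2]
    exact ((hlim _ _ n hn fun m hm => ih hm).neg).const_mul _

end Hurwitz

end MES

namespace MES

/-! ### The coefficients of the blocks -/

section BlockCoefficients

variable {R : Type} [CommRing R]

/-- The sum of `F u a v` over all decompositions `n = u ++ a :: v`. -/
def splitSum {M : Type} [AddCommMonoid M] : (Index → ℕ+ → Index → M) → Index → M
  | _, [] => 0
  | F, a :: n => F [] a n + splitSum (fun u => F (a :: u)) n

lemma splitSum_congr {M : Type} [AddCommMonoid M] {F G : Index → ℕ+ → Index → M} {n : Index}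
    (h : ∀ u a v, u ++ a :: v = n → F u a v = G u a v) : splitSum F n = splitSum G n := by
  induction n generalizing F G with
  | nil => rfl
  | cons b n ih =>
    rw [splitSum, splitSum, h [] b n rfl]
    congr 1
    exact ih fun u a v huv => h (b :: u) a v (by rw [← huv]; rfl)

lemma splitSum_add {M : Type} [AddCommMonoid M] (F G : Index → ℕ+ → Index → M) (n : Index) :
    splitSum (fun u a v => F u a v + G u a v) n = splitSum F n + splitSum G n := by
  induction n generalizing F G with
  | nil => simp [splitSum]
  | cons b n ih => simp only [splitSum, ih]; abel

lemma map_splitSum {M N : Type} [AddCommMonoid M] [AddCommMonoid N] (l : M →+ N)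
    (F : Index → ℕ+ → Index → M) (n : Index) :
    l (splitSum F n) = splitSum (fun u a v => l (F u a v)) n := by
  induction n generalizing F with
  | nil => simp [splitSum]
  | cons b n ih => simp only [splitSum, map_add, ih]

lemma splitSum_finset_sum {M ι : Type} [AddCommMonoid M] (s : Finset ι)
    (F : ι → Index → ℕ+ → Index → M) (n : Index) :
    splitSum (fun u a v => ∑ i ∈ s, F i u a v) n = ∑ i ∈ s, splitSum (F i) n := by
  induction n generalizing F with
  | nil => simp [splitSum]
  | cons b n ih => simp only [splitSum, ih, Finset.sum_add_distrib]

lemma zeroShift_replicate (g : Word → R) (j m : ℕ) {w : Word} (hw : ∀ v, w ≠ 0 :: v) :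
    zeroShift g j (List.replicate m 0 ++ w) =
      if j ≤ m then g (List.replicate (m - j) 0 ++ w) else 0 := by
  induction j generalizing m with
  | zero => simp [zeroShift]
  | succ j ih =>
    rw [zeroShift]
    cases m with
    | zero => rw [List.replicate_zero, List.nil_append, letterFn_zero_conv_eq_zero _ hw]; simp
    | succ m =>
      rw [List.replicate_succ, List.cons_append, letterFn_conv_cons, if_pos rfl, ih]
      simp

lemma conv_replicate_nil (f g : Word → R) (m : ℕ) : conv f g (List.replicate m 0) =
    ∑ p ∈ Finset.range (m + 1), f (List.replicate p 0) * g (List.replicate (m - p) 0) := by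
  rw [conv, lcut_eq_sum, List.length_replicate]
  refine Finset.sum_congr rfl fun p hp => ?_
  have : p ≤ m := by simpa [Nat.lt_succ_iff] using hp
  simp [this]

lemma conv_replicate_one (f g : Word → R) (m : ℕ) (w : Word) :
    conv f g (List.replicate m 0 ++ 1 :: w) =
      ∑ p ∈ Finset.range (m + 1), f (List.replicate p 0) * g (List.replicate (m - p) 0 ++ 1 :: w) +
        conv (fun v => f (List.replicate m 0 ++ 1 :: v)) g w := by
  induction m generalizing f with
  | zero => simp [conv_cons]
  | succ m ih =>
    rw [List.replicate_succ, List.cons_append, conv_cons, ih, Finset.sum_range_succ' _ (m + 1)]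
    simp only [List.replicate_succ, List.replicate_zero, Nat.add_sub_add_right, Nat.sub_zero,
      List.cons_append]
    ring

/-- The word `0^{b-1} 1 ⋯ 1 0^p` preceding the cut in the run of zeros after the index `u`. -/
def prefixWord (u : Index) (p : ℕ) : Word := (indexWord u ++ 1 :: List.replicate p 0).tail

lemma prefixWord_cons (b : ℕ+) (u : Index) (p : ℕ) :
    prefixWord (b :: u) p = List.replicate b.natPred 0 ++ 1 :: prefixWord u p := by
  have h : indexWord u ++ 1 :: List.replicate p 0 = 1 :: prefixWord u p := by
    cases u <;> rfl
  rw [prefixWord, indexWord, List.cons_append, List.tail_cons, List.append_assoc, h]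

lemma reverse_prefixWord (u : Index) (p : ℕ) :
    (prefixWord u p).reverse = List.replicate p 0 ++ indexWord u.reverse := by
  induction u with
  | nil => simp [prefixWord, indexWord]
  | cons b u ih =>
    rw [prefixWord_cons, List.reverse_append, List.reverse_cons, ih, List.reverse_cons,
      indexWord_append, indexWord_singleton]
    simp

lemma length_prefixWord (u : Index) (p : ℕ) :
    (prefixWord u p).length = p + (u.map fun k : ℕ+ => (k : ℕ)).sum := by
  have := congrArg List.length (reverse_prefixWord u p)
  rw [List.length_reverse, List.length_append, List.length_replicate, length_indexWord] at this
  rw [this, List.map_reverse, List.sum_reverse]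

/-- The `j` removed zeros are adjacent, so they lie in the run of zeros of a single entry `a`; `p`
counts the zeros of that run before them. -/
lemma conv_zeroShift_eq_splitSum (f g : Word → R) (j : ℕ) (b : ℕ+) (n : Index) :
    conv f (zeroShift g j) (List.replicate b.natPred 0 ++ indexWord n) =
      splitSum (fun u a v => ∑ p ∈ Finset.range (a.natPred + 1), f (prefixWord u p) *
        if j ≤ a.natPred - p then g (List.replicate (a.natPred - p - j) 0 ++ indexWord v) else 0)
        (b :: n) := by
  induction n generalizing f b with
  | nil =>
    rw [indexWord, List.append_nil, conv_replicate_nil, splitSum, splitSum, add_zero]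
    refine Finset.sum_congr rfl fun p _ => ?_
    have := zeroShift_replicate g j (b.natPred - p) (w := []) (by simp)
    rw [List.append_nil] at this
    rw [this]
    rfl
  | cons c n ih =>
    have h := conv_replicate_one f (zeroShift g j) b.natPred
      (List.replicate c.natPred 0 ++ indexWord n)
    rw [indexWord, h, splitSum, ih]
    congr 1
    · refine Finset.sum_congr rfl fun p _ => ?_
      rw [zeroShift_replicate g j _ (by simp)]
      rfl
    · refine splitSum_congr (M := R) fun u a v _ => Finset.sum_congr rfl fun p _ => ?_
      rw [prefixWord_cons]

/-- The values of `ζ^sh`, as complex numbers. -/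
noncomputable def zC (a b : Fin 2) (w : Word) : ℂ := (zMap (regInt a w b) : ℝ)

lemma zC_zero_one : zC 0 1 = zetaWord := rfl

lemma pathFamily_zC : PathFamily zC where
  same a := by
    funext w
    cases w with
    | nil => rw [zC, regInt_nil, zMap_one, Complex.ofReal_one]; rfl
    | cons b w => rw [zC, regInt_same a _ (by simp), map_zero, Complex.ofReal_zero]; rfl
  path a b c := by
    funext w
    rw [zC, regInt_path a b c w, cut_eq_lcut, map_lcut, ← Complex.ofRealHom_eq_coe, map_lcut]
    exact lcut_congr fun u v _ => by rw [zMap_mul, map_mul]; rfl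

/-- Path reversal: the antipode formula makes the right side a convolution inverse of `zC 0 1`, and
path composition makes `zC 1 0` one as well. -/
lemma zC_one_zero (w : Word) : zC 1 0 w = (-1) ^ w.length * zetaWord w.reverse := by
  set g : Word → ℂ := fun w => (-1) ^ w.length * zetaWord w.reverse with hg
  have h : conv (zC 0 1) g = unitFn := by
    funext w
    have h : ((zMap (ofSh (cut (fun u v => wd u * anti (wd v)) w)) : ℝ) : ℂ) = _ :=
      congrArg (fun x => ((zMap (ofSh x) : ℝ) : ℂ)) (cut_anti w)
    rw [cut_eq_lcut, map_lcut, map_lcut, ← Complex.ofRealHom_eq_coe, map_lcut] at h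
    rw [conv]
    refine Eq.trans (lcut_congr fun u v _ => ?_) (h.trans ?_)
    · rw [ofSh_mul, zMap_mul, map_mul, anti_wd, map_smul, map_smul, ofSh_wd, ofSh_wd, Rat.smul_def,
        map_mul, hg]
      simp [zC, zetaWord]
    · cases w with
      | nil => simp [← wd_nil, ofSh_wd, regInt_nil, zMap_one, unitFn]
      | cons a w => simp [unitFn]
  have h2 : zC 1 0 = g := by
    rw [← conv_unitFn (zC 1 0), ← h, ← conv_assoc, pathFamily_zC.path, pathFamily_zC.same,
      unitFn_conv]
  rw [h2]

/-- The coefficient of `ε^p` in the sum over negative integers. -/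
noncomputable def leftCoeff (p : ℕ) (u : Index) : ℂ :=
  (-1) ^ (p + (u.map fun k : ℕ+ => (k : ℕ)).sum) *
    zetaWord (List.replicate p 0 ++ indexWord u.reverse)

lemma zC_prefixWord (u : Index) (p : ℕ) : zC 1 0 (prefixWord u p) = leftCoeff p u := by
  rw [zC_one_zero, reverse_prefixWord, length_prefixWord, leftCoeff]

lemma blockCoeff_eq_splitSum (j : ℕ) (n : Index) : blockCoeff zC j n =
    splitSum (fun u a v => if j ≤ a.natPred then
      ∑ p ∈ Finset.HasAntidiagonal.antidiagonal (a.natPred - j), leftCoeff p.1 u *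
        zetaWord (List.replicate p.2 0 ++ indexWord v) else 0) n := by
  cases n with
  | nil => rfl
  | cons b n =>
    rw [blockCoeff, tailFn, tauFn, conv_zeroShift_eq_splitSum]
    refine splitSum_congr fun u a v _ => ?_
    simp only [zC_prefixWord, zC_zero_one, mul_ite, mul_zero]
    split_ifs with h
    · rw [← Finset.sum_filter, Finset.Nat.sum_antidiagonal_eq_sum_range_succ_mk]
      refine Finset.sum_congr ?_ fun p hp => ?_
      · ext p
        simp only [Finset.mem_filter, Finset.mem_range]
        omega
      · rw [show a.natPred - p - j = a.natPred - j - p by omega]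
    · exact Finset.sum_eq_zero fun p _ => if_neg (by omega)

end BlockCoefficients

end MES

namespace MES

/-! ### Partial fractions -/

section PartialFractions

open PowerSeries

variable {R : Type} [CommRing R] [Algebra ℂ R]

/-- The polar part `∑_{i < k} g_i v^{k-i}` of `v^k g(v⁻¹)`. -/
noncomputable def polarPart (v : R) (g : ℂ⟦X⟧) (k : ℕ) : R :=
  ∑ i ∈ Finset.range k, coeff i g • v ^ (k - i)

lemma polarPart_add (v : R) (g h : ℂ⟦X⟧) (k : ℕ) :
    polarPart v (g + h) k = polarPart v g k + polarPart v h k := by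
  simp only [polarPart, map_add, add_smul, Finset.sum_add_distrib]

lemma polarPart_smul (v : R) (c : ℂ) (g : ℂ⟦X⟧) (k : ℕ) :
    polarPart v (c • g) k = c • polarPart v g k := by
  simp only [polarPart, PowerSeries.coeff_smul, smul_assoc, Finset.smul_sum]

/-- The polar part, as a linear map. -/
noncomputable def polarMap (v : R) (k : ℕ) : ℂ⟦X⟧ →ₗ[ℂ] R where
  toFun g := polarPart v g k
  map_add' g h := polarPart_add v g h k
  map_smul' c g := polarPart_smul v c g k

lemma polarMap_apply (v : R) (g : ℂ⟦X⟧) (k : ℕ) : polarMap v k g = polarPart v g k := rfl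

lemma polarPart_X_mul (v : R) (g : ℂ⟦X⟧) (k : ℕ) :
    polarPart v (X * g) (k + 1) = polarPart v g k := by
  rw [polarPart, Finset.sum_range_succ', polarPart]
  simp [coeff_succ_X_mul]

lemma polarPart_one {v : R} {k : ℕ} (hk : k ≠ 0) : polarPart v 1 k = v ^ k := by
  rw [polarPart, Finset.sum_eq_single 0]
  · simp
  · intro i _ hi
    rw [coeff_one, if_neg hi, zero_smul]
  · intro h
    exact absurd (Finset.mem_range.mpr (Nat.pos_of_ne_zero hk)) h

lemma polarPart_mul (v : R) (f g : ℂ⟦X⟧) (k : ℕ) :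
    polarPart v (f * g) k = ∑ j ∈ Finset.range k, coeff j g • polarPart v f (k - j) := by
  simp only [polarPart, Finset.smul_sum, coeff_mul, Finset.sum_smul]
  rw [Finset.sum_sigma', Finset.sum_sigma']
  refine Finset.sum_bij' (fun x _ => ⟨x.2.2, x.2.1⟩) (fun x _ => ⟨x.1 + x.2, (x.2, x.1)⟩) ?_ ?_ ?_ ?_ ?_
  · rintro ⟨s, i, j⟩ h
    simp only [Finset.mem_sigma, Finset.mem_range, Finset.HasAntidiagonal.mem_antidiagonal] at h ⊢
    omega
  · rintro ⟨j, i⟩ h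
    simp only [Finset.mem_sigma, Finset.mem_range, Finset.HasAntidiagonal.mem_antidiagonal] at h ⊢
    omega
  · rintro ⟨s, i, j⟩ h
    simp only [Finset.mem_sigma, Finset.mem_range, Finset.HasAntidiagonal.mem_antidiagonal] at h
    obtain ⟨_, rfl⟩ := h
    simp [add_comm]
  · rintro ⟨j, i⟩ h
    rfl
  · rintro ⟨s, i, j⟩ h
    simp only [Finset.mem_sigma, Finset.mem_range, Finset.HasAntidiagonal.mem_antidiagonal] at h
    obtain ⟨_, rfl⟩ := h
    rw [smul_smul, mul_comm (coeff i f), show k - j - i = k - (i + j) by omega]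

lemma polarPart_invSeries_pow {d : ℂ} (hd : d ≠ 0) (v : R) (i k : ℕ) :
    d • polarPart v (invSeries d ^ (i + 1)) (k + 1) =
      polarPart v (invSeries d ^ i) (k + 1) - polarPart v (invSeries d ^ (i + 1)) k := by
  have h : invSeries d ^ i = d • invSeries d ^ (i + 1) + X * invSeries d ^ (i + 1) := by
    rw [smul_eq_C_mul, ← add_mul, pow_succ', ← mul_assoc, add_X_mul_invSeries hd, one_mul]
  rw [h, polarPart_add, polarPart_smul, polarPart_X_mul, add_sub_cancel_right]

/-- The partial fraction decomposition of a product of powers of two linear forms. -/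
lemma pow_mul_pow_eq_polarPart {d : ℂ} (hd : d ≠ 0) {u v : R} (h : d • (u * v) = v - u) (i k : ℕ)
    (hik : i + k ≠ 0) : u ^ i * v ^ k =
      polarPart v (invSeries d ^ i) k + polarPart u (invSeries (-d) ^ k) i := by
  induction i generalizing k with
  | zero => rw [pow_zero, pow_zero, one_mul, polarPart_one (by omega)]; simp [polarPart]
  | succ i ihi =>
    induction k with
    | zero => rw [pow_zero, pow_zero, mul_one, polarPart_one (by omega)]; simp [polarPart]
    | succ k ihk =>
      -- The relation between `u` and `v` lowers the total degree by one. The expansions of (d +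
      -- x)^{-i} and (-d + x)^{-k} satisfy matching recursions, so the polar parts agree by double
      -- induction.
      have h1 : d • (u ^ (i + 1) * v ^ (k + 1)) =
          u ^ i * v ^ (k + 1) - u ^ (i + 1) * v ^ k := by
        rw [show u ^ (i + 1) * v ^ (k + 1) = (u ^ i * v ^ k) * (u * v) by ring, ← mul_smul_comm, h]
        ring
      have h2 := polarPart_invSeries_pow hd v i k
      have h3 := polarPart_invSeries_pow (neg_ne_zero.mpr hd) u k i
      rw [neg_smul] at h3
      refine (IsUnit.mk0 d hd).smul_left_cancel.mp ?_
      rw [h1, ihi (k + 1) (by omega), ihk (by omega), smul_add, h2, ← neg_eq_iff_eq_neg.mpr h3.symm]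
      ring

/-- Multiplying a polar part at `v` by `u ^ i` multiplies its expansion by that of the new factor
and creates poles at `u`. Their expansion is the old polar part itself, rewritten in the local
parameter at `u`. -/
lemma pow_mul_polarPart {d : ℂ} (hd : d ≠ 0) {u v : R} (h : d • (u * v) = v - u) (i a : ℕ)
    (g : ℂ⟦X⟧) : u ^ i * polarPart v g a = polarPart v (invSeries d ^ i * g) a +
      polarPart u (polarPart (invSeries (-d)) g a) i := by
  rw [polarPart_mul, ← polarMap_apply u, polarPart, polarPart, map_sum, Finset.mul_sum,
    ← Finset.sum_add_distrib]
  refine Finset.sum_congr rfl fun j hj => ?_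
  have hj := Finset.mem_range.mp hj
  rw [mul_smul_comm, pow_mul_pow_eq_polarPart hd h i (a - j) (by omega), smul_add, map_smul,
    polarMap_apply]

/-! ### Poles of multiple sums -/

/-- The multiple sum of inverse powers, expanded at `-x`. -/
noncomputable def localSum (x : ℤ) (A : List ℤ) (n : Index) : ℂ⟦X⟧ :=
  multiSum (fun (k : ℕ+) (m : ℤ) => invSeries ((m : ℂ) - x) ^ (k : ℕ)) A n

/-- The contribution of the poles at `-m` to the multiple sum, where `A` and `B` are the lists of
smaller and larger elements. -/
noncomputable def poleSum (u : ℤ → R) (A : List ℤ) (m : ℤ) (B : List ℤ) (n : Index) : R :=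
  splitSum (fun p a s => polarPart (u m) (localSum m A p * localSum m B s) a) n

lemma poleSum_cons (u : ℤ → R) (x : ℤ) (A : List ℤ) (m : ℤ) (B : List ℤ) (i : ℕ+) (n : Index) :
    poleSum u (x :: A) m B (i :: n) = poleSum u A m B (i :: n) +
      splitSum (fun p a s => polarPart (u m)
        (invSeries ((x : ℂ) - m) ^ (i : ℕ) * (localSum m A p * localSum m B s)) a) n := by
  rw [poleSum, poleSum, splitSum, splitSum, add_assoc, ← splitSum_add]
  congr 1
  · simp only [localSum, multiSum_nil_right]
  · refine splitSum_congr fun p a s _ => ?_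
    rw [← polarPart_add, localSum, multiSum_cons_cons, localSum, localSum, localSum]
    congr 1
    ring

lemma poleSum_nil_left (u : ℤ → R) (x : ℤ) (B : List ℤ) (i : ℕ+) (n : Index) :
    poleSum u [] x B (i :: n) = polarPart (u x) (localSum x B n) i := by
  have : splitSum (fun (p : Index) (a : ℕ+) s => polarPart (u x)
      (localSum x [] (i :: p) * localSum x B s) a) n = splitSum (fun _ _ _ => 0) n := by
    refine splitSum_congr fun p a s _ => ?_
    rw [localSum, multiSum_nil_cons, zero_mul]
    simp [polarPart]
  rw [poleSum, splitSum, this]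
  have h0 : splitSum (fun _ _ _ => (0 : R)) n = 0 := (map_splitSum (0 : R →+ R) (fun _ _ _ => 0) n).symm
  rw [h0, add_zero, localSum, multiSum_nil_right, one_mul]

/-- The partial fraction decomposition of multiple sums over finite sets of integers. -/
lemma multiSum_eq_sum_poleSum {L : List ℤ} (hL : L.Pairwise (· < ·)) (u : ℤ → R)
    (hu : ∀ x ∈ L, ∀ m ∈ L, x ≠ m → ((x : ℂ) - m) • (u x * u m) = u m - u x) (i : ℕ+) (n : Index) :
    multiSum (fun (k : ℕ+) m => u m ^ (k : ℕ)) L (i :: n) =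
      (L.map fun m => poleSum u (L.filter (· < m)) m (L.filter (m < ·)) (i :: n)).sum := by
  -- The ring must vary: the expansion at the new point `x` is itself a multiple sum over `L`, in
  -- power series, and needs the same decomposition.
  induction L generalizing R i n with
  | nil => rfl
  | cons x L ih =>
    obtain ⟨hx, hL⟩ := List.pairwise_cons.mp hL
    have hu' : ∀ y ∈ L, ∀ m ∈ L, y ≠ m → ((y : ℂ) - m) • (u y * u m) = u m - u y :=
      fun y hy m hm => hu y (by simp [hy]) m (by simp [hm])
    have f1 : (x :: L).filter (· < x) = [] := by
      rw [List.filter_eq_nil_iff]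
      intro m hm
      rcases List.mem_cons.mp hm with rfl | hm
      · simp
      · simpa using (hx m hm).le
    have f2 : (x :: L).filter (x < ·) = L := by
      rw [List.filter_cons_of_neg (by simp), List.filter_eq_self]
      intro m hm
      simpa using hx m hm
    have f3 : ∀ m ∈ L, (x :: L).filter (· < m) = x :: L.filter (· < m) := fun m hm =>
      List.filter_cons_of_pos (by simpa using hx m hm)
    have f4 : ∀ m ∈ L, (x :: L).filter (m < ·) = L.filter (m < ·) := fun m hm =>
      List.filter_cons_of_neg (by simpa using (hx m hm).le)
    have hmap : (L.map fun m => poleSum u ((x :: L).filter (· < m)) m ((x :: L).filter (m < ·))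
        (i :: n)) = L.map fun m => poleSum u (L.filter (· < m)) m (L.filter (m < ·)) (i :: n) +
          splitSum (fun p a s => polarPart (u m) (invSeries ((x : ℂ) - m) ^ (i : ℕ) *
            (localSum m (L.filter (· < m)) p * localSum m (L.filter (m < ·)) s)) a) n :=
      List.map_congr_left fun m hm => by rw [f3 m hm, f4 m hm, poleSum_cons]
    rw [multiSum_cons_cons, ih hL u hu', List.map_cons, List.sum_cons, f1, f2, poleSum_nil_left, hmap,
      List.sum_map_add, add_left_comm]
    congr 1
    cases n with
    | nil =>
      rw [multiSum_nil_right, mul_one, localSum, multiSum_nil_right, polarPart_one i.ne_zero]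
      simp [splitSum]
    | cons j n =>
      have hne : ∀ m ∈ L, (m : ℂ) - x ≠ 0 := fun m hm => by
        rw [sub_ne_zero]
        exact_mod_cast (hx m hm).ne'
      -- The statement for `L` in the ring of power series, with values 1/(m - x + X): this expands
      -- the tail at the pole belonging to `x`.
      have hloc := ih hL (fun m => invSeries ((m : ℂ) - x)) (fun y hy m hm _ => by
        have h1 := add_X_mul_invSeries (hne y hy)
        have h2 := add_X_mul_invSeries (hne m hm)
        rw [smul_eq_C_mul]
        have h3 : (C ((y : ℂ) - m) : ℂ⟦X⟧) = (C ((y : ℂ) - x) + X) - (C ((m : ℂ) - x) + X) := by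
          rw [add_sub_add_right_eq_sub, ← map_sub]
          congr 1
          ring
        rw [h3]
        linear_combination invSeries ((m : ℂ) - x) * h1 - invSeries ((y : ℂ) - x) * h2) j n
      change localSum x L (j :: n) = _ at hloc
      rw [ih hL u hu', hloc, ← polarMap_apply, map_list_sum, List.map_map, ← List.sum_map_mul_left,
        ← List.sum_map_add]
      congr 1
      refine List.map_congr_left fun m hm => ?_
      have hd : (x : ℂ) - m ≠ 0 := by
        rw [← neg_sub]
        exact neg_ne_zero.mpr (hne m hm)
      have hum := hu x (by simp) m (by simp [hm]) (hx m hm).ne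
      have e1 := map_splitSum (AddMonoidHom.mulLeft (u x ^ (i : ℕ)))
        (fun p a s => polarPart (u m)
          (localSum m (L.filter (· < m)) p * localSum m (L.filter (m < ·)) s) (a : ℕ)) (j :: n)
      have e2 := map_splitSum (polarMap (u x) (i : ℕ)).toAddMonoidHom
        (fun p a s => polarPart (invSeries ((m : ℂ) - x))
          (localSum m (L.filter (· < m)) p * localSum m (L.filter (m < ·)) s) (a : ℕ)) (j :: n)
      simp only [AddMonoidHom.coe_mulLeft, LinearMap.toAddMonoidHom_coe] at e1 e2
      simp only [Function.comp_apply]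
      rw [poleSum, poleSum, e1, e2, add_comm, ← splitSum_add]
      refine splitSum_congr fun p a s _ => ?_
      rw [pow_mul_polarPart hd hum, polarMap_apply, neg_sub]

/-- The coefficient of `(τ + m)^{-(j+1)}` in the partial fraction decomposition. -/
noncomputable def poleCoeff (j : ℕ) (A : List ℤ) (m : ℤ) (B : List ℤ) (n : Index) : ℂ :=
  splitSum (fun p a s => if j ≤ a.natPred then
    coeff (a.natPred - j) (localSum m A p * localSum m B s) else 0) n

lemma poleSum_eq_sum (u : ℤ → R) (A : List ℤ) (m : ℤ) (B : List ℤ) (n : Index) {J : ℕ}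
    (hJ : ∀ a ∈ n, (a : ℕ) ≤ J) : poleSum u A m B n =
      ∑ j ∈ Finset.range J, poleCoeff j A m B n • u m ^ (j + 1) := by
  have h : ∀ j, poleCoeff j A m B n • u m ^ (j + 1) = splitSum (fun p a s => (if j ≤ a.natPred then
      coeff (a.natPred - j) (localSum m A p * localSum m B s) else 0) • u m ^ (j + 1)) n := fun j =>
    map_splitSum ((LinearMap.toSpanSingleton ℂ R (u m ^ (j + 1))).toAddMonoidHom) _ n
  simp only [h]
  rw [← splitSum_finset_sum, poleSum]
  refine splitSum_congr fun p a s hn => ?_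
  have ha : (a : ℕ) ≤ J := hJ a (by rw [← hn]; simp)
  have hs : Finset.range (a : ℕ) ⊆ Finset.range J := Finset.range_mono ha
  rw [← Finset.sum_subset hs, polarPart, ← Finset.sum_range_reflect]
  · refine Finset.sum_congr rfl fun j hj => ?_
    have hj := Finset.mem_range.mp hj
    have := a.natPred_add_one
    rw [if_pos (by omega), show (a : ℕ) - 1 - j = a.natPred - j by omega,
      show (a : ℕ) - (a.natPred - j) = j + 1 by omega]
  · intro j _ hj
    have := a.natPred_add_one
    rw [Finset.mem_range] at hj
    rw [if_neg (by omega), zero_smul]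

end PartialFractions

end MES

namespace MES

/-! ### Limits of the coefficients of the partial fraction decomposition -/

section Window

open PowerSeries

/-- The list of integers from `-M` to `M`. -/
def window (M : ℕ) : List ℤ := (List.range (2 * M + 1)).map fun i : ℕ => (i : ℤ) - M

lemma mem_window {M : ℕ} {m : ℤ} : m ∈ window M ↔ -(M : ℤ) ≤ m ∧ m ≤ M := by
  simp only [window, List.mem_map, List.mem_range]
  constructor
  · rintro ⟨i, hi, rfl⟩
    omega
  · rintro ⟨h1, h2⟩
    exact ⟨(m + M).toNat, by omega, by omega⟩

lemma pairwise_window (M : ℕ) : (window M).Pairwise (· < ·) := by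
  rw [window, List.pairwise_map]
  exact List.pairwise_lt_range.imp fun h => by omega

lemma list_eq_of_pairwise {L L' : List ℤ} (hL : L.Pairwise (· < ·)) (hL' : L'.Pairwise (· < ·))
    (h : ∀ m, m ∈ L ↔ m ∈ L') : L = L' :=
  ((List.perm_ext_iff_of_nodup (hL.imp ne_of_lt) (hL'.imp ne_of_lt)).mpr h).eq_of_pairwise
    (fun _ _ _ _ h1 h2 => absurd (h1.trans h2) (lt_irrefl _)) hL hL'

lemma filter_lt_window {M : ℕ} {m : ℤ} (hm : m ∈ window M) : (window M).filter (m < ·) =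
    (List.range' 1 (M - m).toNat).map fun i : ℕ => m + i := by
  rw [mem_window] at hm
  refine list_eq_of_pairwise ((pairwise_window M).filter _) ?_ fun x => ?_
  · rw [List.pairwise_map]
    exact (List.pairwise_lt_range' _ (pos := one_pos)).imp fun h => by omega
  · simp only [List.mem_filter, mem_window, decide_eq_true_eq, List.mem_map, List.mem_range'_1]
    constructor
    · intro h
      exact ⟨(x - m).toNat, by omega, by omega⟩
    · rintro ⟨i, hi, rfl⟩
      omega

lemma filter_gt_window {M : ℕ} {m : ℤ} (hm : m ∈ window M) : (window M).filter (· < m) =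
    ((List.range' 1 (M + m).toNat).map fun i : ℕ => m - i).reverse := by
  rw [mem_window] at hm
  refine list_eq_of_pairwise ((pairwise_window M).filter _) ?_ fun x => ?_
  · rw [List.pairwise_reverse, List.pairwise_map]
    exact (List.pairwise_lt_range' _ (pos := one_pos)).imp fun h => by omega
  · simp only [List.mem_filter, mem_window, decide_eq_true_eq, List.mem_reverse, List.mem_map,
      List.mem_range'_1]
    constructor
    · intro h
      exact ⟨(m - x).toNat, by omega, by omega⟩
    · rintro ⟨i, hi, rfl⟩
      omega

lemma localSum_filter_lt {M : ℕ} {m : ℤ} (hm : m ∈ window M) (n : Index) :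
    localSum m ((window M).filter (m < ·)) n =
      multiSum hurwitzFn (List.range' 1 (M - m).toNat) n := by
  rw [filter_lt_window hm, localSum, multiSum_map]
  refine multiSum_congr fun k _ i _ => ?_
  rw [hurwitzFn]
  push_cast
  rw [add_sub_cancel_left]

lemma rescale_invSeries {d : ℂ} (hd : d ≠ 0) :
    rescale (-1 : ℂ) (invSeries d) = -invSeries (-d) := by
  have h1 := congrArg (rescale (-1 : ℂ)) (add_X_mul_invSeries hd)
  have h2 := add_X_mul_invSeries (neg_ne_zero.mpr hd)
  have h3 : rescale (-1 : ℂ) (C d) = C d := by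
    ext i
    rw [coeff_rescale, coeff_C]
    split_ifs with hi
    · rw [hi, pow_zero, one_mul]
    · rw [mul_zero]
  rw [map_mul, map_add, map_one, rescale_X, h3] at h1
  simp only [map_neg, map_one] at h1 h2
  linear_combination -invSeries (-d) * h1 - rescale (-1 : ℂ) (invSeries d) * h2

/-- Reflection of the integers about `m` reverses the order, hence the index, and replaces X by -X,
which produces the signs. -/
lemma coeff_localSum_filter_gt {M : ℕ} {m : ℤ} (hm : m ∈ window M) (c : ℕ) (n : Index) :
    coeff c (localSum m ((window M).filter (· < m)) n) =
      (-1) ^ (c + (n.map fun k : ℕ+ => (k : ℕ)).sum) *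
        coeff c (multiSum hurwitzFn (List.range' 1 (M + m).toNat) n.reverse) := by
  have h1 : localSum m ((window M).filter (· < m)) n = (-1) ^ (n.map fun k : ℕ+ => (k : ℕ)).sum *
      rescale (-1 : ℂ) (multiSum hurwitzFn (List.range' 1 (M + m).toNat) n.reverse) := by
    rw [filter_gt_window hm, localSum, ← n.reverse_reverse, multiSum_reverse, multiSum_map,
      map_multiSum, List.reverse_reverse, ← List.sum_reverse (List.map _ n), ← List.map_reverse]
    have h2 : ∀ u : Index, (-1 : ℂ⟦X⟧) ^ (u.map fun k : ℕ+ => (k : ℕ)).sum =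
        (u.map fun k : ℕ+ => (-1) ^ (k : ℕ)).prod := fun u => by
      induction u with
      | nil => rfl
      | cons k u ih => rw [List.map_cons, List.sum_cons, pow_add, ih, List.map_cons, List.prod_cons]
    rw [h2, ← multiSum_smul]
    refine multiSum_congr fun k _ i hi => ?_
    have hi : (i : ℂ) ≠ 0 := by
      simp only [List.mem_range'_1] at hi
      exact_mod_cast (by omega : i ≠ 0)
    rw [hurwitzFn, map_pow, rescale_invSeries hi, ← mul_pow]
    push_cast
    rw [show (m : ℂ) - i - m = -i by ring]
    ring
  have h3 : (-1 : ℂ⟦X⟧) ^ (n.map fun k : ℕ+ => (k : ℕ)).sum =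
      C ((-1) ^ (n.map fun k : ℕ+ => (k : ℕ)).sum) := by simp
  rw [h1, h3, coeff_C_mul, coeff_rescale, pow_add]
  ring

end Window

/-! ### Limits in the two ends of the window -/

section BoundedLimits

open Filter

/-- The family `f` is bounded, and tends to `c` as both variables tend to infinity. -/
def BddLim (f : ℕ × ℕ → ℂ) (c : ℂ) : Prop :=
  Tendsto f (atTop ×ˢ atTop) (nhds c) ∧ ∃ B, ∀ x, ‖f x‖ ≤ B

lemma BddLim.add {f g : ℕ × ℕ → ℂ} {c d : ℂ} (hf : BddLim f c) (hg : BddLim g d) :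
    BddLim (fun x => f x + g x) (c + d) := by
  obtain ⟨hf, B, hB⟩ := hf
  obtain ⟨hg, B', hB'⟩ := hg
  exact ⟨hf.add hg, B + B', fun x => (norm_add_le _ _).trans (add_le_add (hB x) (hB' x))⟩

lemma BddLim.mul {f g : ℕ × ℕ → ℂ} {c d : ℂ} (hf : BddLim f c) (hg : BddLim g d) :
    BddLim (fun x => f x * g x) (c * d) := by
  obtain ⟨hf, B, hB⟩ := hf
  obtain ⟨hg, B', hB'⟩ := hg
  refine ⟨hf.mul hg, B * B', fun x => ?_⟩
  rw [norm_mul]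
  exact mul_le_mul (hB x) (hB' x) (norm_nonneg _) ((norm_nonneg _).trans (hB x))

lemma bddLim_const (c : ℂ) : BddLim (fun _ => c) c :=
  ⟨tendsto_const_nhds, ‖c‖, fun _ => le_rfl⟩

lemma BddLim.sum {ι : Type} {s : Finset ι} {f : ι → ℕ × ℕ → ℂ} {c : ι → ℂ}
    (h : ∀ i ∈ s, BddLim (f i) (c i)) : BddLim (fun x => ∑ i ∈ s, f i x) (∑ i ∈ s, c i) := by
  classical
  induction s using Finset.induction_on with
  | empty => simpa using bddLim_const 0
  | insert i s hi ih =>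
    simp only [Finset.sum_insert hi]
    exact (h i (by simp)).add (ih fun j hj => h j (by simp [hj]))

lemma BddLim.splitSum {F : ℕ × ℕ → Index → ℕ+ → Index → ℂ} {G : Index → ℕ+ → Index → ℂ} {n : Index}
    (h : ∀ u a v, u ++ a :: v = n → BddLim (fun x => F x u a v) (G u a v)) :
    BddLim (fun x => splitSum (F x) n) (splitSum G n) := by
  induction n generalizing F G with
  | nil => exact bddLim_const 0
  | cons b n ih =>
    exact (h [] b n rfl).add (ih fun u a v huv => h (b :: u) a v (by rw [← huv]; rfl))

lemma bddLim_fst {f : ℕ → ℂ} {c : ℂ} (h : Tendsto f atTop (nhds c)) :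
    BddLim (fun x => f x.1) c := by
  obtain ⟨B, hB⟩ := (Metric.isBounded_range_of_tendsto f h).exists_norm_le
  exact ⟨h.comp tendsto_fst, B, fun x => hB _ ⟨x.1, rfl⟩⟩

lemma bddLim_snd {f : ℕ → ℂ} {c : ℂ} (h : Tendsto f atTop (nhds c)) :
    BddLim (fun x => f x.2) c := by
  obtain ⟨B, hB⟩ := (Metric.isBounded_range_of_tendsto f h).exists_norm_le
  exact ⟨h.comp tendsto_snd, B, fun x => hB _ ⟨x.2, rfl⟩⟩

/-- The coefficient of `(τ + m)^{-(j+1)}`, with `x.1` integers below and `x.2` integers above `m`. -/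
noncomputable def windowCoeff (j : ℕ) (n : Index) (x : ℕ × ℕ) : ℂ :=
  splitSum (fun u a v => if j ≤ a.natPred then
    ∑ p ∈ Finset.HasAntidiagonal.antidiagonal (a.natPred - j),
      ((-1) ^ (p.1 + (u.map fun k : ℕ+ => (k : ℕ)).sum) *
        PowerSeries.coeff p.1 (multiSum hurwitzFn (List.range' 1 x.1) u.reverse)) *
      PowerSeries.coeff p.2 (multiSum hurwitzFn (List.range' 1 x.2) v) else 0) n

lemma poleCoeff_window {M : ℕ} {m : ℤ} (hm : m ∈ window M) (j : ℕ) (n : Index) :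
    poleCoeff j ((window M).filter (· < m)) m ((window M).filter (m < ·)) n =
      windowCoeff j n ((M + m).toNat, (M - m).toNat) := by
  refine splitSum_congr fun u a v _ => ?_
  split_ifs
  · rw [PowerSeries.coeff_mul]
    refine Finset.sum_congr rfl fun p _ => ?_
    rw [coeff_localSum_filter_gt hm, localSum_filter_lt hm]
  · rfl

/-- The entries on either side of the pole are at least 2, so both truncated Hurwitz sums converge,
to values of ζ^sh at words 0^c n. The limits assemble to the block coefficients of the coproduct,
which ties multitangent functions to Eisenstein series. -/
lemma bddLim_windowCoeff (j : ℕ) {n : Index} (hn : ∀ k ∈ n, 2 ≤ k) :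
    BddLim (windowCoeff j n) (blockCoeff zC j n) := by
  rw [blockCoeff_eq_splitSum]
  refine BddLim.splitSum fun u a v huv => ?_
  subst huv
  split_ifs
  · refine BddLim.sum fun p _ => BddLim.mul (BddLim.mul (bddLim_const _) ?_) ?_
    · exact bddLim_fst (tendsto_coeff_multiSum_hurwitzFn p.1 fun k hk => hn k (by simp at hk; simp [hk]))
    · exact bddLim_snd (tendsto_coeff_multiSum_hurwitzFn p.2 fun k hk => hn k (by simp [hk]))
  · exact bddLim_const 0

end BoundedLimits

end MES

namespace MES

/-! ### Multitangent functions -/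

section Multitangent

open Filter

/-- The function `m ↦ (τ + m)⁻¹`. -/
noncomputable def invShift (τ : ℂ) (m : ℤ) : ℂ := (τ + m)⁻¹

/-- The function `∑_{m ∈ ℤ} (τ + m)^{-k}`. -/
noncomputable def monotangent (k : ℕ) (τ : ℂ) : ℂ := ∑' m : ℤ, invShift τ m ^ k

/-- The multiple sum of `(τ + m)^{-k}` over the integers from `-M` to `M`. -/
noncomputable def windowSum (τ : ℂ) (M : ℕ) (n : Index) : ℂ :=
  multiSum (fun (k : ℕ+) m => invShift τ m ^ (k : ℕ)) (window M) n

lemma add_intCast_ne_zero {τ : ℂ} (hτ : 0 < τ.im) (m : ℤ) : τ + m ≠ 0 := fun h => by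
  have := congrArg Complex.im h
  simp at this
  exact hτ.ne' this

lemma summable_invShift_pow (τ : ℂ) {k : ℕ} (hk : 2 ≤ k) :
    Summable fun m : ℤ => ‖invShift τ m ^ k‖ := by
  refine ((EisensteinSeries.linear_right_summable τ 1 (k := k) (by exact_mod_cast hk)).norm).congr
    fun m => ?_
  simp [invShift]

lemma invShift_sub {τ τ' : ℂ} (hτ : 0 < τ.im) (hτ' : 0 < τ'.im) (m : ℤ) :
    invShift τ m - invShift τ' m = (τ' - τ) * (invShift τ m * invShift τ' m) := by
  have h1 := add_intCast_ne_zero hτ m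
  have h2 := add_intCast_ne_zero hτ' m
  rw [invShift, invShift]
  field_simp
  ring

/-- The series of (τ+m)^{-1} is not absolutely convergent, but a difference at two values of τ is
O(m^{-2}). This is why limits are first taken for differences. -/
lemma summable_invShift_pow_sub {τ τ' : ℂ} (hτ : 0 < τ.im) (hτ' : 0 < τ'.im) (j : ℕ) :
    Summable fun m : ℤ => ‖invShift τ m ^ (j + 1) - invShift τ' m ^ (j + 1)‖ := by
  rcases Nat.eq_zero_or_pos j with rfl | hj
  · refine Summable.of_nonneg_of_le (fun _ => norm_nonneg _) (fun m => ?_)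
      (((summable_invShift_pow τ le_rfl).add (summable_invShift_pow τ' le_rfl)).mul_left ‖τ' - τ‖)
    rw [zero_add, pow_one, pow_one, invShift_sub hτ hτ', norm_mul]
    refine mul_le_mul_of_nonneg_left ?_ (norm_nonneg _)
    rw [norm_mul, norm_pow, norm_pow]
    nlinarith [sq_nonneg (‖invShift τ m‖ - ‖invShift τ' m‖), norm_nonneg (invShift τ m),
      norm_nonneg (invShift τ' m)]
  · refine Summable.of_nonneg_of_le (fun _ => norm_nonneg _) (fun m => norm_sub_le _ _)
      ((summable_invShift_pow τ (by omega)).add (summable_invShift_pow τ' (by omega)))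

lemma sum_map_window {A : Type} [AddCommMonoid A] (M : ℕ) (f : ℤ → A) :
    ((window M).map f).sum = ∑ m ∈ Finset.Icc (-(M : ℤ)) M, f m := by
  rw [← List.sum_toFinset f ((pairwise_window M).imp ne_of_lt)]
  congr 1
  ext m
  simp [mem_window]

lemma windowSum_cons {τ : ℂ} (hτ : 0 < τ.im) (M : ℕ) (i : ℕ+) (n : Index) {J : ℕ}
    (hJ : ∀ a ∈ i :: n, (a : ℕ) ≤ J) : windowSum τ M (i :: n) =
      ∑ j ∈ Finset.range J, ∑ m ∈ Finset.Icc (-(M : ℤ)) M,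
        windowCoeff j (i :: n) ((M + m).toNat, (M - m).toNat) * invShift τ m ^ (j + 1) := by
  have hu : ∀ x ∈ window M, ∀ m ∈ window M, x ≠ m →
      ((x : ℂ) - m) • (invShift τ x * invShift τ m) = invShift τ m - invShift τ x := by
    intro x _ m _ _
    have h1 := add_intCast_ne_zero hτ x
    have h2 := add_intCast_ne_zero hτ m
    rw [smul_eq_mul, invShift, invShift]
    field_simp
    ring
  rw [windowSum, multiSum_eq_sum_poleSum (pairwise_window M) _ hu, Finset.sum_comm,
    ← sum_map_window]
  congr 1
  refine List.map_congr_left fun m hm => ?_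
  rw [poleSum_eq_sum _ _ _ _ _ hJ]
  refine Finset.sum_congr rfl fun j _ => ?_
  rw [poleCoeff_window hm, smul_eq_mul]

/-- Dominated convergence: for fixed m both ends M + m and M - m tend to infinity, and the
coefficients are bounded uniformly. -/
lemma tendsto_sum_windowCoeff (j : ℕ) {n : Index} (hn : ∀ k ∈ n, 2 ≤ k) {e : ℤ → ℂ}
    (he : Summable fun m => ‖e m‖) :
    Tendsto (fun M : ℕ => ∑ m ∈ Finset.Icc (-(M : ℤ)) M,
      windowCoeff j n ((M + m).toNat, (M - m).toNat) * e m) atTop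
      (nhds (blockCoeff zC j n * ∑' m, e m)) := by
  obtain ⟨h, B, hB⟩ := bddLim_windowCoeff j hn
  have h1 : Tendsto (fun M : ℕ => ∑' m : ℤ, (if m ∈ Finset.Icc (-(M : ℤ)) M then
      windowCoeff j n ((M + m).toNat, (M - m).toNat) * e m else 0)) atTop
      (nhds (∑' m, blockCoeff zC j n * e m)) := by
    refine tendsto_tsum_of_dominated_convergence (bound := fun m => B * ‖e m‖) (he.mul_left B)
      (fun m => ?_) (Eventually.of_forall fun M m => ?_)
    · have h2 : Tendsto (fun M : ℕ => ((M + m).toNat, (M - m).toNat)) atTop (atTop ×ˢ atTop) := by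
        refine Tendsto.prodMk ?_ ?_ <;>
        · refine tendsto_atTop_atTop.mpr fun b => ⟨b + m.natAbs, fun M hM => ?_⟩
          omega
      refine ((h.comp h2).mul_const (e m)).congr' ?_
      filter_upwards [eventually_ge_atTop m.natAbs] with M hM
      rw [if_pos (by rw [Finset.mem_Icc]; omega)]
      rfl
    · split_ifs
      · rw [norm_mul]
        exact mul_le_mul_of_nonneg_right (hB _) (norm_nonneg _)
      · rw [norm_zero]
        exact mul_nonneg ((norm_nonneg _).trans (hB (0, 0))) (norm_nonneg _)
  rw [tsum_mul_left] at h1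
  refine h1.congr fun M => ?_
  rw [tsum_eq_sum (s := Finset.Icc (-(M : ℤ)) M) fun m hm => if_neg hm]
  exact Finset.sum_congr rfl fun m hm => if_pos hm

/-- The combination of monotangent functions that equals the multitangent function. -/
noncomputable def multitangent (τ : ℂ) : Index → ℂ
  | [] => 1
  | i :: n => ∑ j ∈ Finset.range (indexWord (i :: n)).length,
      blockCoeff zC j (i :: n) * monotangent (j + 1) τ

lemma le_length_indexWord {n : Index} {a : ℕ+} (ha : a ∈ n) : (a : ℕ) ≤ (indexWord n).length := by
  rw [length_indexWord]
  exact List.single_le_sum (fun _ _ => Nat.zero_le _) _ (List.mem_map_of_mem ha)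

/-- At finite M the coefficient of the simple poles need not vanish, only its limit does. Passing to
differences in τ makes that part absolutely summable, so its contribution tends to zero. -/
lemma tendsto_windowSum_sub {τ τ' : ℂ} (hτ : 0 < τ.im) (hτ' : 0 < τ'.im) {n : Index}
    (hn : ∀ k ∈ n, 2 ≤ k) : Tendsto (fun M => windowSum τ M n - windowSum τ' M n) atTop
      (nhds (multitangent τ n - multitangent τ' n)) := by
  cases n with
  | nil => simp [windowSum, multitangent]
  | cons i n =>
    have hJ : ∀ a ∈ i :: n, (a : ℕ) ≤ (indexWord (i :: n)).length := fun a ha =>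
      le_length_indexWord ha
    simp only [windowSum_cons hτ _ i n hJ, windowSum_cons hτ' _ i n hJ, multitangent,
      ← Finset.sum_sub_distrib, ← mul_sub]
    refine tendsto_finsetSum _ fun j _ => ?_
    have h : blockCoeff zC j (i :: n) * ∑' m, (invShift τ m ^ (j + 1) - invShift τ' m ^ (j + 1)) =
        blockCoeff zC j (i :: n) * (monotangent (j + 1) τ - monotangent (j + 1) τ') := ?_
    · rw [← h]
      exact tendsto_sum_windowCoeff j hn (summable_invShift_pow_sub hτ hτ' j)
    rcases Nat.eq_zero_or_pos j with rfl | hj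
    · rw [blockCoeff_zero pathFamily_zC hn, zero_mul, zero_mul]
    · rw [monotangent, monotangent, Summable.tsum_sub (summable_invShift_pow τ (by omega)).of_norm
        (summable_invShift_pow τ' (by omega)).of_norm]

lemma norm_multiSum_le {ι α : Type} (φ : ι → α → ℂ) (L : List α) (n : List ι) :
    ‖multiSum φ L n‖ ≤ (n.map fun k => (L.map fun x => ‖φ k x‖).sum).prod := by
  have hnn : ∀ (L : List α) (k : ι), 0 ≤ (L.map fun x => ‖φ k x‖).sum := fun L k =>
    List.sum_nonneg fun a ha => by
      obtain ⟨x, _, rfl⟩ := List.mem_map.mp ha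
      exact norm_nonneg _
  have hpn : ∀ (L : List α) (n : List ι), 0 ≤ (n.map fun k => (L.map fun x => ‖φ k x‖).sum).prod :=
    fun L n => List.prod_nonneg fun a ha => by
      obtain ⟨k, _, rfl⟩ := List.mem_map.mp ha
      exact hnn L k
  have hmono : ∀ (x : α) (L : List α) (n : List ι),
      (n.map fun k => (L.map fun x => ‖φ k x‖).sum).prod ≤
        (n.map fun k => ((x :: L).map fun x => ‖φ k x‖).sum).prod := by
    intro x L n
    induction n with
    | nil => exact le_rfl
    | cons k n ih =>
      rw [List.map_cons, List.map_cons, List.prod_cons, List.prod_cons]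
      refine mul_le_mul ?_ ih (hpn L n) (hnn _ k)
      rw [List.map_cons, List.sum_cons]
      exact le_add_of_nonneg_left (norm_nonneg _)
  induction L generalizing n with
  | nil => cases n <;> simp [multiSum, unitFn]
  | cons x L ih =>
    cases n with
    | nil => simp
    | cons k n =>
      rw [multiSum_cons_cons, List.map_cons, List.prod_cons, List.map_cons, List.sum_cons, add_mul,
        add_comm]
      refine (norm_add_le _ _).trans (add_le_add ?_ ?_)
      · rw [norm_mul]
        exact mul_le_mul_of_nonneg_left ((ih n).trans (hmono x L n)) (norm_nonneg _)
      · refine (ih (k :: n)).trans ?_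
        rw [List.map_cons, List.prod_cons]
        exact mul_le_mul_of_nonneg_left (hmono x L n) (hnn L k)

lemma normSq_I_mul_add (y : ℝ) (m : ℤ) : ‖Complex.I * y + m‖ ^ 2 = y ^ 2 + m ^ 2 := by
  rw [← Complex.normSq_eq_norm_sq, Complex.normSq_apply]
  simp
  ring

lemma norm_invShift_sq_le {y : ℝ} (hy : 1 ≤ y) (m : ℤ) :
    ‖invShift (Complex.I * y) m ^ 2‖ ≤ ‖invShift Complex.I m ^ 2‖ := by
  have h1 := normSq_I_mul_add 1 m
  have h2 := normSq_I_mul_add y m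
  rw [Complex.ofReal_one, mul_one] at h1
  rw [invShift, invShift, inv_pow, inv_pow, norm_inv, norm_inv, norm_pow, norm_pow, h1, h2]
  have hm : 0 ≤ (m : ℝ) ^ 2 := sq_nonneg _
  exact inv_anti₀ (by nlinarith) (by nlinarith)

lemma norm_invShift_le_one {y : ℝ} (hy : 1 ≤ y) (m : ℤ) : ‖invShift (Complex.I * y) m‖ ≤ 1 := by
  rw [invShift, norm_inv]
  refine inv_le_one_of_one_le₀ ?_
  have h2 := normSq_I_mul_add y m
  have hm : 0 ≤ (m : ℝ) ^ 2 := sq_nonneg _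
  nlinarith [norm_nonneg (Complex.I * y + m)]

lemma norm_invShift_pow_le {y : ℝ} (hy : 1 ≤ y) (m : ℤ) {k : ℕ} (hk : 2 ≤ k) :
    ‖invShift (Complex.I * y) m ^ k‖ ≤ ‖invShift (Complex.I * y) m ^ 2‖ := by
  rw [norm_pow, norm_pow]
  exact pow_le_pow_of_le_one (norm_nonneg _) (norm_invShift_le_one hy m) hk

lemma tendsto_tsum_norm_invShift :
    Tendsto (fun y : ℝ => ∑' m : ℤ, ‖invShift (Complex.I * y) m ^ 2‖) atTop (nhds 0) := by
  have h : Tendsto (fun y : ℝ => ∑' m : ℤ, ‖invShift (Complex.I * y) m ^ 2‖) atTop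
      (nhds (∑' _ : ℤ, (0 : ℝ))) := by
    refine tendsto_tsum_of_dominated_convergence (summable_invShift_pow Complex.I le_rfl)
      (fun m => ?_) ?_
    · have h1 : Tendsto (fun y : ℝ => y ^ 2 + (m : ℝ) ^ 2) atTop atTop :=
        tendsto_atTop_add_const_right _ _ (tendsto_pow_atTop two_ne_zero)
      refine (tendsto_inv_atTop_zero.comp h1).congr fun y => ?_
      rw [Function.comp_apply, invShift, inv_pow, norm_inv, norm_pow, normSq_I_mul_add]
    · filter_upwards [eventually_ge_atTop 1] with y hy m
      rw [norm_norm]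
      exact norm_invShift_sq_le hy m
  rwa [tsum_zero] at h

/-- Dropping the order bounds the sum by a product over entries, each factor at most s ≤ 1; one
factor s is kept. The bound does not depend on `M`. -/
lemma norm_windowSum_le {y : ℝ} (hy : 1 ≤ y)
    (hs : ∑' m : ℤ, ‖invShift (Complex.I * y) m ^ 2‖ ≤ 1) (M : ℕ) {n : Index} (hne : n ≠ [])
    (hn : ∀ k ∈ n, 2 ≤ k) :
    ‖windowSum (Complex.I * y) M n‖ ≤ ∑' m : ℤ, ‖invShift (Complex.I * y) m ^ 2‖ := by
  set s := ∑' m : ℤ, ‖invShift (Complex.I * y) m ^ 2‖ with hsdef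
  have hs0 : 0 ≤ s := tsum_nonneg fun _ => norm_nonneg _
  have h1 : ∀ k ∈ n, ((window M).map fun m => ‖invShift (Complex.I * y) m ^ (k : ℕ)‖).sum ≤ s := by
    intro k hk
    rw [sum_map_window]
    have hk : 2 ≤ (k : ℕ) := hn k hk
    exact (Finset.sum_le_sum fun m _ => norm_invShift_pow_le hy m hk).trans
      ((summable_invShift_pow _ le_rfl).sum_le_tsum _ fun _ _ => norm_nonneg _)
  have h0 : ∀ k : ℕ+, 0 ≤ ((window M).map fun m => ‖invShift (Complex.I * y) m ^ (k : ℕ)‖).sum :=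
    fun k => by
      rw [sum_map_window]
      exact Finset.sum_nonneg fun _ _ => norm_nonneg _
  have h2 : ∀ u : Index, (∀ k ∈ u,
      ((window M).map fun m => ‖invShift (Complex.I * y) m ^ (k : ℕ)‖).sum ≤ s) → (u.map fun k : ℕ+ =>
        ((window M).map fun m => ‖invShift (Complex.I * y) m ^ (k : ℕ)‖).sum).prod ≤ 1 := by
    intro u hu
    induction u with
    | nil => exact le_rfl
    | cons k u ih =>
      rw [List.map_cons, List.prod_cons]
      exact mul_le_one₀ ((hu k (by simp)).trans hs) (List.prod_nonneg fun a ha => by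
        obtain ⟨k, _, rfl⟩ := List.mem_map.mp ha
        exact h0 k) (ih fun k hk => hu k (by simp [hk]))
  obtain ⟨i, n, rfl⟩ := List.exists_cons_of_ne_nil hne
  refine (norm_multiSum_le _ _ _).trans ?_
  rw [List.map_cons, List.prod_cons]
  calc _ ≤ s * 1 := by
        refine mul_le_mul (h1 i (by simp)) (h2 n fun k hk => h1 k (by simp [hk])) ?_ hs0
        refine List.prod_nonneg fun a ha => ?_
        obtain ⟨k, _, rfl⟩ := List.mem_map.mp ha
        exact h0 k
    _ = s := mul_one s

lemma tendsto_multitangent {n : Index} (hne : n ≠ []) (hn : ∀ k ∈ n, 2 ≤ k) :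
    Tendsto (fun y : ℝ => multitangent (Complex.I * y) n) atTop (nhds 0) := by
  obtain ⟨i, n, rfl⟩ := List.exists_cons_of_ne_nil hne
  have h : Tendsto (fun y : ℝ => multitangent (Complex.I * y) (i :: n)) atTop
      (nhds (∑ j ∈ Finset.range (indexWord (i :: n)).length, blockCoeff zC j (i :: n) * 0)) := by
    refine tendsto_finsetSum _ fun j _ => ?_
    rcases Nat.eq_zero_or_pos j with rfl | hj
    · simp only [blockCoeff_zero pathFamily_zC hn, zero_mul]
      exact tendsto_const_nhds
    · refine Tendsto.const_mul _ (squeeze_zero_norm' ?_ tendsto_tsum_norm_invShift)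
      filter_upwards [eventually_ge_atTop 1] with y hy
      exact (norm_tsum_le_tsum_norm (summable_invShift_pow _ (by omega))).trans
        ((summable_invShift_pow _ (by omega)).tsum_le_tsum
          (fun m => norm_invShift_pow_le hy m (by omega)) (summable_invShift_pow _ le_rfl))
  simpa using h

/-- Reduction of multitangent functions to monotangent functions. -/
theorem tendsto_windowSum {τ : ℂ} (hτ : 0 < τ.im) {n : Index} (hn : ∀ k ∈ n, 2 ≤ k) :
    Tendsto (fun M => windowSum τ M n) atTop (nhds (multitangent τ n)) := by
  rcases eq_or_ne n [] with rfl | hne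
  · simp [windowSum, multitangent]
  · rw [Metric.tendsto_atTop]
    intro ε hε
    -- The comparison point iy is taken so high that both the window sums, uniformly in M, and the
    -- multitangent value are below ε/3. The bound by 1 is the hypothesis of `norm_windowSum_le`.
    have e1 := tendsto_tsum_norm_invShift.eventually_lt_const (lt_min one_pos (div_pos hε three_pos))
    have e2 := (Metric.tendsto_nhds.mp (tendsto_multitangent hne hn)) (ε / 3) (div_pos hε three_pos)
    obtain ⟨y, ⟨h1, h2⟩, hy⟩ := ((e1.and e2).and (eventually_ge_atTop 1)).exists
    rw [lt_min_iff] at h1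
    have hy' : 0 < (Complex.I * y).im := by simp; linarith
    obtain ⟨N, hN⟩ := Metric.tendsto_atTop.mp (tendsto_windowSum_sub hτ hy' hn) (ε / 3)
      (div_pos hε three_pos)
    refine ⟨N, fun M hM => ?_⟩
    have h3 := hN M hM
    have h4 := norm_windowSum_le hy h1.1.le M hne hn
    rw [dist_eq_norm] at h2 h3 ⊢
    rw [sub_zero] at h2
    have h5 : windowSum τ M n - multitangent τ n =
        (windowSum τ M n - windowSum (Complex.I * y) M n -
          (multitangent τ n - multitangent (Complex.I * y) n)) +
        windowSum (Complex.I * y) M n - multitangent (Complex.I * y) n := by ring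
    rw [h5]
    refine (norm_sub_le _ _).trans_lt ?_
    have := norm_add_le (windowSum τ M n - windowSum (Complex.I * y) M n -
          (multitangent τ n - multitangent (Complex.I * y) n)) (windowSum (Complex.I * y) M n)
    linarith [h1.2]

end Multitangent

end MES

namespace MES

/-! ### Characters of the harmonic algebra -/

section Harmonic

/-- The linear extension of `f`, evaluated at the harmonic product of two words. -/
def harmonicSum {M : Type} [AddCommMonoid M] (f : Index → M) : Index → Index → M
  | [], v => f v
  | m :: u, [] => f (m :: u)
  | m :: u, n :: v => harmonicSum (fun w => f (m :: w)) u (n :: v) +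
      harmonicSum (fun w => f (n :: w)) (m :: u) v + harmonicSum (fun w => f ((m + n) :: w)) u v
termination_by u v => u.length + v.length

variable {M N R : Type} [AddCommMonoid M] [AddCommMonoid N] [CommRing R]

lemma harmonicSum_nil_left (f : Index → M) (v : Index) : harmonicSum f [] v = f v := by
  rw [harmonicSum]

lemma harmonicSum_nil_right (f : Index → M) (u : Index) : harmonicSum f u [] = f u := by
  cases u <;> rw [harmonicSum]

lemma harmonicSum_cons (f : Index → M) (m n : ℕ+) (u v : Index) :
    harmonicSum f (m :: u) (n :: v) = harmonicSum (fun w => f (m :: w)) u (n :: v) +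
      harmonicSum (fun w => f (n :: w)) (m :: u) v +
      harmonicSum (fun w => f ((m + n) :: w)) u v := by
  rw [harmonicSum]

lemma linearCombination_prepend {A : Type} [AddCommGroup A] [Module ℚ A] (f : Index → A) (m : ℕ+)
    (x : Index →₀ ℚ) : Finsupp.linearCombination ℚ f (prepend m x) =
      Finsupp.linearCombination ℚ (fun w => f (m :: w)) x := by
  rw [prepend, Finsupp.lmapDomain_apply, Finsupp.linearCombination_mapDomain]
  rfl

lemma harmonic_sum {A : Type} [AddCommGroup A] [Module ℚ A] (f : Index → A) (u v : Index) :
    (harmonic u v).sum (fun w c => c • f w) = harmonicSum f u v := by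
  rw [← Finsupp.linearCombination_apply]
  induction hl : u.length + v.length using Nat.strong_induction_on generalizing u v f with
  | _ l ih =>
    match u, v with
    | [], v => rw [harmonic, harmonicSum, Finsupp.linearCombination_single, one_smul]
    | m :: u, [] => rw [harmonic, harmonicSum, Finsupp.linearCombination_single, one_smul]
    | m :: u, n :: v =>
      simp only [List.length_cons] at hl
      rw [harmonic, harmonicSum, map_add, map_add, linearCombination_prepend,
        linearCombination_prepend, linearCombination_prepend,
        ih _ (by simp; omega) _ u (n :: v) rfl, ih _ (by simp; omega) _ (m :: u) v rfl,
        ih _ (by omega) _ u v rfl]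

/-- A relation compatible with addition passes to harmonic products. -/
lemma harmonicSum_rel {P : M → N → Prop}
    (hP : ∀ {a b c d}, P a b → P c d → P (a + c) (b + d)) {f : Index → M} {g : Index → N}
    (h : ∀ w : Index, (∀ k ∈ w, 2 ≤ k) → P (f w) (g w)) {u v : Index} (hu : ∀ k ∈ u, 2 ≤ k)
    (hv : ∀ k ∈ v, 2 ≤ k) : P (harmonicSum f u v) (harmonicSum g u v) := by
  induction hl : u.length + v.length using Nat.strong_induction_on generalizing u v f g with
  | _ l ih =>
    match u, v with
    | [], v => rw [harmonicSum_nil_left, harmonicSum_nil_left]; exact h v hv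
    | m :: u, [] => rw [harmonicSum_nil_right, harmonicSum_nil_right]; exact h _ hu
    | m :: u, n :: v =>
      simp only [List.length_cons] at hl
      have hm : 2 ≤ m := hu m (by simp)
      have hn : 2 ≤ n := hv n (by simp)
      have hu' : ∀ k ∈ u, 2 ≤ k := fun k hk => hu k (by simp [hk])
      have hv' : ∀ k ∈ v, 2 ≤ k := fun k hk => hv k (by simp [hk])
      have hc : ∀ a : ℕ+, 2 ≤ a → ∀ w : Index, (∀ k ∈ w, 2 ≤ k) → P (f (a :: w)) (g (a :: w)) :=
        fun a ha w hw => h _ fun k hk => by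
          rcases List.mem_cons.mp hk with rfl | hk
          · exact ha
          · exact hw k hk
      rw [harmonicSum_cons, harmonicSum_cons]
      exact hP (hP (ih _ (by simp; omega) (hc m hm) hu' hv rfl)
        (ih _ (by simp; omega) (hc n hn) hu hv' rfl))
        (ih _ (by omega) (hc (m + n) (hm.trans (PNat.lt_add_right m n).le)) hu' hv' rfl)

lemma harmonicSum_congr {f g : Index → M} (h : ∀ w : Index, (∀ k ∈ w, 2 ≤ k) → f w = g w)
    {u v : Index} (hu : ∀ k ∈ u, 2 ≤ k) (hv : ∀ k ∈ v, 2 ≤ k) :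
    harmonicSum f u v = harmonicSum g u v :=
  harmonicSum_rel (P := Eq) (fun h1 h2 => by rw [h1, h2]) h hu hv

lemma map_harmonicSum (l : M →+ N) (f : Index → M) (u v : Index) :
    l (harmonicSum f u v) = harmonicSum (fun w => l (f w)) u v := by
  induction hl : u.length + v.length using Nat.strong_induction_on generalizing u v f with
  | _ k ih =>
    match u, v with
    | [], v => rw [harmonicSum_nil_left, harmonicSum_nil_left]
    | m :: u, [] => rw [harmonicSum_nil_right, harmonicSum_nil_right]
    | m :: u, n :: v =>
      simp only [List.length_cons] at hl
      rw [harmonicSum_cons, harmonicSum_cons, map_add, map_add, ih _ (by simp; omega) _ _ _ rfl,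
        ih _ (by simp; omega) _ _ _ rfl, ih _ (by omega) _ _ _ rfl]

lemma harmonicSum_add (f g : Index → M) (u v : Index) :
    harmonicSum (fun w => f w + g w) u v = harmonicSum f u v + harmonicSum g u v := by
  induction hl : u.length + v.length using Nat.strong_induction_on generalizing u v f g with
  | _ k ih =>
    match u, v with
    | [], v => simp only [harmonicSum_nil_left]
    | m :: u, [] => simp only [harmonicSum_nil_right]
    | m :: u, n :: v =>
      simp only [List.length_cons] at hl
      rw [harmonicSum_cons, harmonicSum_cons, harmonicSum_cons, ih _ (by simp; omega) _ _ _ _ rfl,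
        ih _ (by simp; omega) _ _ _ _ rfl, ih _ (by omega) _ _ _ _ rfl]
      abel

lemma harmonicSum_mul (c : R) (f : Index → R) (u v : Index) :
    harmonicSum (fun w => c * f w) u v = c * harmonicSum f u v :=
  (map_harmonicSum (AddMonoidHom.mulLeft c) f u v).symm

/-- Deconcatenation is compatible with the harmonic product. -/
lemma harmonicSum_conv (f g : Index → R) (u v : Index) : harmonicSum (conv f g) u v =
    lcut (fun u' u'' => lcut (fun v' v'' => harmonicSum f u' v' * harmonicSum g u'' v'') v) u := by
  induction hl : u.length + v.length using Nat.strong_induction_on generalizing u v f with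
  | _ k ih =>
    match u, v with
    | [], v => simp only [harmonicSum_nil_left, lcut_nil]; rfl
    | m :: u, [] => simp only [harmonicSum_nil_right, lcut_nil]; rfl
    | m :: u, n :: v =>
      simp only [List.length_cons] at hl
      have h1 := ih _ (by simp; omega) (fun w => f (m :: w)) u (n :: v) rfl
      have h2 := ih _ (by simp; omega) (fun w => f (n :: w)) (m :: u) v rfl
      have h3 := ih _ (by omega) (fun w => f ((m + n) :: w)) u v rfl
      rw [harmonicSum_cons]
      simp only [conv_cons, harmonicSum_add, harmonicSum_mul, h1, h2, h3]
      simp only [lcut_cons, lcut_add, harmonicSum_nil_left, harmonicSum_nil_right, harmonicSum_cons,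
        add_mul, mul_add]
      abel

/-- A character of the harmonic algebra on the indices with entries at least `2`. -/
structure HarmonicChar (f : Index → R) : Prop where
  nil : f [] = 1
  mul : ∀ {u v : Index}, (∀ k ∈ u, 2 ≤ k) → (∀ k ∈ v, 2 ≤ k) → harmonicSum f u v = f u * f v

lemma HarmonicChar.congr {f g : Index → R} (hf : HarmonicChar f)
    (h : ∀ w : Index, (∀ k ∈ w, 2 ≤ k) → g w = f w) : HarmonicChar g where
  nil := by rw [h [] (by simp), hf.nil]
  mul hu hv := by rw [harmonicSum_congr h hu hv, hf.mul hu hv, h _ hu, h _ hv]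

lemma HarmonicChar.map {S : Type} [CommRing S] {f : Index → R} (hf : HarmonicChar f) (π : R →+* S) :
    HarmonicChar fun w => π (f w) where
  nil := by rw [hf.nil, map_one]
  mul hu hv := by
    rw [← map_mul, ← hf.mul hu hv]
    exact (map_harmonicSum π.toAddMonoidHom f _ _).symm

lemma HarmonicChar.conv {f g : Index → R} (hf : HarmonicChar f) (hg : HarmonicChar g) :
    HarmonicChar (MES.conv f g) where
  nil := by rw [conv_nil, hf.nil, hg.nil, one_mul]
  mul {u v} hu hv := by
    rw [harmonicSum_conv, conv_mul_conv]
    refine lcut_congr fun u' u'' hu' => lcut_congr fun v' v'' hv' => ?_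
    subst hu' hv'
    rw [hf.mul (fun k hk => hu k (by simp [hk])) (fun k hk => hv k (by simp [hk])),
      hg.mul (fun k hk => hu k (by simp [hk])) (fun k hk => hv k (by simp [hk])), mul_mul_mul_comm]

lemma harmonicSum_unitFn (u v : Index) :
    harmonicSum (unitFn : Index → R) u v = unitFn u * unitFn v := by
  have hz : ∀ u v : Index, harmonicSum (fun _ => (0 : R)) u v = 0 := fun u v =>
    (map_harmonicSum (0 : R →+ R) (fun _ => 0) u v).symm
  match u, v with
  | [], v => rw [harmonicSum_nil_left]; simp [unitFn]
  | m :: u, [] => rw [harmonicSum_nil_right]; simp [unitFn]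
  | m :: u, n :: v => rw [harmonicSum_cons]; simp [unitFn, hz]

lemma harmonicChar_unitFn : HarmonicChar (unitFn : Index → R) :=
  ⟨rfl, fun _ _ => harmonicSum_unitFn _ _⟩

/-- With a single point available, a product of two one-letter words is seen only through the merged
letter, and merging adds exponents. -/
lemma harmonicChar_pointFn {X : Type} {φ : ℕ+ → X → R} {x : X}
    (h : ∀ i j, φ (i + j) x = φ i x * φ j x) : HarmonicChar (pointFn φ x) where
  nil := rfl
  mul {u v} _ _ := by
    match u, v with
    | [], v => rw [harmonicSum_nil_left]; simp [pointFn]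
    | m :: u, [] => rw [harmonicSum_nil_right]; simp [pointFn]
    | m :: u, n :: v =>
      rw [harmonicSum_cons]
      simp only [pointFn, harmonicSum_mul, h]
      have e := @harmonicSum_unitFn R _
      rw [e, e, e]
      simp only [unitFn]
      ring

lemma harmonicChar_foldr {X : Type} {W : X → Index → R} {L : List X}
    (h : ∀ x ∈ L, HarmonicChar (W x)) :
    HarmonicChar (L.foldr (fun x f => conv (W x) f) unitFn) := by
  induction L with
  | nil => exact harmonicChar_unitFn
  | cons x L ih => exact (h x (by simp)).conv (ih fun y hy => h y (by simp [hy]))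

lemma harmonicChar_multiSum {X : Type} {φ : ℕ+ → X → R} (L : List X)
    (h : ∀ x ∈ L, ∀ i j, φ (i + j) x = φ i x * φ j x) : HarmonicChar (multiSum φ L) := by
  induction L with
  | nil => exact harmonicChar_unitFn
  | cons x L ih =>
    exact (harmonicChar_pointFn (h x (by simp))).conv (ih fun y hy => h y (by simp [hy]))

/-- A harmonic product is a finite sum over indices with entries at least 2, so pointwise limits on
such indices preserve the product rule. -/
lemma harmonicChar_of_tendsto {F : ℕ → Index → ℂ} {f : Index → ℂ} (hF : ∀ N, HarmonicChar (F N))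
    (h : ∀ w : Index, (∀ k ∈ w, 2 ≤ k) →
      Filter.Tendsto (fun N => F N w) Filter.atTop (nhds (f w))) : HarmonicChar f where
  nil := by
    have h1 := h [] (by simp)
    simp only [(hF _).nil] at h1
    exact tendsto_nhds_unique h1 tendsto_const_nhds
  mul {u v} hu hv := by
    have h1 := harmonicSum_rel (P := fun (a : ℕ → ℂ) (b : ℂ) =>
      Filter.Tendsto a Filter.atTop (nhds b)) (fun h1 h2 => h1.add h2) h hu hv
    have h2 : ∀ N, harmonicSum (fun w N => F N w) u v N = F N u * F N v := fun N => by
      rw [← (hF N).mul hu hv]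
      exact map_harmonicSum (Pi.evalAddMonoidHom (fun _ : ℕ => ℂ) N) (fun w N => F N w) u v
    exact tendsto_nhds_unique (h1.congr h2) ((h u hu).mul (h v hv))

lemma harmonicChar_zetaWord : HarmonicChar fun n => zetaWord (indexWord n) := by
  refine harmonicChar_of_tendsto (F := fun N n =>
    PowerSeries.constantCoeff (multiSum hurwitzFn (List.range' 1 N) n)) (fun N => ?_) fun w hw => ?_
  · refine (harmonicChar_multiSum _ fun m _ i j => ?_).map _
    rw [hurwitzFn, hurwitzFn, hurwitzFn, PNat.add_coe, pow_add]
  · refine (tendsto_coeff_multiSum_hurwitzFn 0 hw).congr fun N => ?_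
    rw [PowerSeries.coeff_zero_eq_constantCoeff_apply]

lemma harmonicChar_multitangent {τ : ℂ} (hτ : 0 < τ.im) : HarmonicChar (multitangent τ) := by
  refine harmonicChar_of_tendsto (F := windowSum τ) (fun M => ?_) fun w hw => tendsto_windowSum hτ hw
  refine harmonicChar_multiSum _ fun m _ i j => ?_
  rw [PNat.add_coe, pow_add]

end Harmonic

end MES

namespace MES

/-! ### Evaluation of power series -/

section Evaluation

open PowerSeries Filter

/-- The power series `f` converges absolutely at `q`, with value `v`. -/
def EvalsTo (q : ℂ) (f : ℂ⟦X⟧) (v : ℂ) : Prop :=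
  (Summable fun n => ‖coeff n f * q ^ n‖) ∧ ∑' n, coeff n f * q ^ n = v

lemma EvalsTo.add {q : ℂ} {f g : ℂ⟦X⟧} {v w : ℂ} (hf : EvalsTo q f v) (hg : EvalsTo q g w) :
    EvalsTo q (f + g) (v + w) := by
  obtain ⟨hf, rfl⟩ := hf
  obtain ⟨hg, rfl⟩ := hg
  refine ⟨Summable.of_nonneg_of_le (fun _ => norm_nonneg _) (fun n => ?_) (hf.add hg), ?_⟩
  · rw [map_add, add_mul]
    exact norm_add_le _ _
  · rw [← Summable.tsum_add hf.of_norm hg.of_norm]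
    simp only [map_add, add_mul]

lemma EvalsTo.C_mul {q : ℂ} {f : ℂ⟦X⟧} {v : ℂ} (c : ℂ) (hf : EvalsTo q f v) :
    EvalsTo q (C c * f) (c * v) := by
  obtain ⟨hf, rfl⟩ := hf
  constructor
  · simp only [coeff_C_mul, mul_assoc, norm_mul c]
    exact hf.mul_left _
  · simp only [coeff_C_mul, mul_assoc]
    exact tsum_mul_left

lemma EvalsTo.mul {q : ℂ} {f g : ℂ⟦X⟧} {v w : ℂ} (hf : EvalsTo q f v) (hg : EvalsTo q g w) :
    EvalsTo q (f * g) (v * w) := by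
  have h : ∀ n, coeff n (f * g) * q ^ n = ∑ p ∈ Finset.HasAntidiagonal.antidiagonal n,
      coeff p.1 f * q ^ p.1 * (coeff p.2 g * q ^ p.2) := fun n => by
    rw [coeff_mul, Finset.sum_mul]
    refine Finset.sum_congr rfl fun p hp => ?_
    rw [show q ^ n = q ^ p.1 * q ^ p.2 by
      rw [← pow_add, Finset.HasAntidiagonal.mem_antidiagonal.mp hp]]
    exact mul_mul_mul_comm _ _ _ _
  constructor
  · exact (summable_norm_sum_mul_antidiagonal_of_summable_norm hf.1 hg.1).congr fun n => by rw [h]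
  · rw [← hf.2, ← hg.2, tsum_mul_tsum_eq_tsum_sum_antidiagonal_of_summable_norm hf.1 hg.1]
    exact tsum_congr h

lemma evalsTo_zero (q : ℂ) : EvalsTo q 0 0 := by
  constructor <;> simp [summable_zero]

lemma evalsTo_one (q : ℂ) : EvalsTo q 1 1 := by
  have h : ∀ n, n ≠ 0 → coeff n (1 : ℂ⟦X⟧) * q ^ n = 0 := fun n hn => by
    rw [coeff_one, if_neg hn, zero_mul]
  refine ⟨summable_of_ne_finset_zero (s := {0}) fun n hn => ?_, ?_⟩
  · rw [h n (by simpa using hn), norm_zero]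
  · rw [tsum_eq_single 0 h]
    simp

lemma EvalsTo.sum {ι : Type} {s : Finset ι} {q : ℂ} {f : ι → ℂ⟦X⟧} {v : ι → ℂ}
    (h : ∀ i ∈ s, EvalsTo q (f i) (v i)) : EvalsTo q (∑ i ∈ s, f i) (∑ i ∈ s, v i) := by
  classical
  induction s using Finset.induction_on with
  | empty => exact evalsTo_zero q
  | insert i s hi ih =>
    rw [Finset.sum_insert hi, Finset.sum_insert hi]
    exact (h i (by simp)).add (ih fun j hj => h j (by simp [hj]))

/-! ### Evaluation at the nome -/

/-- The parameter `q = e^{2πiτ}`. -/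
noncomputable def nome (τ : ℂ) : ℂ := Complex.exp (2 * Real.pi * Complex.I * τ)

lemma norm_nome (τ : ℂ) : ‖nome τ‖ = Real.exp (-(2 * Real.pi * τ.im)) := by
  rw [nome, Complex.norm_exp]
  simp

lemma nome_ne_zero (τ : ℂ) : nome τ ≠ 0 := Complex.exp_ne_zero _

lemma norm_nome_lt_one {τ : ℂ} (hτ : 0 < τ.im) : ‖nome τ‖ < 1 := by
  rw [norm_nome, Real.exp_lt_one_iff]
  have := Real.pi_pos
  nlinarith [mul_pos this hτ]

lemma nome_pow (τ : ℂ) (l : ℕ) : nome τ ^ l = nome (l * τ) := by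
  rw [nome, ← Complex.exp_nat_mul, nome]
  congr 1
  ring

lemma tendsto_nome : Tendsto (fun y : ℝ => nome (Complex.I * y)) atTop (nhds 0) := by
  rw [tendsto_zero_iff_norm_tendsto_zero]
  simp only [norm_nome]
  refine Real.tendsto_exp_atBot.comp (tendsto_neg_atTop_atBot.comp ?_)
  simp only [Complex.mul_im, Complex.I_re, Complex.I_im, Complex.ofReal_im, Complex.ofReal_re,
    zero_mul, one_mul, zero_add]
  exact tendsto_id.const_mul_atTop (by positivity)

/-- A power series whose values vanish is zero. -/
lemma eq_zero_of_evalsTo {f : ℂ⟦X⟧} (h : ∀ τ : ℂ, 0 < τ.im → EvalsTo (nome τ) f 0) : f = 0 := by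
  ext k
  rw [map_zero]
  -- With the lower coefficients zero, dividing by q^k leaves a series with constant term the k-th
  -- coefficient. All its values vanish, and τ = iy with y → ∞ sends q to 0.
  induction k using Nat.strong_induction_on with
  | _ k ih =>
    have him : ∀ y : ℝ, 1 ≤ y → 0 < (Complex.I * y).im := fun y hy => by simp; linarith
    have hshift : ∀ τ : ℂ, (fun n => coeff (n + k) f * nome τ ^ n) =
        fun n => (nome τ ^ k)⁻¹ * (coeff (n + k) f * nome τ ^ (n + k)) := fun τ => by
      funext n
      have := pow_ne_zero k (nome_ne_zero τ)
      rw [pow_add]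
      field_simp
    have hsum : ∀ τ : ℂ, 0 < τ.im → ∑' n, coeff (n + k) f * nome τ ^ n = 0 := fun τ hτ => by
      obtain ⟨h1, h2⟩ := h τ hτ
      rw [← h1.of_norm.sum_add_tsum_nat_add k, Finset.sum_eq_zero, zero_add] at h2
      · rw [hshift, tsum_mul_left, h2, mul_zero]
      · intro i hi
        rw [ih i (Finset.mem_range.mp hi), zero_mul]
    have hbound : Summable fun n => ‖coeff (n + k) f * nome (Complex.I * (1 : ℝ)) ^ n‖ := by
      have h1 := ((summable_nat_add_iff k).mpr (h _ (him 1 le_rfl)).1).mul_left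
        ‖(nome (Complex.I * (1 : ℝ)) ^ k)⁻¹‖
      simp only [← norm_mul] at h1
      rw [show (fun n => ‖coeff (n + k) f * nome (Complex.I * (1 : ℝ)) ^ n‖) =
        fun n => ‖(fun n => coeff (n + k) f * nome (Complex.I * (1 : ℝ)) ^ n) n‖ from rfl, hshift]
      exact h1
    have hlim : Tendsto (fun y : ℝ => ∑' n, coeff (n + k) f * nome (Complex.I * y) ^ n) atTop
        (nhds (∑' n, coeff (n + k) f * 0 ^ n)) := by
      refine tendsto_tsum_of_dominated_convergence hbound
        (fun n => (tendsto_nome.pow n).const_mul _) ?_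
      filter_upwards [eventually_ge_atTop 1] with y hy n
      rw [norm_mul, norm_mul, norm_pow, norm_pow, norm_nome, norm_nome]
      refine mul_le_mul_of_nonneg_left (pow_le_pow_left₀ (Real.exp_pos _).le ?_ n) (norm_nonneg _)
      rw [Real.exp_le_exp]
      have := Real.pi_pos
      simp
      nlinarith
    rw [tsum_eq_single 0 fun n hn => by rw [zero_pow hn, mul_zero], pow_zero, mul_one,
      zero_add] at hlim
    refine tendsto_nhds_unique hlim (tendsto_const_nhds.congr' ?_)
    filter_upwards [eventually_ge_atTop 1] with y hy
    exact (hsum _ (him y hy)).symm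

/-- The power series `(-2πi)^k / (k-1)! ∑ d^{k-1} q^{ld}`. -/
noncomputable def eisFn (k : ℕ+) (l : ℕ) : ℂ⟦X⟧ :=
  algebraMap ℂ ℂ⟦X⟧ (-2 * (Real.pi : ℂ) * Complex.I) ^ (k : ℕ) *
    PowerSeries.map (algebraMap ℚ ℂ) (divisorSeries k l)

/-- The Lipschitz formula. -/
lemma evalsTo_eisFn {k : ℕ+} (hk : 2 ≤ k) {l : ℕ} (hl : 0 < l) {τ : ℂ} (hτ : 0 < τ.im) :
    EvalsTo (nome τ) (eisFn k l) (monotangent k (l * τ)) := by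
  have hlτ : 0 < ((l : ℂ) * τ).im := by
    simp only [Complex.mul_im, Complex.natCast_re, Complex.natCast_im, zero_mul, add_zero]
    positivity
  have hinj : Function.Injective fun d : ℕ => l * d := fun a b h => Nat.eq_of_mul_eq_mul_left hl h
  set c : ℂ := (-2 * (Real.pi : ℂ) * Complex.I) ^ (k : ℕ) / (k.natPred.factorial : ℂ) with hc
  have hzero : ∀ n ∉ Set.range fun d : ℕ => l * d, coeff n (eisFn k l) * nome τ ^ n = 0 := by
    intro n hn
    have : ¬ l ∣ n := fun ⟨d, hd⟩ => hn ⟨d, hd.symm⟩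
    rw [eisFn, ← map_pow]
    rw [PowerSeries.algebraMap_apply, coeff_C_mul, coeff_map, divisorSeries, coeff_mk, if_neg this,
      map_zero, mul_zero, zero_mul]
  have hval : ∀ d : ℕ, coeff (l * d) (eisFn k l) * nome τ ^ (l * d) =
      c * ((d : ℂ) ^ k.natPred * nome (l * τ) ^ d) := fun d => by
    rw [eisFn, ← map_pow, PowerSeries.algebraMap_apply, Algebra.algebraMap_self_apply, coeff_C_mul, coeff_map,
      divisorSeries, coeff_mk, if_pos (dvd_mul_right l d), Nat.mul_div_cancel_left d hl, pow_mul,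
      nome_pow, hc]
    simp
    ring
  have hs := summable_norm_pow_mul_geometric_of_norm_lt_one k.natPred (norm_nome_lt_one hlτ)
  constructor
  · rw [← hinj.summable_iff fun n hn => by rw [hzero n hn, norm_zero]]
    refine (hs.mul_left ‖c‖).congr fun d => ?_
    rw [Function.comp_apply, hval, norm_mul c]
  · rw [← hinj.tsum_eq (f := fun n => coeff n (eisFn k l) * nome τ ^ n) fun n hn => by
      by_contra h
      exact hn (hzero n h)]
    simp only [hval]
    -- The expansion concerns exponent j + 1 with j ≥ 1; here j = k - 1 and the point is lτ.
    have h1 := EisensteinSeries.qExpansion_identity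
      (Nat.one_le_iff_ne_zero.mpr (natPred_ne_zero hk)) ⟨l * τ, hlτ⟩
    rw [k.natPred_add_one] at h1
    rw [tsum_mul_left, hc, nome]
    refine h1.symm.trans (tsum_congr fun m => ?_)
    rw [invShift, inv_pow, one_div]

end Evaluation

end MES

namespace MES

/-! ### The harmonic product of regularised multiple Eisenstein series -/

section HarmonicProduct

open PowerSeries

lemma zFam_eq (a b : Fin 2) (w : Word) : zFam a b w = C (zC a b w) := by
  rw [zFam, zC, IsScalarTower.algebraMap_apply ℝ ℂ ℂ⟦X⟧, PowerSeries.algebraMap_apply]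
  rfl

lemma map_zeroShift {R S : Type} [CommRing R] [CommRing S] (π : R →+* S) (g : Word → R) (j : ℕ)
    (w : Word) : π (zeroShift g j w) = zeroShift (fun v => π (g v)) j w := by
  induction j generalizing w with
  | zero => rfl
  | succ j ih =>
    rw [zeroShift, zeroShift, map_conv]
    refine conv_congr fun u v _ => ⟨?_, ih v⟩
    unfold letterFn
    split_ifs <;> simp

lemma map_blockCoeff {R S : Type} [CommRing R] [CommRing S] (π : R →+* S)
    (z : Fin 2 → Fin 2 → Word → R) (j : ℕ) (n : Index) :
    π (blockCoeff z j n) = blockCoeff (fun a b w => π (z a b w)) j n := by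
  cases n with
  | nil => exact map_zero π
  | cons b n =>
    rw [blockCoeff, blockCoeff, tailFn, tailFn, tauFn, tauFn, map_conv]
    exact conv_congr fun u v _ => ⟨rfl, map_zeroShift π _ j v⟩

lemma map_blockGen {R S X : Type} [CommRing R] [CommRing S] (π : R →+* S)
    (z : Fin 2 → Fin 2 → Word → R) (φ : ℕ+ → X → R) (x : X) (n : Index) :
    π (blockGen z φ x n) = blockGen (fun a b w => π (z a b w)) (fun k x => π (φ k x)) x n := by
  cases n with
  | nil => exact map_one π
  | cons b n => simp only [blockGen, map_sum, map_mul, map_blockCoeff]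

/-- The term j = 0 has coefficient zero, so the Lipschitz formula is used only for exponents at
least 2, where it holds. -/
lemma evalsTo_blockGen {l : ℕ} (hl : 0 < l) {τ : ℂ} (hτ : 0 < τ.im) {n : Index}
    (hn : ∀ k ∈ n, 2 ≤ k) :
    EvalsTo (nome τ) (blockGen zFam eisFn l n) (multitangent (l * τ) n) := by
  cases n with
  | nil => exact evalsTo_one _
  | cons b n =>
    refine EvalsTo.sum fun j _ => ?_
    have h : blockCoeff zFam j (b :: n) = C (blockCoeff zC j (b :: n)) := by
      rw [map_blockCoeff]
      congr 1
      funext a b w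
      exact zFam_eq a b w
    rw [h]
    rcases Nat.eq_zero_or_pos j with rfl | hj
    · rw [blockCoeff_zero pathFamily_zC hn, map_zero, zero_mul, zero_mul]
      exact evalsTo_zero _
    · exact (evalsTo_eisFn (two_le_succPNat hj.ne') hl hτ).C_mul _

/-- The product rule holds for the values at every τ in the upper half-plane, by the rule for
multitangent functions at lτ; a convergent q-series with vanishing values is zero. -/
lemma harmonicChar_blockGen {l : ℕ} (hl : 0 < l) : HarmonicChar (blockGen zFam eisFn l) where
  nil := rfl
  mul {u v} hu hv := by
    rw [← sub_eq_zero]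
    refine eq_zero_of_evalsTo fun τ hτ => ?_
    have hlτ : 0 < ((l : ℂ) * τ).im := by
      simp only [Complex.mul_im, Complex.natCast_re, Complex.natCast_im, zero_mul, add_zero]
      positivity
    have h1 := harmonicSum_rel (P := EvalsTo (nome τ)) EvalsTo.add
      (fun w hw => evalsTo_blockGen hl hτ hw) hu hv
    have h2 := (evalsTo_blockGen hl hτ hu).mul (evalsTo_blockGen hl hτ hv)
    rw [(harmonicChar_multitangent hlτ).mul hu hv] at h1
    have h3 := h1.add (h2.C_mul (-1))
    rw [map_neg, map_one, neg_one_mul, neg_one_mul, add_neg_cancel, ← sub_eq_add_neg] at h3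
    exact h3

/-- The factor (-2πi)^{weight} is distributed over the entries, which turns each divisor series into
the series of the Lipschitz formula. -/
lemma map_gFam {A : Type} [CommRing A] (π : ℂ⟦X⟧ →+* A) {N : ℕ} (hπ : π X ^ (N + 1) = 0) {n : Index}
    (hn : ∀ k ∈ n, 2 ≤ k) :
    π (gFam (indexWord n)) = multiSum (fun k l => π (eisFn k l)) (List.range' 1 N) n := by
  have h1 : gFam (indexWord n) = gChar (indexWord n) := by
    rw [← gSh_eq]
    change gMap (regIdx n) = _
    rw [← regBasis_apply, gMap, Module.Basis.constr_basis]
  have h2 := map_qCharLim (π := π.comp (PowerSeries.map (algebraMap ℚ ℂ))) (N := N)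
    (by rw [RingHom.comp_apply, PowerSeries.map_X, hπ]) hn
  rw [RingHom.comp_apply] at h2
  have h3 : ∀ (c : A) (n : Index), c ^ (indexWord n).length = (n.map fun k : ℕ+ => c ^ (k : ℕ)).prod := by
    intro c n
    rw [length_indexWord]
    induction n with
    | nil => exact pow_zero c
    | cons k n ih => rw [List.map_cons, List.sum_cons, pow_add, ih, List.map_cons, List.prod_cons]
  rw [h1, gChar, map_mul, map_pow, h2, h3, ← multiSum_smul]
  refine multiSum_congr fun k _ l _ => ?_
  rw [eisFn, map_mul π (_ ^ _), map_pow π]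
  rfl

/-- Modulo q^{N+1} the Eisenstein series is the convolution of ζ with the block functions for l = 1,
…, N, each of them a harmonic character. -/
lemma harmonicChar_map_eisChar {A : Type} [CommRing A] (π : ℂ⟦X⟧ →+* A) {N : ℕ}
    (hπ : π X ^ (N + 1) = 0) : HarmonicChar fun n => π (eisChar (indexWord n)) := by
  have h1 : HarmonicChar fun n => π (zFam 0 1 (indexWord n)) := by
    simp only [zFam_eq]
    exact harmonicChar_zetaWord.map (π.comp C)
  refine (h1.conv (harmonicChar_foldr (W := fun l n => π (blockGen zFam eisFn l n))
    (L := List.range' 1 N) fun l hl => (harmonicChar_blockGen ?_).map π)).congr fun n hn => ?_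
  · simp only [List.mem_range'_1] at hl
    omega
  · have hz := pathFamily_zFam.map π
    have h2 : π (eisChar (indexWord n)) =
        subwordSum (fun a b w => π (zFam a b w)) (fun w => π (gFam w)) (indexWord n) :=
      map_gapSum π zFam 0 [] _ gFam
    rw [h2, subwordSum_indexWord hz]
    refine conv_congr fun u v huv => ⟨rfl, ?_⟩
    rw [blockValue_multiSum hz (fun k l => π (eisFn k l)) (List.range' 1 N)
      (fun k hk => map_gFam π hπ hk) fun k hk => hn k (by rw [← huv]; simp [hk])]
    simp only [map_blockGen]

lemma harmonicChar_eisensteinSh : HarmonicChar eisensteinSh where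
  nil := by rw [eisensteinSh_eq]; exact shChar_eisChar.nil
  mul {u v} hu hv := by
    rw [← sub_eq_zero]
    -- Coefficients of q^N are compared modulo q^{N+1}, where the factorisation has finitely many
    -- blocks.
    ext N
    set I : Ideal ℂ⟦X⟧ := Ideal.span {X ^ (N + 1)} with hI
    have hπ : Ideal.Quotient.mk I X ^ (N + 1) = 0 := by
      rw [← map_pow, Ideal.Quotient.eq_zero_iff_mem]
      exact Ideal.subset_span rfl
    have h := (harmonicChar_map_eisChar (Ideal.Quotient.mk I) hπ).mul hu hv
    simp only [← eisensteinSh_eq] at h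
    rw [← map_mul] at h
    have h2 := map_harmonicSum (Ideal.Quotient.mk I).toAddMonoidHom eisensteinSh u v
    have h3 : Ideal.Quotient.mk I (harmonicSum eisensteinSh u v - eisensteinSh u * eisensteinSh v) =
        0 := by
      rw [map_sub, sub_eq_zero, ← h]
      exact h2
    rw [Ideal.Quotient.eq_zero_iff_mem, hI, Ideal.mem_span_singleton, X_pow_dvd_iff] at h3
    rw [h3 N (Nat.lt_succ_self N), map_zero]

/-- The harmonic product formula for regularised multiple Eisenstein series. -/
theorem eisensteinSh_mul_harmonic (w₁ w₂ : Index) (h₁ : ∀ n ∈ w₁, 2 ≤ n) (h₂ : ∀ n ∈ w₂, 2 ≤ n) :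
    eisensteinSh w₁ * eisensteinSh w₂ = (harmonic w₁ w₂).sum fun w c => c • eisensteinSh w := by
  rw [harmonic_sum, harmonicChar_eisensteinSh.mul h₁ h₂]

end HarmonicProduct

end MES

theorem theorem4p4 (w₁ w₂ : List ℕ+) (h₁ : ∀ n ∈ w₁, 2 ≤ n) (h₂ : ∀ n ∈ w₂, 2 ≤ n) :
    MES.zgMap (MES.coproduct
      (MES.har (MES.regIdx w₁) (MES.regIdx w₂) - MES.regIdx w₁ * MES.regIdx w₂)) = 0 ∧
    MES.eisensteinSh w₁ * MES.eisensteinSh w₂ =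
      (MES.harmonic w₁ w₂).sum (fun w c => c • MES.eisensteinSh w) ∧
    MES.eisensteinSh w₁ * MES.eisensteinSh w₂ =
      (MES.shuffle (MES.indexWord w₁) (MES.indexWord w₂)).sum
        (fun w c => c • MES.eisensteinSh (MES.wordIndex w)) := by
  refine ⟨?_, MES.eisensteinSh_mul_harmonic w₁ w₂ h₁ h₂, MES.eisensteinSh_mul_shuffle w₁ w₂⟩
  -- Multiplicativity for the shuffle product evaluates the second term, linearity over the harmonic
  -- product the first; the harmonic product formula equates them.
  rw [map_sub, map_sub, MES.zgMap_coproduct_mul, MES.har_regIdx, map_finsuppSum, map_finsuppSum,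
    sub_eq_zero]
  refine Eq.trans ?_ (MES.eisensteinSh_mul_harmonic w₁ w₂ h₁ h₂).symm
  exact Finsupp.sum_congr fun w _ => by rw [map_smul, map_smul]; rfl
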